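/- Let $H(x,y)=\frac{y^2}{2}-\frac{x^2}{2}+\frac{x^4}{4}$. For $h>0$ let $\gamma(h)$ be the real oval $\{H=h\}$, oriented by the Hamiltonian vector field $\dot x=y,\ \dot y=x-x^3$, and put $I_i(h)=\oint_{\gamma(h)}x^i y\,dx$. The cycle $\gamma(h)$ extends continuously to $h\in\mathcal D=\mathbb C\setminus(-\infty,0]$ as a cycle on the complex curve $\{H=h\}$, and $I_i$ extends correspondingly to $\mathcal D$; for $h\in(-\infty,0]$ let $I_i(h)$ denote the limit value from the upper half-plane. For $(\lambda_0,\lambda_2)\in\mathbb R^2\setminus\{0\}$ let $$M_1=\lambda_0 I_0+\lambda_2 I_2 ,$$ and let $Z(M_1)\in\mathbb N\cup\{\infty\}$ be the number of zeros of $M_1$ in $\mathcal D$, counted with multiplicity. It is a function of $[\lambda_0:\lambda_2]\in\mathbb{RP}^1$; its bifurcation set $\mathbf B$ is the set of points at which it is not locally constant. Put $$P_{h_0}=\{[\lambda_0:\lambda_2]:\lambda_0I_0(h_0)+\lambda_2I_2(h_0)=0\}\ \ (h_0=0,-\tfrac14),\qquad P_\infty=\{[\lambda_0:\lambda_2]:\lambda_2=0\}.$$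 **Corollary.** For all real $\lambda_0,\lambda_2$ the function $M_1$ is holomorphic in $\mathcal D$, and 1. $\mathbf B=P_0\cup P_{-1/4}\cup P_\infty$, and these sets are single points: $P_0=\{[-\frac45:1]\}$, $P_{-1/4}=\{[-\frac15:1]\}$, $P_\infty=\{[1:0]\}$. 2. (Diagram.) With $[\lambda_0:\lambda_2]=[t:1]$: $Z(M_1)=1$ for $t\le-\frac45$; $Z(M_1)=2$ for $-\frac45<t<-\frac15$; $Z(M_1)=0$ for $t\ge-\frac15$. Moreover $Z(M_1)=0$ at $[1:0]$. In particular $Z(M_1)\le 2$ on all of $\mathbb{RP}^1$. 3. (Crossing $P_0$.) For every sufficiently small $r>0$, the function $tI_0+I_2$ has exactly one zero in $\mathcal D\cap\{|h|<r\}$, and it is simple, for all $t>-\frac45$ close enough to $-\frac45$; it has no zero there for all $t\le-\frac45$ close enough to $-\frac45$. 4. (Crossing $P_{-1/4}$.) For every sufficiently small $r>0$, the zeros of $tI_0+I_2$ in $\mathcal D\cap\{|h+\frac14|<r\}$ are exactly two distinct complex conjugate simple zeros for all $t<-\frac15$ close enough to $-\frac15$; there are none for all $t\ge-\frac15$ close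 enough to $-\frac15$. 5. (Crossing $P_\infty$.) For every sufficiently large $r$, the function $tI_0+I_2$ has exactly one zero in $\mathcal D\cap\{|h|>r\}$, and it is simple, for all $t$ close enough to $-\infty$; it has no zero there for all $t$ close enough to $+\infty$, and neither does $I_0$. -/

import Mathlib

open Filter Topology Set
open scoped LinearAlgebra.Projectivization

namespace Duffing

noncomputable section

/-- The first integral `H = y²/2 - x²/2 + x⁴/4` of the unperturbed Duffing oscillator. -/
def H (x y : ℂ) : ℂ := y ^ 2 / 2 - x ^ 2 / 2 + x ^ 4 / 4

/-- The principal branch of the square root (with `arg ∈ (-π, π]`, so it is continuous from above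
along the negative real axis). -/
def csqrt (z : ℂ) : ℂ := z ^ (1 / 2 : ℂ)

/-- The `x`-coordinate of the loop `γ(h)`. For `h > 0` the exterior oval meets the `x`-axis at
`x = ± √(1 + √(1 + 4 h))`. -/
def gammaX (h : ℂ) (t : ℝ) : ℂ := -(csqrt (1 + csqrt (1 + 4 * h)) * (Real.cos t : ℂ))

/-- The `y`-coordinate of the loop `γ(h)`, chosen so that `H (gammaX h t) (gammaY h t) = h`
(see `H_gamma`).

For `h > 0` the loop runs once over the exterior oval `{H = h}` of the real plane
(see `gamma_real`, `range_gamma`); it is oriented by the vector field `ẋ = y`, because `gammaX`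
increases exactly where `gammaY > 0`.  The loop depends continuously on `h ∈ ℂ ∖ (-∞, 0]`
(see `continuousOn_gamma`), and for `h ∈ (-∞, 0]` it is the limit loop `γ⁺(h)` from the
upper half-plane (see `continuousOn_gamma_upper`). -/
def gammaY (h : ℂ) (t : ℝ) : ℂ :=
  csqrt (1 + csqrt (1 + 4 * h)) / (Real.sqrt 2 : ℂ) * (Real.sin t : ℂ) *
    csqrt (csqrt (1 + 4 * h) * (1 + (Real.cos t : ℂ) ^ 2) - (Real.sin t : ℂ) ^ 2)

/-- The complete elliptic integral `I_i(h) = ∮_{γ(h)} x^i y dx`.  For `h ∈ (-∞, 0]` this is the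
boundary value `I_i⁺(h)` from the upper half-plane (see `continuousOn_I_upper`). -/
def I (i : ℕ) (h : ℂ) : ℂ :=
  ∫ t in (0 : ℝ)..(2 * Real.pi), gammaX h t ^ i * gammaY h t * deriv (gammaX h) t

/-- The first Melnikov function `M₁ = λ₀ I₀ + λ₂ I₂` with real coefficients. -/
def M₁ (l0 l2 : ℝ) (h : ℂ) : ℂ := (l0 : ℂ) * I 0 h + (l2 : ℂ) * I 2 h

/-- The domain `𝓓 = ℂ ∖ (-∞, 0]`. -/
def D : Set ℂ := Complex.slitPlane

/-- The number of zeros of `f` in `U`, counted with multiplicity, as the supremum in `ℕ∞` of the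
sums of the orders of vanishing over finite subsets of `U`. -/
def zeroCount (f : ℂ → ℂ) (U : Set ℂ) : ℕ∞ :=
  ⨆ (s : Finset ℂ) (_ : (s : Set ℂ) ⊆ U), ∑ z ∈ s, analyticOrderAt f z

/-- The real projective line with its quotient topology. -/
instance : TopologicalSpace (ℙ ℝ (ℝ × ℝ)) :=
  inferInstanceAs (TopologicalSpace (Quotient (projectivizationSetoid ℝ (ℝ × ℝ))))

/-- `Z(M₁)`: the number of zeros of `M₁` in `𝓓`, counted with multiplicity, as a function of
`[λ₀ : λ₂]`; it does not depend on the representative (see `Z_mk`). -/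
def Z (p : ℙ ℝ (ℝ × ℝ)) : ℕ∞ := zeroCount (M₁ p.rep.1 p.rep.2) D

/-- The bifurcation set: the points at which `Z(M₁)` is not a locally constant function. -/
def bifurcationSet : Set (ℙ ℝ (ℝ × ℝ)) := {p | ¬ ∀ᶠ q in 𝓝 p, Z q = Z p}

/-- `P_{h₀} = {[λ₀ : λ₂] : λ₀ I₀(h₀) + λ₂ I₂(h₀) = 0}` (see `mk_mem_P`). -/
def P (h₀ : ℂ) : Set (ℙ ℝ (ℝ × ℝ)) := {p | M₁ p.rep.1 p.rep.2 h₀ = 0}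

/-- `P_∞ = {[λ₀ : λ₂] : λ₂ = 0}`. -/
def PInf : Set (ℙ ℝ (ℝ × ℝ)) := {p | p.rep.2 = 0}

/-- The point `[t : 1]` of the projective line. -/
def pt (t : ℝ) : ℙ ℝ (ℝ × ℝ) := Projectivization.mk ℝ (t, 1) (by simp)

/-- The point `[1 : 0]` of the projective line. -/
def ptInf : ℙ ℝ (ℝ × ℝ) := Projectivization.mk ℝ (1, 0) (by simp)

/-- `f` has no zero in `S`. -/
def NoZeroIn (f : ℂ → ℂ) (S : Set ℂ) : Prop := {w ∈ S | f w = 0} = ∅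

/-- `f` has exactly one zero in `S`, and it is simple. -/
def OneSimpleZeroIn (f : ℂ → ℂ) (S : Set ℂ) : Prop :=
  ∃ z, {w ∈ S | f w = 0} = {z} ∧ analyticOrderAt f z = 1

/-- The zeros of `f` in `S` are exactly two distinct, complex conjugate, simple zeros. -/
def ConjPairOfZerosIn (f : ℂ → ℂ) (S : Set ℂ) : Prop :=
  ∃ z, z.im ≠ 0 ∧ {w ∈ S | f w = 0} = {z, (starRingEnd ℂ) z} ∧
    analyticOrderAt f z = 1 ∧ analyticOrderAt f ((starRingEnd ℂ) z) = 1

/-! Facts which confirm that the definitions are the intended ones. -/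

theorem csqrt_sq (z : ℂ) : csqrt z ^ 2 = z := by
  unfold csqrt
  simp

theorem csqrt_ofReal {x : ℝ} (hx : 0 ≤ x) : csqrt (x : ℂ) = (Real.sqrt x : ℂ) := by
  unfold csqrt
  rw [Real.sqrt_eq_rpow, Complex.ofReal_cpow hx]
  norm_num

/-- The loop `γ(h)` lies on the level curve `Γ_h = {H = h}`. -/
theorem H_gamma (h : ℂ) (t : ℝ) : H (gammaX h t) (gammaY h t) = h := by
  unfold H gammaX gammaY
  have h1 := csqrt_sq (1 + 4 * h)
  set s := csqrt (1 + 4 * h)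
  have h2 := csqrt_sq (1 + s)
  set a := csqrt (1 + s)
  have h3 := csqrt_sq (s * (1 + (Real.cos t : ℂ) ^ 2) - (Real.sin t : ℂ) ^ 2)
  set r := csqrt (s * (1 + (Real.cos t : ℂ) ^ 2) - (Real.sin t : ℂ) ^ 2)
  have h4 : (Real.sqrt 2 : ℂ) ^ 2 = 2 := by
    rw [← Complex.ofReal_pow, Real.sq_sqrt (by norm_num)]; norm_num
  have h5 : (Real.sin t : ℂ) ^ 2 = 1 - (Real.cos t : ℂ) ^ 2 := by
    have := Real.sin_sq t
    rw [← Complex.ofReal_pow, this]; push_cast; ring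
  have e1 : (a / (Real.sqrt 2 : ℂ) * (Real.sin t : ℂ) * r) ^ 2
      = a ^ 2 / (Real.sqrt 2 : ℂ) ^ 2 * (Real.sin t : ℂ) ^ 2 * r ^ 2 := by ring
  have e2 : (-(a * (Real.cos t : ℂ))) ^ 2 = a ^ 2 * (Real.cos t : ℂ) ^ 2 := by ring
  have e3 : (-(a * (Real.cos t : ℂ))) ^ 4 = (a ^ 2) ^ 2 * (Real.cos t : ℂ) ^ 4 := by ring
  rw [e1, e2, e3, h4, h3, h2, h5]
  linear_combination (1 / 4) * h1

/-- For `h > 0` the loop `γ(h)` lies in the real plane. -/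
theorem gamma_real {h : ℝ} (hh : 0 < h) (t : ℝ) :
    gammaX h t = ((-(√(1 + √(1 + 4 * h)) * Real.cos t) : ℝ) : ℂ) ∧
    gammaY h t = ((√(1 + √(1 + 4 * h)) / √2 * Real.sin t *
      √(√(1 + 4 * h) * (1 + Real.cos t ^ 2) - Real.sin t ^ 2) : ℝ) : ℂ) := by
  have hs : 1 ≤ √(1 + 4 * h) := by
    rw [Real.one_le_sqrt]; linarith
  have e1 : csqrt (1 + 4 * (h : ℂ)) = (√(1 + 4 * h) : ℂ) := by
    rw [← csqrt_ofReal (by linarith)]; push_cast; rfl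
  have e2 : csqrt (1 + (√(1 + 4 * h) : ℂ)) = (√(1 + √(1 + 4 * h)) : ℂ) := by
    have := csqrt_ofReal (x := 1 + √(1 + 4 * h)) (by linarith)
    rw [← this, Complex.ofReal_add, Complex.ofReal_one]
  have hn : 0 ≤ √(1 + 4 * h) * (1 + Real.cos t ^ 2) - Real.sin t ^ 2 := by
    have := Real.sin_sq_le_one t
    nlinarith [sq_nonneg (Real.cos t)]
  have e3 : csqrt ((√(1 + 4 * h) : ℂ) * (1 + (Real.cos t : ℂ) ^ 2) - (Real.sin t : ℂ) ^ 2)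
      = (√(√(1 + 4 * h) * (1 + Real.cos t ^ 2) - Real.sin t ^ 2) : ℂ) := by
    rw [← csqrt_ofReal hn]; push_cast; rfl
  constructor
  · unfold gammaX
    rw [e1, e2]; push_cast; rfl
  · unfold gammaY
    rw [e1, e2, e3]; push_cast; rfl

/-- For `h > 0` the loop `γ(h)` covers the whole level set `{H = h}` of the real plane. -/
theorem range_gamma {h : ℝ} (hh : 0 < h) (x y : ℝ) (hxy : H x y = h) :
    ∃ t ∈ Ico (0 : ℝ) (2 * Real.pi), gammaX h t = x ∧ gammaY h t = y := by
  have hs : 1 ≤ √(1 + 4 * h) := by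
    rw [Real.one_le_sqrt]; linarith
  have hs2 : √(1 + 4 * h) ^ 2 = 1 + 4 * h := Real.sq_sqrt (by linarith)
  have ha2 : √(1 + √(1 + 4 * h)) ^ 2 = 1 + √(1 + 4 * h) := Real.sq_sqrt (by linarith)
  have hapos : 0 < √(1 + √(1 + 4 * h)) := Real.sqrt_pos.2 (by linarith)
  have hH : y ^ 2 / 2 - x ^ 2 / 2 + x ^ 4 / 4 = h := by
    unfold H at hxy; exact_mod_cast hxy
  have hf := gamma_real hh
  set s := √(1 + 4 * h)
  set a := √(1 + s)
  have hx2 : x ^ 2 ≤ a ^ 2 := by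
    rw [ha2]
    by_contra hc
    push Not at hc
    nlinarith [sq_nonneg y]
  have hxa : |x| ≤ a := abs_le_of_sq_le_sq hx2 hapos.le
  obtain ⟨hx1, hx3⟩ := abs_le.1 hxa
  have hc1 : -1 ≤ -x / a := by rw [le_div_iff₀ hapos]; linarith
  have hc2 : -x / a ≤ 1 := by rw [div_le_iff₀ hapos]; linarith
  have hy : ∀ t : ℝ, Real.cos t = -x / a → (a / √2 * Real.sin t *
      √(s * (1 + Real.cos t ^ 2) - Real.sin t ^ 2)) ^ 2 = y ^ 2 := by
    intro t ht
    have hn : 0 ≤ s * (1 + Real.cos t ^ 2) - Real.sin t ^ 2 := by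
      have := Real.sin_sq_le_one t
      nlinarith [sq_nonneg (Real.cos t)]
    have hxc : x ^ 2 = a ^ 2 * Real.cos t ^ 2 := by rw [ht]; field_simp
    have e : (a / √2 * Real.sin t * √(s * (1 + Real.cos t ^ 2) - Real.sin t ^ 2)) ^ 2
        = a ^ 2 / √2 ^ 2 * Real.sin t ^ 2 *
          √(s * (1 + Real.cos t ^ 2) - Real.sin t ^ 2) ^ 2 := by ring
    rw [e, Real.sq_sqrt hn, Real.sq_sqrt (x := 2) (by norm_num), Real.sin_sq, ha2]
    rw [ha2] at hxc
    have h4 : x ^ 4 = ((1 + s) * Real.cos t ^ 2) ^ 2 := by rw [← hxc]; ring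
    linear_combination (-2) * hH - hxc + (1 / 2) * h4 + (1 / 2) * hs2
  have hxt : ∀ t : ℝ, Real.cos t = -x / a → -(a * Real.cos t) = x := by
    intro t ht; rw [ht]; field_simp
  have hsin : 0 ≤ Real.sin (Real.arccos (-x / a)) :=
    Real.sin_nonneg_of_nonneg_of_le_pi (Real.arccos_nonneg _) (Real.arccos_le_pi _)
  have hcos := Real.cos_arccos hc1 hc2
  have hr : ∀ t : ℝ, 0 ≤ √(s * (1 + Real.cos t ^ 2) - Real.sin t ^ 2) :=
    fun t => Real.sqrt_nonneg _
  have hpi := Real.pi_pos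
  by_cases hy0 : 0 ≤ y
  · refine ⟨Real.arccos (-x / a), ⟨Real.arccos_nonneg _, ?_⟩, ?_, ?_⟩
    · linarith [Real.arccos_le_pi (-x / a)]
    · rw [(hf _).1, hxt _ hcos]
    · rw [(hf _).2]
      congr 1
      exact (sq_eq_sq₀ (by have := hr (Real.arccos (-x / a)); positivity) hy0).1 (hy _ hcos)
  · push Not at hy0
    have hcos' : Real.cos (2 * Real.pi - Real.arccos (-x / a)) = -x / a := by
      rw [Real.cos_two_pi_sub, hcos]
    have hsin' : 0 ≤ -Real.sin (2 * Real.pi - Real.arccos (-x / a)) := by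
      rw [Real.sin_two_pi_sub]; linarith
    refine ⟨2 * Real.pi - Real.arccos (-x / a), ⟨?_, ?_⟩, ?_, ?_⟩
    · linarith [Real.arccos_le_pi (-x / a)]
    · rcases (Real.arccos_nonneg (-x / a)).eq_or_lt with h0 | h0
      · exfalso
        have := hy _ hcos
        rw [← h0] at this
        simp at this
        exact hy0.ne (by simpa using this.symm)
      · linarith
    · rw [(hf _).1, hxt _ hcos']
    · rw [(hf _).2]
      congr 1
      have hk := hy _ hcos'
      have hr' := hr (2 * Real.pi - Real.arccos (-x / a))
      have := (sq_eq_sq₀ (a := -(a / √2 * Real.sin (2 * Real.pi - Real.arccos (-x / a)) *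
        √(s * (1 + Real.cos (2 * Real.pi - Real.arccos (-x / a)) ^ 2)
          - Real.sin (2 * Real.pi - Real.arccos (-x / a)) ^ 2))) (b := -y)
        (by
          have : 0 ≤ a / √2 * (-Real.sin (2 * Real.pi - Real.arccos (-x / a))) *
            √(s * (1 + Real.cos (2 * Real.pi - Real.arccos (-x / a)) ^ 2)
            - Real.sin (2 * Real.pi - Real.arccos (-x / a)) ^ 2) := by positivity
          linarith) (by linarith)).1 (by rw [neg_sq, neg_sq]; exact hk)
      linarith

theorem csqrt_re_nonneg (z : ℂ) : 0 ≤ (csqrt z).re := by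
  by_cases hz : z = 0
  · subst hz; simp [csqrt]
  · have := Complex.abs_arg_le_pi z
    unfold csqrt
    rw [Complex.cpow_def_of_ne_zero hz, Complex.exp_re]
    have e : (Complex.log z * (1 / 2)).im = Complex.arg z / 2 := by
      rw [show (1 / 2 : ℂ) = ((1 / 2 : ℝ) : ℂ) by norm_num, Complex.im_mul_ofReal, Complex.log_im]
      ring
    rw [e]
    have h2 := abs_le.1 this
    exact mul_nonneg (Real.exp_pos _).le
      (Real.cos_nonneg_of_mem_Icc ⟨by linarith, by linarith⟩)

theorem csqrt_im_nonneg {z : ℂ} (hz0 : 0 ≤ z.im) : 0 ≤ (csqrt z).im := by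
  by_cases hz : z = 0
  · subst hz; simp [csqrt]
  · have h1 := Complex.arg_nonneg_iff.2 hz0
    have h2 := Complex.arg_le_pi z
    unfold csqrt
    rw [Complex.cpow_def_of_ne_zero hz, Complex.exp_im]
    have e : (Complex.log z * (1 / 2)).im = Complex.arg z / 2 := by
      rw [show (1 / 2 : ℂ) = ((1 / 2 : ℝ) : ℂ) by norm_num, Complex.im_mul_ofReal, Complex.log_im]
      ring
    rw [e]
    exact mul_nonneg (Real.exp_pos _).le
      (Real.sin_nonneg_of_nonneg_of_le_pi (by linarith) (by linarith [Real.pi_pos]))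

theorem continuousAt_csqrt {z : ℂ} (hz : z ∈ Complex.slitPlane) : ContinuousAt csqrt z :=
  continuousAt_id.cpow continuousAt_const hz

theorem continuousOn_csqrt_upper : ContinuousOn csqrt {z | 0 ≤ z.im} := by
  intro z hz
  by_cases h0 : z = 0
  · subst h0
    have : ContinuousAt (fun z : ℂ => z ^ (1 / 2 : ℂ)) 0 := by
      have := Complex.continuousAt_cpow_zero_of_re_pos (z := (1 / 2 : ℂ)) (by norm_num)
      exact ContinuousAt.comp (f := fun z : ℂ => (z, (1 / 2 : ℂ))) (x := 0)
        this (by fun_prop)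
    exact this.continuousWithinAt
  by_cases hs : z ∈ Complex.slitPlane
  · exact (continuousAt_csqrt hs).continuousWithinAt
  · have h1 : z.im = 0 := by
      by_contra hc; exact hs (Or.inr hc)
    have h2 : z.re < 0 := by
      rcases lt_trichotomy z.re 0 with h | h | h
      · exact h
      · exact absurd (Complex.ext h h1) h0
      · exact absurd (Or.inl h) hs
    have hl := Complex.continuousWithinAt_log_of_re_neg_of_im_zero h2 h1
    have hc : ContinuousWithinAt (fun w => Complex.exp (Complex.log w * (1 / 2)))
        {z | 0 ≤ z.im} z :=
      (Complex.continuous_exp.continuousAt).comp_continuousWithinAt (hl.mul_const _)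
    refine hc.congr_of_eventuallyEq ?_ (by simp [csqrt, Complex.cpow_def_of_ne_zero h0])
    filter_upwards [mem_nhdsWithin_of_mem_nhds (isOpen_ne.mem_nhds h0)] with w hw
    simp only [csqrt]
    exact Complex.cpow_def_of_ne_zero hw _

/-- The loop `γ(h)` depends continuously on `h ∈ 𝓓`. -/
theorem continuousOn_gamma :
    ContinuousOn (fun q : ℂ × ℝ => (gammaX q.1 q.2, gammaY q.1 q.2)) (D ×ˢ univ) := by
  rintro ⟨h, t⟩ ⟨hh, -⟩
  apply ContinuousAt.continuousWithinAt
  have hh' : h ∈ Complex.slitPlane := hh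
  have k1 : 1 + 4 * h ∈ Complex.slitPlane := by
    rw [Complex.mem_slitPlane_iff] at hh' ⊢
    rcases hh' with h' | h'
    · left; simp; linarith
    · right; simpa using h'
  have c1 : ContinuousAt (fun q : ℂ × ℝ => csqrt (1 + 4 * q.1)) (h, t) :=
    ContinuousAt.comp (f := fun q : ℂ × ℝ => 1 + 4 * q.1) (x := (h, t))
      (continuousAt_csqrt k1) (by fun_prop)
  have k2 : 1 + csqrt (1 + 4 * h) ∈ Complex.slitPlane := by
    left; simp; linarith [csqrt_re_nonneg (1 + 4 * h)]
  have c2 : ContinuousAt (fun q : ℂ × ℝ => csqrt (1 + csqrt (1 + 4 * q.1))) (h, t) :=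
    ContinuousAt.comp (f := fun q : ℂ × ℝ => 1 + csqrt (1 + 4 * q.1)) (x := (h, t))
      (continuousAt_csqrt k2) (by fun_prop)
  have k3 : csqrt (1 + 4 * h) * (1 + (Real.cos t : ℂ) ^ 2) - (Real.sin t : ℂ) ^ 2
      ∈ Complex.slitPlane := by
    have hsq := csqrt_sq (1 + 4 * h)
    have hre := csqrt_re_nonneg (1 + 4 * h)
    set s := csqrt (1 + 4 * h)
    have e : s * (1 + (Real.cos t : ℂ) ^ 2) - (Real.sin t : ℂ) ^ 2
        = s * ((1 + Real.cos t ^ 2 : ℝ) : ℂ) - ((Real.sin t ^ 2 : ℝ) : ℂ) := by push_cast; rfl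
    rw [e, Complex.mem_slitPlane_iff]
    simp only [Complex.sub_re, Complex.sub_im, Complex.re_mul_ofReal, Complex.im_mul_ofReal,
      Complex.ofReal_re, Complex.ofReal_im, sub_zero]
    by_cases him : s.im = 0
    · left
      have h1 : s.re ^ 2 = 1 + 4 * h.re := by
        have := congrArg Complex.re hsq
        simp [pow_two, him] at this
        rw [pow_two]; exact this
      have h2 : h.im = 0 := by
        have := congrArg Complex.im hsq
        simp [pow_two, him] at this
        exact this
      have h3 : 0 < h.re := by
        rcases hh' with h' | h'
        · exact h'
        · exact absurd h2 h'
      have h4 : 1 < s.re := by nlinarith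
      have := Real.sin_sq_le_one t
      nlinarith [sq_nonneg (Real.cos t)]
    · right
      exact mul_ne_zero him (by positivity)
  have c3 : ContinuousAt (fun q : ℂ × ℝ => csqrt (csqrt (1 + 4 * q.1) *
      (1 + (Real.cos q.2 : ℂ) ^ 2) - (Real.sin q.2 : ℂ) ^ 2)) (h, t) :=
    ContinuousAt.comp (f := fun q : ℂ × ℝ => csqrt (1 + 4 * q.1) *
      (1 + (Real.cos q.2 : ℂ) ^ 2) - (Real.sin q.2 : ℂ) ^ 2) (x := (h, t))
      (continuousAt_csqrt k3) (by fun_prop)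
  unfold gammaX gammaY
  fun_prop

/-- The loop `γ(h)` is continuous in `h` on the closed upper half-plane; for `h ∈ (-∞, 0]` it is
the limit `γ⁺(h)`. -/
theorem continuousOn_gamma_upper :
    ContinuousOn (fun q : ℂ × ℝ => (gammaX q.1 q.2, gammaY q.1 q.2))
      ({h | 0 ≤ h.im} ×ˢ univ) := by
  have c1 : ContinuousOn (fun q : ℂ × ℝ => csqrt (1 + 4 * q.1)) ({h | 0 ≤ h.im} ×ˢ univ) := by
    refine continuousOn_csqrt_upper.comp (by fun_prop) ?_
    rintro ⟨h, t⟩ ⟨hh, -⟩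
    simpa using hh
  have p1 : ∀ h : ℂ, 0 ≤ h.im → 0 ≤ (csqrt (1 + 4 * h)).im := fun h hh =>
    csqrt_im_nonneg (by simpa using hh)
  have c2 : ContinuousOn (fun q : ℂ × ℝ => csqrt (1 + csqrt (1 + 4 * q.1)))
      ({h | 0 ≤ h.im} ×ˢ univ) := by
    refine continuousOn_csqrt_upper.comp (by fun_prop) ?_
    rintro ⟨h, t⟩ ⟨hh, -⟩
    simpa using p1 h hh
  have c3 : ContinuousOn (fun q : ℂ × ℝ => csqrt (csqrt (1 + 4 * q.1) *
      (1 + (Real.cos q.2 : ℂ) ^ 2) - (Real.sin q.2 : ℂ) ^ 2)) ({h | 0 ≤ h.im} ×ˢ univ) := by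
    refine continuousOn_csqrt_upper.comp (by fun_prop) ?_
    rintro ⟨h, t⟩ ⟨hh, -⟩
    have e : csqrt (1 + 4 * h) * (1 + (Real.cos t : ℂ) ^ 2) - (Real.sin t : ℂ) ^ 2
        = csqrt (1 + 4 * h) * ((1 + Real.cos t ^ 2 : ℝ) : ℂ) - ((Real.sin t ^ 2 : ℝ) : ℂ) := by
      push_cast; rfl
    have := p1 h hh
    change 0 ≤ (csqrt (1 + 4 * h) * (1 + (Real.cos t : ℂ) ^ 2) - (Real.sin t : ℂ) ^ 2).im
    rw [e, Complex.sub_im, Complex.im_mul_ofReal, Complex.ofReal_im]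
    simp only [sub_zero]
    positivity
  unfold gammaX gammaY
  fun_prop

theorem deriv_gammaX (h : ℂ) (t : ℝ) :
    deriv (gammaX h) t = csqrt (1 + csqrt (1 + 4 * h)) * (Real.sin t : ℂ) := by
  have h1 : HasDerivAt (fun t : ℝ => (Real.cos t : ℂ)) ((-Real.sin t : ℝ) : ℂ) t :=
    (Real.hasDerivAt_cos t).ofReal_comp
  have := ((h1.const_mul (csqrt (1 + csqrt (1 + 4 * h)))).neg).deriv
  unfold gammaX
  refine Eq.trans this ?_
  push_cast; ring

theorem continuousOn_integral {S : Set ℂ} {g : ℂ → ℝ → ℂ}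
    (hg : ContinuousOn (fun q : ℂ × ℝ => g q.1 q.2) (S ×ˢ univ)) (a b : ℝ) :
    ContinuousOn (fun h => ∫ t in a..b, g h t) S := by
  rw [continuousOn_iff_continuous_domRestrict]
  have hj : Continuous (fun q : S × ℝ => ((q.1 : ℂ), q.2)) :=
    (continuous_subtype_val.comp continuous_fst).prodMk continuous_snd
  have hF : Continuous (Function.uncurry (fun (h : S) (t : ℝ) => g h t)) :=
    hg.comp_continuous hj (fun q => mem_prod.2 ⟨q.1.2, mem_univ _⟩)
  exact intervalIntegral.continuous_parametric_intervalIntegral_of_continuous'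
    (μ := MeasureTheory.volume) hF a b

/-- On `(-∞, 0]` the integrals `I_i` take their limit values from the upper half-plane. -/
theorem continuousOn_I_upper (i : ℕ) : ContinuousOn (I i) {h | 0 ≤ h.im} := by
  have hX := continuousOn_gamma_upper.fst
  have hY := continuousOn_gamma_upper.snd
  have h0 : ContinuousOn (fun q : ℂ × ℝ => gammaX q.1 0) ({h | 0 ≤ h.im} ×ˢ univ) := by
    have hm : Continuous (fun q : ℂ × ℝ => (q.1, (0 : ℝ))) :=
      continuous_fst.prodMk continuous_const
    refine ContinuousOn.comp (f := fun q : ℂ × ℝ => (q.1, (0 : ℝ)))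
      (g := fun q : ℂ × ℝ => gammaX q.1 q.2) hX hm.continuousOn ?_
    intro q hq
    exact mem_prod.2 ⟨(mem_prod.1 hq).1, mem_univ _⟩
  have hs : Continuous (fun q : ℂ × ℝ => (Real.sin q.2 : ℂ)) :=
    Complex.continuous_ofReal.comp (Real.continuous_sin.comp continuous_snd)
  have hd : ContinuousOn (fun q : ℂ × ℝ => deriv (gammaX q.1) q.2)
      ({h | 0 ≤ h.im} ×ˢ univ) := by
    refine (h0.neg.mul hs.continuousOn).congr fun q _ => ?_
    simp [deriv_gammaX, gammaX]
  exact continuousOn_integral (g := fun h t => gammaX h t ^ i * gammaY h t * deriv (gammaX h) t)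
    (((hX.pow i).mul hY).mul hd) 0 (2 * Real.pi)

theorem analyticOrderAt_const_mul {c : ℂ} (hc : c ≠ 0) (f : ℂ → ℂ) (z : ℂ) :
    analyticOrderAt (fun w => c * f w) z = analyticOrderAt f z := by
  by_cases hf : AnalyticAt ℂ f z
  · have h1 : AnalyticAt ℂ (fun _ : ℂ => c) z := analyticAt_const
    have := analyticOrderAt_mul h1 hf
    rw [show (fun w => c * f w) = (fun _ : ℂ => c) * f from rfl, this,
      h1.analyticOrderAt_eq_zero.2 hc, zero_add]
  · rw [analyticOrderAt_of_not_analyticAt hf, analyticOrderAt_of_not_analyticAt]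
    intro hcf
    apply hf
    have := (analyticAt_const (v := c⁻¹)).mul hcf
    refine this.congr (Eventually.of_forall fun w => ?_)
    simp [hc]

theorem M₁_smul (c l0 l2 : ℝ) : M₁ (c * l0) (c * l2) = fun h => (c : ℂ) * M₁ l0 l2 h := by
  funext h; unfold M₁; push_cast; ring

theorem exists_rep (v : ℝ × ℝ) (hv : v ≠ 0) : ∃ c : ℝ, c ≠ 0 ∧
    (Projectivization.mk ℝ v hv).rep = (c * v.1, c * v.2) := by
  obtain ⟨a, ha⟩ := Projectivization.exists_smul_eq_mk_rep ℝ v hv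
  exact ⟨a, a.ne_zero, by rw [← ha]; rfl⟩

/-- `Z` may be computed with any representative. -/
theorem Z_mk (v : ℝ × ℝ) (hv : v ≠ 0) :
    Z (Projectivization.mk ℝ v hv) = zeroCount (M₁ v.1 v.2) D := by
  obtain ⟨c, hc, e⟩ := exists_rep v hv
  unfold Z zeroCount
  rw [e, M₁_smul]
  simp only [analyticOrderAt_const_mul (Complex.ofReal_ne_zero.2 hc)]

/-- Membership in `P h₀` may be tested on any representative. -/
theorem mk_mem_P (h₀ : ℂ) (v : ℝ × ℝ) (hv : v ≠ 0) :
    Projectivization.mk ℝ v hv ∈ P h₀ ↔ M₁ v.1 v.2 h₀ = 0 := by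
  obtain ⟨c, hc, e⟩ := exists_rep v hv
  unfold P
  rw [mem_ofPred_eq, e, M₁_smul]
  simp [hc]

/-- Membership in `P_∞` may be tested on any representative. -/
theorem mk_mem_PInf (v : ℝ × ℝ) (hv : v ≠ 0) :
    Projectivization.mk ℝ v hv ∈ PInf ↔ v.2 = 0 := by
  obtain ⟨c, hc, e⟩ := exists_rep v hv
  unfold PInf
  rw [mem_ofPred_eq, e]
  simp [hc]

end

end Duffing

open Duffing

namespace Duffing

/-! Since `I 0` has no zero in 𝓓, the zeros of `t I₀ + I₂` are, with multiplicity, the solutions of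
`quot h = -t`, where `quot = I₂ / I₀`. The problem becomes how often `quot` takes a real value `τ =
-t` in 𝓓.

Such a count changes with `τ` only if a solution reaches the boundary of 𝓓, and infinity is excluded
for bounded `τ` because `quot` is proper (`exists_norm_quot_gt`). On the upper side of the cut
`quot` is real only at `-1/4`, with value `1/5`, and at `0`, with value `4/5` (`mem_D_of_quot_eq`).
The lower side follows by conjugation. Hence the count is constant on the three intervals cut out by
`1/5` and `4/5` (`eventually_solCount_D`). - For `τ < 1/5` it is the count at `τ = 0`, and `I₂` has
no zeros in 𝓓. - For `τ > 4/5` it is at most one, because `quot` is injective near infinity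
(`exists_injOn_quot`), and at least one, by the intermediate value theorem on `h > 0`. - For `1/5 <
τ < 4/5` the open upper half-plane contains at most one solution (`solCount_upperOpen_le_one`). Its
level is shifted to `τ + iε` and carried to `+∞`, which no boundary value obstructs; then `ε → 0`.
Solutions exist because `quot` drops below `4/5` to the right of `h = 0`. At `τ = 1/4` none of them
is real, since `quot ≥ 1/2` on `h > 0`. So there is exactly one conjugate pair of simple solutions.

At the two critical levels, lower semicontinuity of the count (`le_zeroCount_of_frequently`) bounds
it by its value on a neighbouring interval. The crossings follow by locating the solutions at each
critical level and subtracting counts.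

The boundary behaviour is studied in `s = √(1 + 4h)`, in which `√2 I₀` and `√2 I₂` become `N0` and
`N2`, solutions of a linear Picard–Fuchs system. For `h < -1/4`, `s` is purely imaginary, the system
is real there, and Liouville's formula makes the Wronskian `Im (N2 · conj N0)` of constant sign
(`wronskian_pos`). For `-1/4 < h < 0` a comparison of averages of `cos²` gives the opposite sign
(`ratio_im_neg`). The endpoint values have elementary antiderivatives. -/

/-! ### Counting the solutions of `f z = τ` -/

/-- The zeros of `f` in `U` form a finite set, and their orders add up to `k`. -/
def HasCount (f : ℂ → ℂ) (U : Set ℂ) (k : ℕ∞) : Prop :=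
  ∃ s : Finset ℂ, (s : Set ℂ) = {z ∈ U | f z = 0} ∧ ∑ z ∈ s, analyticOrderAt f z = k

theorem sum_le_zeroCount (f : ℂ → ℂ) {U : Set ℂ} {s : Finset ℂ} (hs : (s : Set ℂ) ⊆ U) :
    ∑ z ∈ s, analyticOrderAt f z ≤ zeroCount f U :=
  le_iSup₂_of_le s hs le_rfl

theorem zeroCount_le_iff {f : ℂ → ℂ} {U : Set ℂ} {k : ℕ∞} : zeroCount f U ≤ k ↔
    ∀ s : Finset ℂ, (s : Set ℂ) ⊆ U → ∑ z ∈ s, analyticOrderAt f z ≤ k :=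
  iSup₂_le_iff

theorem zeroCount_mono (f : ℂ → ℂ) {U V : Set ℂ} (h : U ⊆ V) : zeroCount f U ≤ zeroCount f V :=
  zeroCount_le_iff.2 fun _ hs => sum_le_zeroCount f (hs.trans h)

theorem HasCount.zeroCount_eq {f : ℂ → ℂ} {U : Set ℂ} {k : ℕ∞} (h : HasCount f U k) :
    zeroCount f U = k := by
  obtain ⟨s, hs, rfl⟩ := h
  apply le_antisymm
  · refine zeroCount_le_iff.2 fun t ht => Finset.sum_le_sum_of_ne_zero fun z hz h0 => ?_
    rw [← Finset.mem_coe, hs]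
    exact ⟨ht hz, (analyticOrderAt_ne_zero.1 h0).2⟩
  · exact sum_le_zeroCount f (hs.trans_subset (sep_subset _ _))

theorem HasCount.of_subset {f : ℂ → ℂ} {U V : Set ℂ} {k : ℕ∞} (h : HasCount f U k) (hUV : U ⊆ V)
    (hV : ∀ z ∈ V, f z = 0 → z ∈ U) : HasCount f V k := by
  obtain ⟨s, hs, h⟩ := h
  refine ⟨s, ?_, h⟩
  rw [hs]
  ext z
  exact ⟨fun hz => ⟨hUV hz.1, hz.2⟩, fun hz => ⟨hV z hz.1 hz.2, hz.2⟩⟩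

theorem zeroCount_congr {f g : ℂ → ℂ} {U : Set ℂ}
    (h : ∀ z ∈ U, analyticOrderAt f z = analyticOrderAt g z) : zeroCount f U = zeroCount g U := by
  unfold zeroCount
  congr! 3 with s hs
  exact Finset.sum_congr rfl fun z hz => h z (hs hz)

theorem zeroCount_eq_zero {f : ℂ → ℂ} {U : Set ℂ} (h : ∀ z ∈ U, f z ≠ 0) : zeroCount f U = 0 := by
  refine HasCount.zeroCount_eq ⟨∅, ?_, by simp⟩
  ext z
  simpa using h z

/-- Near a point where `f` takes a value `k` times, it takes all nearby values `k` times. -/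
theorem exists_hasCount_of_order {f : ℂ → ℂ} {z₀ : ℂ} (hf : AnalyticAt ℂ f z₀) {k : ℕ}
    (hk : analyticOrderAt (fun z => f z - f z₀) z₀ = k) {V : Set ℂ} (hV : V ∈ 𝓝 z₀) :
    ∃ B ⊆ V, B ∈ 𝓝 z₀ ∧ ∀ᶠ τ in 𝓝 (f z₀), HasCount (fun z => f z - τ) B k := by
  have hk0 : k ≠ 0 := by
    rintro rfl
    have := (analyticOrderAt_eq_zero.1 (by simpa using hk))
    rcases this with h | h
    · exact h (hf.sub analyticAt_const)
    · simp at h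
  obtain ⟨g, hg, hg0, hfg⟩ :=
    ((hf.sub (analyticAt_const (v := f z₀))).analyticOrderAt_eq_natCast (n := k)).1 hk
  obtain ⟨c, hc⟩ := IsAlgClosed.exists_pow_nat_eq (g z₀) (Nat.pos_of_ne_zero hk0)
  have hc0 : c ≠ 0 := by
    rintro rfl
    rw [zero_pow hk0] at hc
    exact hg0 hc.symm
  -- A holomorphic `k`-th root of `g` near `z₀`: division by `g z₀` moves the value at `z₀` to `1`,
  -- off the branch cut, and `c` restores the factor.
  set ρ : ℂ → ℂ := fun z => c * (g z / g z₀) ^ ((1 : ℂ) / k) with hρ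
  have hρa : AnalyticAt ℂ ρ z₀ := by
    refine analyticAt_const.mul (AnalyticAt.cpow (hg.div analyticAt_const hg0) analyticAt_const ?_)
    simp [div_self hg0]
  have hρ0 : ρ z₀ = c := by simp [hρ, div_self hg0]
  have hρk : ∀ z, ρ z ^ k = g z := by
    intro z
    have hkc : (k : ℂ) ≠ 0 := Nat.cast_ne_zero.2 hk0
    rw [hρ, mul_pow, hc, ← Complex.cpow_nat_mul, mul_one_div_cancel hkc, Complex.cpow_one]
    field_simp
  -- Near `z₀`, `f - f z₀ = φ ^ k` with `φ` a local coordinate. The solutions of `f = τ` therefore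
  -- correspond to the `k`-th roots of `τ - f z₀`: one root with order `k`, or `k` distinct roots
  -- giving simple solutions.
  set φ : ℂ → ℂ := fun z => (z - z₀) * ρ z with hφ
  have hφa : AnalyticAt ℂ φ z₀ := (analyticAt_id.sub analyticAt_const).mul hρa
  have hφ0 : φ z₀ = 0 := by simp [hφ]
  have hφd : deriv φ z₀ = c := by
    have h1 := ((hasDerivAt_id z₀).sub_const z₀).mul hρa.differentiableAt.hasDerivAt
    have := h1.deriv
    simp only [id, sub_self, zero_mul, add_zero, one_mul, hρ0] at this
    exact this
  have hstrict : HasStrictDerivAt φ c z₀ := hφd ▸ hφa.hasStrictDerivAt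
  have hsf : HasStrictFDerivAt φ
      ((ContinuousLinearEquiv.unitsEquivAut ℂ (Units.mk0 c hc0) : ℂ ≃L[ℂ] ℂ) : ℂ →L[ℂ] ℂ) z₀ :=
    hstrict.hasStrictFDerivAt_equiv hc0
  set e := hsf.toOpenPartialHomeomorph φ with he
  have hes : z₀ ∈ e.source := hsf.mem_toOpenPartialHomeomorph_source
  have hecoe : ∀ z, e z = φ z := fun z => rfl
  have hdne : ∀ᶠ z in 𝓝 z₀, deriv φ z ≠ 0 :=
    hφa.deriv.continuousAt.eventually_ne (by rw [hφd]; exact hc0)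
  have hev : ∀ᶠ z in 𝓝 z₀, z ∈ e.source ∧ z ∈ V ∧ (f z - f z₀ = φ z ^ k) ∧ AnalyticAt ℂ φ z ∧
      deriv φ z ≠ 0 ∧ AnalyticAt ℂ f z := by
    filter_upwards [e.open_source.mem_nhds hes, hV, hfg, hφa.eventually_analyticAt, hdne,
      hf.eventually_analyticAt] with z h1 h2 h3 h4 h5 h6
    refine ⟨h1, h2, ?_, h4, h5, h6⟩
    have h3' : f z - f z₀ = (z - z₀) ^ k • g z := h3
    rw [h3', hφ, mul_pow, hρk, smul_eq_mul]
  obtain ⟨N, hN, hNo, hzN⟩ := eventually_nhds_iff.1 hev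
  have himg : e '' N ∈ 𝓝 (0 : ℂ) := by
    have : e '' N ∈ 𝓝 (e z₀) := e.image_mem_nhds hes (hNo.mem_nhds hzN)
    rwa [hecoe, hφ0] at this
  obtain ⟨r, hr, hball⟩ := Metric.mem_nhds_iff.1 himg
  have hinj : ∀ z ∈ N, ∀ w ∈ N, φ z = φ w → z = w := fun z hz w hw h =>
    e.injOn (hN z hz).1 (hN w hw).1 h
  refine ⟨N ∩ φ ⁻¹' Metric.ball 0 r, fun z hz => (hN z hz.1).2.1, ?_, ?_⟩
  · refine inter_mem (hNo.mem_nhds hzN) (hφa.continuousAt.preimage_mem_nhds ?_)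
    rw [hφ0]
    exact Metric.ball_mem_nhds 0 hr
  have hTk : ∀ᶠ τ in 𝓝 (f z₀), ‖τ - f z₀‖ < r ^ k := by
    have h : Tendsto (fun τ : ℂ => ‖τ - f z₀‖) (𝓝 (f z₀)) (𝓝 ‖f z₀ - f z₀‖) :=
      (tendsto_id.sub_const _).norm
    rw [sub_self, norm_zero] at h
    exact h.eventually_lt_const (by positivity)
  filter_upwards [hTk] with τ hτ
  by_cases hτ0 : τ = f z₀
  · subst hτ0
    refine ⟨{z₀}, ?_, by simp [hk]⟩
    ext z
    simp only [Finset.coe_singleton, mem_singleton_iff, mem_inter_iff, mem_preimage]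
    constructor
    · rintro rfl
      exact ⟨⟨hzN, by rw [hφ0]; exact Metric.mem_ball_self hr⟩, sub_self _⟩
    · rintro ⟨⟨hz, -⟩, h⟩
      rw [(hN z hz).2.2.1] at h
      exact hinj z hz z₀ hzN (by rw [hφ0]; exact pow_eq_zero_iff hk0 |>.1 h)
  · have ha : τ - f z₀ ≠ 0 := sub_ne_zero.2 hτ0
    set R := (Polynomial.nthRoots k (τ - f z₀)).toFinset with hR
    have hRmem : ∀ u, u ∈ R ↔ u ^ k = τ - f z₀ := fun u => by
      rw [hR, Multiset.mem_toFinset, Polynomial.mem_nthRoots (Nat.pos_of_ne_zero hk0)]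
    have hRcard : R.card = k := by
      have hprim := Complex.isPrimitiveRoot_exp k hk0
      rw [hR, Multiset.toFinset_card_of_nodup (hprim.nthRoots_nodup ha), hprim.card_nthRoots,
        if_pos (IsAlgClosed.exists_pow_nat_eq _ (Nat.pos_of_ne_zero hk0))]
    have hRb : ∀ u ∈ R, u ∈ Metric.ball (0 : ℂ) r := by
      intro u hu
      rw [hRmem] at hu
      rw [← hu, norm_pow] at hτ
      simpa using lt_of_pow_lt_pow_left₀ k hr.le hτ
    have hRN : ∀ u ∈ R, ∃ z ∈ N, φ z = u := fun u hu => hball (hRb u hu)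
    choose! ψ hψN hψ using hRN
    have hψinj : Set.InjOn ψ R := fun u hu v hv h => by rw [← hψ u hu, ← hψ v hv, h]
    have hord : ∀ u ∈ R, analyticOrderAt (fun z => f z - τ) (ψ u) = 1 := by
      intro u hu
      obtain ⟨-, -, h3, h4, h5, h6⟩ := hN _ (hψN u hu)
      have hu0 : u ≠ 0 := by
        rintro rfl
        rw [hRmem, zero_pow hk0] at hu
        exact ha hu.symm
      refine AnalyticAt.analyticOrderAt_eq_one_of_zero_deriv_ne_zero (h6.sub analyticAt_const) ?_ ?_
      · have : f (ψ u) - f z₀ = τ - f z₀ := by rw [h3, hψ u hu, (hRmem u).1 hu]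
        rw [sub_eq_zero]
        exact sub_left_injective this
      · have hloc : (fun z => f z - τ) =ᶠ[𝓝 (ψ u)] fun z => φ z ^ k + (f z₀ - τ) := by
          filter_upwards [hNo.mem_nhds (hψN u hu)] with z hz
          rw [← (hN z hz).2.2.1]
          ring
        rw [hloc.deriv_eq, deriv_add_const, deriv_fun_pow h4.differentiableAt, hψ u hu]
        exact mul_ne_zero (mul_ne_zero (Nat.cast_ne_zero.2 hk0) (pow_ne_zero _ hu0)) h5
    refine ⟨R.image ψ, ?_, ?_⟩
    · ext z
      simp only [Finset.coe_image, mem_image, Finset.mem_coe, mem_inter_iff,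
        mem_preimage, sub_eq_zero]
      constructor
      · rintro ⟨u, hu, rfl⟩
        refine ⟨⟨hψN u hu, by rw [hψ u hu]; exact hRb u hu⟩, ?_⟩
        have := (hN _ (hψN u hu)).2.2.1
        rw [hψ u hu, (hRmem u).1 hu] at this
        exact sub_left_injective this
      · rintro ⟨⟨hz, -⟩, h⟩
        have hu : φ z ∈ R := by rw [hRmem, ← (hN z hz).2.2.1, h]
        exact ⟨φ z, hu, hinj _ (hψN _ hu) _ hz (hψ _ hu)⟩
    · rw [Finset.sum_image hψinj, Finset.sum_congr rfl hord]
      simp [hRcard]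

theorem HasCount.biUnion {ι : Type*} {f : ℂ → ℂ} {S : Finset ι} {B : ι → Set ℂ} {k : ι → ℕ∞}
    (h : ∀ i ∈ S, HasCount f (B i) (k i)) (hB : (S : Set ι).PairwiseDisjoint B) :
    HasCount f (⋃ i ∈ S, B i) (∑ i ∈ S, k i) := by
  classical
  choose! s hs hk using h
  refine ⟨S.biUnion s, ?_, ?_⟩
  · ext z
    simp only [Finset.coe_biUnion, mem_iUnion, exists_prop, Finset.mem_coe]
    constructor
    · rintro ⟨i, hi, hz⟩
      rw [← Finset.mem_coe, hs i hi] at hz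
      exact ⟨⟨i, hi, hz.1⟩, hz.2⟩
    · rintro ⟨⟨i, hi, hz⟩, h0⟩
      refine ⟨i, hi, ?_⟩
      rw [← Finset.mem_coe, hs i hi]
      exact ⟨hz, h0⟩
  · rw [Finset.sum_biUnion, Finset.sum_congr rfl hk]
    intro i hi j hj hij
    refine Finset.disjoint_left.2 fun z hz hz' => ?_
    rw [← Finset.mem_coe, hs i hi] at hz
    rw [← Finset.mem_coe, hs j hj] at hz'
    exact Set.disjoint_left.1 (hB hi hj hij) hz.1 hz'.1

/-- Finitely many solutions of `f z = τ₀` in `U` persist, with multiplicities, for `τ` near `τ₀`. -/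
theorem exists_hasCount_of_finset {f : ℂ → ℂ} {τ₀ : ℂ} {S : Finset ℂ} {U : Set ℂ}
    (hf : ∀ z ∈ S, AnalyticAt ℂ f z) (hτ : ∀ z ∈ S, f z = τ₀)
    (ho : ∀ z ∈ S, analyticOrderAt (fun w => f w - τ₀) z ≠ ⊤) (hU : ∀ z ∈ S, U ∈ 𝓝 z) :
    ∃ W ⊆ U, (∀ z ∈ S, W ∈ 𝓝 z) ∧ ∀ᶠ τ in 𝓝 τ₀,
      HasCount (fun z => f z - τ) W (∑ z ∈ S, analyticOrderAt (fun w => f w - τ₀) z) := by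
  -- Disjoint neighbourhoods let the local counts be added.
  obtain ⟨V, hV, hVd⟩ := S.finite_toSet.t2_separation
  have key : ∀ z ∈ S, ∃ B ⊆ U ∩ V z, B ∈ 𝓝 z ∧ ∀ᶠ τ in 𝓝 τ₀, HasCount (fun w => f w - τ) B
      (analyticOrderAt (fun w => f w - τ₀) z) := by
    intro z hz
    obtain ⟨k, hk⟩ := ENat.ne_top_iff_exists.1 (ho z hz)
    rw [← hk]
    have := hτ z hz
    subst this
    exact exists_hasCount_of_order (hf z hz) hk.symm
      (inter_mem (hU z hz) ((hV z).2.mem_nhds (hV z).1))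
  choose! B hB hBn hBc using key
  refine ⟨⋃ z ∈ S, B z, ?_, ?_, ?_⟩
  · exact iUnion₂_subset fun z hz => (hB z hz).trans inter_subset_left
  · exact fun z hz => mem_of_superset (hBn z hz) (subset_biUnion_of_mem (u := B) hz)
  · filter_upwards [(eventually_all_finset S).2 hBc] with τ h
    refine HasCount.biUnion h fun z hz w hw hzw => ?_
    exact (hVd hz hw hzw).mono ((hB z hz).trans inter_subset_right)
      ((hB w hw).trans inter_subset_right)

/-- Zeros do not disappear under small perturbations of the level. -/
theorem le_zeroCount_of_frequently {f : ℂ → ℂ} {τ₀ : ℂ} {U : Set ℂ} {k : ℕ∞} (hU : IsOpen U)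
    (hf : AnalyticOnNhd ℂ f U) (ho : ∀ z ∈ U, analyticOrderAt (fun w => f w - τ₀) z ≠ ⊤)
    (h : ∃ᶠ τ in 𝓝 τ₀, zeroCount (fun z => f z - τ) U ≤ k) :
    zeroCount (fun z => f z - τ₀) U ≤ k := by
  classical
  refine zeroCount_le_iff.2 fun s hs => ?_
  set S := s.filter (fun z => f z = τ₀) with hS
  have hSU : ∀ z ∈ S, z ∈ U := fun z hz => hs (Finset.mem_filter.1 hz).1
  obtain ⟨W, hWU, -, hW⟩ := exists_hasCount_of_finset (f := f) (τ₀ := τ₀) (S := S) (U := U)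
    (fun z hz => hf z (hSU z hz)) (fun z hz => (Finset.mem_filter.1 hz).2)
    (fun z hz => ho z (hSU z hz)) (fun z hz => hU.mem_nhds (hSU z hz))
  obtain ⟨τ, hτ1, hτ2⟩ := (h.and_eventually hW).exists
  calc ∑ z ∈ s, analyticOrderAt (fun w => f w - τ₀) z
      ≤ ∑ z ∈ S, analyticOrderAt (fun w => f w - τ₀) z :=
        Finset.sum_le_sum_of_ne_zero fun z hz h0 => Finset.mem_filter.2
          ⟨hz, sub_eq_zero.1 (analyticOrderAt_ne_zero.1 h0).2⟩
    _ = zeroCount (fun z => f z - τ) W := hτ2.zeroCount_eq.symm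
    _ ≤ zeroCount (fun z => f z - τ) U := zeroCount_mono _ hWU
    _ ≤ k := hτ1

/-- The Noshiro–Warschawski criterion: along the segment from `a` to `b`, the function `Re (f · conj
(b - a))` has derivative `Re f' · |b - a|² > 0`, so its end values differ. -/
theorem injOn_of_re_deriv_pos {f f' : ℂ → ℂ} {K : Set ℂ} (hK : Convex ℝ K)
    (hf : ∀ z ∈ K, HasDerivAt f (f' z) z) (hpos : ∀ z ∈ K, 0 < (f' z).re) : InjOn f K := by
  intro a ha b hb hab
  by_contra hne
  set p : ℝ → ℂ := fun t => a + (t : ℂ) * (b - a) with hp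
  have hpK : ∀ t ∈ Icc (0 : ℝ) 1, p t ∈ K := by
    intro t ht
    have := hK.add_smul_sub_mem ha hb ht
    simpa [hp] using this
  have hpd : ∀ t : ℝ, HasDerivAt p (b - a) t := by
    intro t
    have h1 : HasDerivAt (fun t : ℝ => (t : ℂ)) ((1 : ℝ) : ℂ) t := (hasDerivAt_id t).ofReal_comp
    simpa [hp] using (h1.mul_const (b - a)).const_add a
  set u : ℝ → ℝ := fun t => (f (p t) * (starRingEnd ℂ) (b - a)).re with hu
  have hud : ∀ t ∈ Icc (0 : ℝ) 1,
      HasDerivAt u ((f' (p t)).re * Complex.normSq (b - a)) t := by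
    intro t ht
    have h1 : HasDerivAt (fun t => f (p t)) (f' (p t) * (b - a)) t :=
      HasDerivAt.comp (𝕜 := ℝ) (𝕜' := ℂ) t (hf _ (hpK t ht)) (hpd t)
    have h2 := (h1.mul_const ((starRingEnd ℂ) (b - a)))
    have h3 := Complex.reCLM.hasFDerivAt.comp_hasDerivAt t h2
    convert! h3 using 1
    rw [mul_assoc, Complex.mul_conj]
    simp
  have hnorm : 0 < Complex.normSq (b - a) := Complex.normSq_pos.2 (sub_ne_zero.2 (Ne.symm hne))
  have hmono : StrictMonoOn u (Icc 0 1) := by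
    refine strictMonoOn_of_deriv_pos (convex_Icc 0 1)
      (fun t ht => (hud t ht).continuousAt.continuousWithinAt) fun t ht => ?_
    have ht' := interior_subset ht
    rw [(hud t ht').deriv]
    exact mul_pos (hpos _ (hpK t ht')) hnorm
  have := hmono (left_mem_Icc.2 zero_le_one) (right_mem_Icc.2 zero_le_one) one_pos
  simp [hu, hp, hab] at this

/-! ### The integrals as functions of `s = √(1 + 4h)` -/

/-- The expression under the root in `gammaY`, with `s` in place of `√(1 + 4h)`. -/
noncomputable def radicand (s : ℂ) (t : ℝ) : ℂ :=
  s * (1 + (Real.cos t : ℂ) ^ 2) - (Real.sin t : ℂ) ^ 2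

/-- The weighted integral of the square root of `radicand`. -/
noncomputable def sqrtInt (φ : ℝ → ℝ) (s : ℂ) : ℂ :=
  ∫ t in (0 : ℝ)..(2 * Real.pi), (φ t : ℂ) * csqrt (radicand s t)

/-- The weighted integral of the reciprocal square root of `radicand`. -/
noncomputable def invSqrtInt (φ : ℝ → ℝ) (s : ℂ) : ℂ :=
  ∫ t in (0 : ℝ)..(2 * Real.pi), (φ t : ℂ) / csqrt (radicand s t)

/-- The plane cut along `(-∞, 1]`. -/
def cutPlane : Set ℂ := {s | 1 < s.re ∨ s.im ≠ 0}

theorem isOpen_cutPlane : IsOpen cutPlane :=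
  (isOpen_lt continuous_const Complex.continuous_re).union
    (isOpen_ne_fun Complex.continuous_im continuous_const)

theorem radicand_re (s : ℂ) (t : ℝ) :
    (radicand s t).re = s.re * (1 + Real.cos t ^ 2) - Real.sin t ^ 2 := by
  have e : radicand s t = s * ((1 + Real.cos t ^ 2 : ℝ) : ℂ) - ((Real.sin t ^ 2 : ℝ) : ℂ) := by
    unfold radicand; push_cast; rfl
  rw [e, Complex.sub_re, Complex.re_mul_ofReal, Complex.ofReal_re]

theorem radicand_im (s : ℂ) (t : ℝ) : (radicand s t).im = s.im * (1 + Real.cos t ^ 2) := by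
  have e : radicand s t = s * ((1 + Real.cos t ^ 2 : ℝ) : ℂ) - ((Real.sin t ^ 2 : ℝ) : ℂ) := by
    unfold radicand; push_cast; rfl
  rw [e, Complex.sub_im, Complex.im_mul_ofReal, Complex.ofReal_im, sub_zero]

theorem continuous_radicand : Continuous fun q : ℂ × ℝ => radicand q.1 q.2 := by
  unfold radicand
  fun_prop

theorem radicand_mem_slitPlane {s : ℂ} (hs : s ∈ cutPlane) (t : ℝ) :
    radicand s t ∈ Complex.slitPlane := by
  rw [Complex.mem_slitPlane_iff, radicand_re, radicand_im]
  rcases hs with h | h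
  · left
    nlinarith [Real.sin_sq_le_one t, sq_nonneg (Real.cos t)]
  · right
    positivity

theorem csqrt_eq_zero {z : ℂ} : csqrt z = 0 ↔ z = 0 := by
  constructor
  · intro h
    rw [← csqrt_sq z, h, zero_pow two_ne_zero]
  · rintro rfl
    simp [csqrt]

theorem hasDerivAt_csqrt {z : ℂ} (hz : z ∈ Complex.slitPlane) :
    HasDerivAt csqrt (1 / (2 * csqrt z)) z := by
  have h0 : z ≠ 0 := Complex.slitPlane_ne_zero hz
  have h := (hasDerivAt_id z).cpow_const (c := (1 / 2 : ℂ)) hz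
  have hd : HasDerivAt csqrt (1 / 2 * z ^ ((1 / 2 : ℂ) - 1) * 1) z := h
  convert! hd using 1
  rw [Complex.cpow_sub _ _ h0, Complex.cpow_one]
  have h2 : z ^ (1 / 2 : ℂ) = csqrt z := rfl
  have h3 := csqrt_sq z
  have h4 : csqrt z ≠ 0 := csqrt_eq_zero.not.2 h0
  rw [h2]
  field_simp
  exact h3.symm

theorem continuousOn_csqrt_radicand :
    ContinuousOn (fun q : ℂ × ℝ => csqrt (radicand q.1 q.2)) (cutPlane ×ˢ univ) := by
  rintro ⟨s, t⟩ ⟨hs, -⟩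
  exact (ContinuousAt.comp (f := fun q : ℂ × ℝ => radicand q.1 q.2) (x := (s, t))
    (continuousAt_csqrt (radicand_mem_slitPlane hs t))
    continuous_radicand.continuousAt).continuousWithinAt

theorem continuousOn_csqrt_radicand_upper :
    ContinuousOn (fun q : ℂ × ℝ => csqrt (radicand q.1 q.2)) ({s | 0 ≤ s.im} ×ˢ univ) := by
  refine continuousOn_csqrt_upper.comp continuous_radicand.continuousOn ?_
  rintro ⟨s, t⟩ ⟨hs, -⟩
  change 0 ≤ (radicand s t).im
  rw [radicand_im]
  have : 0 ≤ s.im := hs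
  positivity

theorem continuous_slice {g : ℂ × ℝ → ℂ} {S : Set ℂ} (hg : ContinuousOn g (S ×ˢ univ)) {s : ℂ}
    (hs : s ∈ S) : Continuous fun t : ℝ => g (s, t) :=
  hg.comp_continuous (by fun_prop) fun _ => ⟨hs, mem_univ _⟩

theorem continuous_csqrt_radicand {s : ℂ} (hs : s ∈ cutPlane) :
    Continuous fun t : ℝ => csqrt (radicand s t) :=
  continuous_slice continuousOn_csqrt_radicand hs

theorem continuous_csqrt_radicand_upper {s : ℂ} (hs : 0 ≤ s.im) :
    Continuous fun t : ℝ => csqrt (radicand s t) :=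
  continuous_slice continuousOn_csqrt_radicand_upper hs

theorem csqrt_radicand_ne_zero {s : ℂ} (hs : s ∈ cutPlane) (t : ℝ) : csqrt (radicand s t) ≠ 0 :=
  csqrt_eq_zero.not.2 (Complex.slitPlane_ne_zero (radicand_mem_slitPlane hs t))

theorem continuous_inv_csqrt_radicand {φ : ℝ → ℝ} (hφ : Continuous φ) {s : ℂ}
    (hs : s ∈ cutPlane) : Continuous fun t : ℝ => (φ t : ℂ) / csqrt (radicand s t) :=
  (Complex.continuous_ofReal.comp hφ).div (continuous_csqrt_radicand hs)
    (csqrt_radicand_ne_zero hs)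

/-- Differentiation under the integral sign for jointly continuous derivatives. -/
theorem hasDerivAt_integral_of_continuousOn {F F' : ℂ → ℝ → ℂ} {S : Set ℂ} (hS : IsOpen S)
    (hF : ∀ s ∈ S, Continuous (F s)) (hF' : ContinuousOn (fun q : ℂ × ℝ => F' q.1 q.2) (S ×ˢ univ))
    (hd : ∀ s ∈ S, ∀ t, HasDerivAt (fun s => F s t) (F' s t) s) (a b : ℝ) {s₀ : ℂ} (hs : s₀ ∈ S) :
    HasDerivAt (fun s => ∫ t in a..b, F s t) (∫ t in a..b, F' s₀ t) s₀ := by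
  obtain ⟨ε, hε, hball⟩ := Metric.nhds_basis_closedBall.mem_iff.1 (hS.mem_nhds hs)
  have hK : IsCompact (Metric.closedBall s₀ ε ×ˢ uIcc a b) :=
    (isCompact_closedBall _ _).prod isCompact_uIcc
  obtain ⟨C, hC⟩ := hK.exists_bound_of_continuousOn
    (hF'.mono (prod_mono hball (subset_univ _)))
  refine (intervalIntegral.hasDerivAt_integral_of_dominated_loc_of_deriv_le (F := F) (F' := F')
    (bound := fun _ => C) (s := Metric.closedBall s₀ ε) (Metric.closedBall_mem_nhds _ hε)
    ?_ ?_ ?_ ?_ ?_ ?_).2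
  · filter_upwards [hS.mem_nhds hs] with s h
    exact (hF s h).aestronglyMeasurable
  · exact (hF s₀ hs).intervalIntegrable _ _
  · exact (continuous_slice hF' hs).aestronglyMeasurable
  · exact Eventually.of_forall fun t ht s h => hC (s, t) ⟨h, uIoc_subset_uIcc ht⟩
  · exact intervalIntegrable_const
  · exact Eventually.of_forall fun t _ s h => hd s (hball h) t

theorem hasDerivAt_sqrtInt {φ : ℝ → ℝ} (hφ : Continuous φ) {s : ℂ} (hs : s ∈ cutPlane) :
    HasDerivAt (sqrtInt φ) (invSqrtInt (fun t => φ t * (1 + Real.cos t ^ 2) / 2) s) s := by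
  have hφ' : Continuous fun q : ℂ × ℝ => ((φ q.2 * (1 + Real.cos q.2 ^ 2) / 2 : ℝ) : ℂ) := by
    fun_prop
  refine hasDerivAt_integral_of_continuousOn
    (F' := fun s t => ((φ t * (1 + Real.cos t ^ 2) / 2 : ℝ) : ℂ) / csqrt (radicand s t))
    isOpen_cutPlane (fun s h => ?_) ?_ ?_ 0 (2 * Real.pi) hs
  · exact (Complex.continuous_ofReal.comp hφ).mul (continuous_csqrt_radicand h)
  · exact hφ'.continuousOn.div continuousOn_csqrt_radicand
      fun q hq => csqrt_radicand_ne_zero hq.1 q.2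
  · intro s h t
    have h1 : HasDerivAt (fun s => radicand s t) (1 * (1 + (Real.cos t : ℂ) ^ 2)) s :=
      ((hasDerivAt_id s).mul_const _).sub_const _
    have h2 := ((hasDerivAt_csqrt (radicand_mem_slitPlane h t)).comp s h1).const_mul (φ t : ℂ)
    convert! h2 using 1
    push_cast
    ring

/-- Outside the cut plane the root, having nonnegative real part, would lie in `[0, 1]`, and `h =
(s² - 1) / 4` would lie in `[-1/4, 0]`. -/
theorem csqrt_one_add_mem_cutPlane {h : ℂ} (hh : h ∈ D) : csqrt (1 + 4 * h) ∈ cutPlane := by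
  by_contra hc
  have hc' : ¬ (1 < (csqrt (1 + 4 * h)).re ∨ (csqrt (1 + 4 * h)).im ≠ 0) := hc
  push Not at hc'
  have h0 := csqrt_re_nonneg (1 + 4 * h)
  have h1 := csqrt_sq (1 + 4 * h)
  have hre := congrArg Complex.re h1
  have him := congrArg Complex.im h1
  simp [pow_two, hc'.2] at hre him
  rcases Complex.mem_slitPlane_iff.1 hh with h | h
  · nlinarith
  · exact h him

theorem one_add_four_mul_mem_slitPlane {h : ℂ} (hh : h ∈ D) : 1 + 4 * h ∈ Complex.slitPlane := by
  have hh' : h ∈ Complex.slitPlane := hh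
  rw [Complex.mem_slitPlane_iff] at hh' ⊢
  rcases hh' with h' | h'
  · left; simp; linarith
  · right; simpa using h'

theorem hasDerivAt_csqrt_one_add {h : ℂ} (hh : h ∈ D) :
    HasDerivAt (fun h => csqrt (1 + 4 * h)) (2 / csqrt (1 + 4 * h)) h := by
  have h1 : HasDerivAt (fun h : ℂ => 1 + 4 * h) (4 * 1) h :=
    ((hasDerivAt_id h).const_mul 4).const_add 1
  have h2 := (hasDerivAt_csqrt (one_add_four_mul_mem_slitPlane hh)).comp h h1
  convert! h2 using 1
  field_simp
  norm_num

/-- The weight `sin² t`, which belongs to `I₀`. -/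
noncomputable def wt0 (t : ℝ) : ℝ := Real.sin t ^ 2

/-- The weight `cos² t sin² t`, which belongs to `I₂`. -/
noncomputable def wt2 (t : ℝ) : ℝ := Real.cos t ^ 2 * Real.sin t ^ 2

theorem continuous_wt0 : Continuous wt0 := by unfold wt0; fun_prop

theorem continuous_wt2 : Continuous wt2 := by unfold wt2; fun_prop

/-- The amplitude `a = √(1 + s)` enters `gammaX`, its derivative and `gammaY` once each, so it
occurs to an even power in the integrand of `I 0` and of `I 2`. Replacing `a²` by `1 + s` leaves
functions of `s` alone. -/
theorem I_zero_eq (h : ℂ) : I 0 h = (1 + csqrt (1 + 4 * h)) / (Real.sqrt 2 : ℂ) *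
    sqrtInt wt0 (csqrt (1 + 4 * h)) := by
  unfold I sqrtInt
  rw [← intervalIntegral.integral_const_mul]
  congr 1
  funext t
  rw [deriv_gammaX]
  have := csqrt_sq (1 + csqrt (1 + 4 * h))
  unfold gammaX gammaY radicand wt0
  generalize csqrt (1 + 4 * h) = s at this ⊢
  generalize csqrt (1 + s) = a at this ⊢
  generalize csqrt (s * (1 + (Real.cos t : ℂ) ^ 2) - (Real.sin t : ℂ) ^ 2) = R
  push_cast
  linear_combination (Complex.sin t ^ 2 * R / (Real.sqrt 2 : ℂ)) * this

theorem I_two_eq (h : ℂ) : I 2 h = (1 + csqrt (1 + 4 * h)) ^ 2 / (Real.sqrt 2 : ℂ) *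
    sqrtInt wt2 (csqrt (1 + 4 * h)) := by
  unfold I sqrtInt
  rw [← intervalIntegral.integral_const_mul]
  congr 1
  funext t
  rw [deriv_gammaX]
  have := csqrt_sq (1 + csqrt (1 + 4 * h))
  unfold gammaX gammaY radicand wt2
  generalize csqrt (1 + 4 * h) = s at this ⊢
  generalize csqrt (1 + s) = a at this ⊢
  generalize csqrt (s * (1 + (Real.cos t : ℂ) ^ 2) - (Real.sin t : ℂ) ^ 2) = R
  push_cast
  linear_combination (Complex.cos t ^ 2 * Complex.sin t ^ 2 * R / (Real.sqrt 2 : ℂ)) *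
    (a ^ 2 + 1 + s) * this

theorem differentiableOn_D_of_eq {f : ℂ → ℂ} {g : ℂ → ℂ} (hg : DifferentiableOn ℂ g cutPlane)
    (h : ∀ z, f z = g (csqrt (1 + 4 * z))) : AnalyticOnNhd ℂ f D := by
  have hD : IsOpen D := Complex.isOpen_slitPlane
  refine DifferentiableOn.analyticOnNhd ?_ hD
  intro z hz
  have h1 := (hg.differentiableAt (isOpen_cutPlane.mem_nhds (csqrt_one_add_mem_cutPlane hz)))
  have h2 := h1.comp z (hasDerivAt_csqrt_one_add hz).differentiableAt
  rw [show f = g ∘ fun z => csqrt (1 + 4 * z) from funext h]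
  exact h2.differentiableWithinAt

theorem differentiableOn_sqrtInt {φ : ℝ → ℝ} (hφ : Continuous φ) :
    DifferentiableOn ℂ (sqrtInt φ) cutPlane := fun _ hs =>
  (hasDerivAt_sqrtInt hφ hs).differentiableAt.differentiableWithinAt

theorem analyticOnNhd_I_zero : AnalyticOnNhd ℂ (I 0) D := by
  refine differentiableOn_D_of_eq
    (g := fun s => (1 + s) / (Real.sqrt 2 : ℂ) * sqrtInt wt0 s) ?_ I_zero_eq
  exact DifferentiableOn.mul (by fun_prop) (differentiableOn_sqrtInt continuous_wt0)

theorem analyticOnNhd_I_two : AnalyticOnNhd ℂ (I 2) D := by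
  refine differentiableOn_D_of_eq
    (g := fun s => (1 + s) ^ 2 / (Real.sqrt 2 : ℂ) * sqrtInt wt2 s) ?_ I_two_eq
  exact DifferentiableOn.mul (by fun_prop) (differentiableOn_sqrtInt continuous_wt2)

theorem analyticOnNhd_M₁ (l0 l2 : ℝ) : AnalyticOnNhd ℂ (M₁ l0 l2) D := fun z hz =>
  (analyticAt_const.mul (analyticOnNhd_I_zero z hz)).add
    (analyticAt_const.mul (analyticOnNhd_I_two z hz))

/-! ### The differential equations satisfied by the integrals -/

/-- The integral of `cos^{2n} t` divided by the root of `radicand`. -/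
noncomputable def cosInt (n : ℕ) (s : ℂ) : ℂ := invSqrtInt (fun t => Real.cos t ^ (2 * n)) s

theorem intervalIntegrable_cosInt (n : ℕ) {s : ℂ} (hs : s ∈ cutPlane) (a b : ℝ) :
    IntervalIntegrable (fun t : ℝ => ((Real.cos t ^ (2 * n) : ℝ) : ℂ) / csqrt (radicand s t))
      MeasureTheory.volume a b :=
  (continuous_inv_csqrt_radicand (by fun_prop) hs).intervalIntegrable a b

/-- Integrals of polynomials in `cos² t` of degree at most three over the root. -/
theorem integral_cubic {s : ℂ} (hs : s ∈ cutPlane) (c : Fin 4 → ℂ) :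
    ∫ t in (0 : ℝ)..(2 * Real.pi), (c 0 + c 1 * (Real.cos t : ℂ) ^ 2 + c 2 * (Real.cos t : ℂ) ^ 4 +
      c 3 * (Real.cos t : ℂ) ^ 6) / csqrt (radicand s t)
    = c 0 * cosInt 0 s + c 1 * cosInt 1 s + c 2 * cosInt 2 s + c 3 * cosInt 3 s := by
  have hi := fun n => (intervalIntegrable_cosInt n hs 0 (2 * Real.pi))
  unfold cosInt invSqrtInt
  rw [← intervalIntegral.integral_const_mul, ← intervalIntegral.integral_const_mul,
    ← intervalIntegral.integral_const_mul, ← intervalIntegral.integral_const_mul,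
    ← intervalIntegral.integral_add ((hi 0).const_mul _) ((hi 1).const_mul _),
    ← intervalIntegral.integral_add (((hi 0).const_mul _).add ((hi 1).const_mul _))
      ((hi 2).const_mul _),
    ← intervalIntegral.integral_add ((((hi 0).const_mul _).add ((hi 1).const_mul _)).add
      ((hi 2).const_mul _)) ((hi 3).const_mul _)]
  congr 1
  funext t
  push_cast
  ring

theorem sin_sq_ofReal (t : ℝ) : (Real.sin t : ℂ) ^ 2 = 1 - (Real.cos t : ℂ) ^ 2 := by
  have := Real.sin_sq t
  rw [← Complex.ofReal_pow, this]; push_cast; ring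

theorem hasDerivAt_csqrt_radicand {s : ℂ} (hs : s ∈ cutPlane) (t : ℝ) :
    HasDerivAt (fun t : ℝ => csqrt (radicand s t))
      (-(s + 1) * (Real.cos t : ℂ) * (Real.sin t : ℂ) / csqrt (radicand s t)) t := by
  have hc : HasDerivAt (fun t : ℝ => (Real.cos t : ℂ)) ((-Real.sin t : ℝ) : ℂ) t :=
    (Real.hasDerivAt_cos t).ofReal_comp
  have hsn : HasDerivAt (fun t : ℝ => (Real.sin t : ℂ)) ((Real.cos t : ℝ) : ℂ) t :=
    (Real.hasDerivAt_sin t).ofReal_comp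
  have h1 := (((hc.pow 2).const_add 1).const_mul s).sub (hsn.pow 2)
  have h2 := HasDerivAt.comp (𝕜 := ℝ) (𝕜' := ℂ) t
    (hasDerivAt_csqrt (radicand_mem_slitPlane hs t)) h1
  have h0 := csqrt_radicand_ne_zero hs t
  convert! h2 using 1
  push_cast
  field_simp
  ring

/-- Integration by parts against `sin t cos^{2n+1} t`. -/
theorem integral_by_parts {s : ℂ} (hs : s ∈ cutPlane) (n : ℕ) :
    ∫ t in (0 : ℝ)..(2 * Real.pi), (((Real.cos t : ℂ) ^ (2 * n + 2) -
      (2 * n + 1) * (Real.sin t : ℂ) ^ 2 * (Real.cos t : ℂ) ^ (2 * n)) * radicand s t -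
      (s + 1) * (Real.sin t : ℂ) ^ 2 * (Real.cos t : ℂ) ^ (2 * n + 2)) /
      csqrt (radicand s t) = 0 := by
  have hd : ∀ t : ℝ, HasDerivAt
      (fun t : ℝ => (Real.sin t : ℂ) * (Real.cos t : ℂ) ^ (2 * n + 1) * csqrt (radicand s t))
      ((((Real.cos t : ℂ) ^ (2 * n + 2) -
      (2 * n + 1) * (Real.sin t : ℂ) ^ 2 * (Real.cos t : ℂ) ^ (2 * n)) * radicand s t -
      (s + 1) * (Real.sin t : ℂ) ^ 2 * (Real.cos t : ℂ) ^ (2 * n + 2)) /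
      csqrt (radicand s t)) t := by
    intro t
    have hc : HasDerivAt (fun t : ℝ => (Real.cos t : ℂ)) ((-Real.sin t : ℝ) : ℂ) t :=
      (Real.hasDerivAt_cos t).ofReal_comp
    have hsn : HasDerivAt (fun t : ℝ => (Real.sin t : ℂ)) ((Real.cos t : ℝ) : ℂ) t :=
      (Real.hasDerivAt_sin t).ofReal_comp
    have h1 := (hsn.mul (hc.pow (2 * n + 1))).mul (hasDerivAt_csqrt_radicand hs t)
    have h0 := csqrt_radicand_ne_zero hs t
    have h2 := csqrt_sq (radicand s t)
    convert! h1 using 1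
    simp only [Pi.mul_apply, Pi.pow_apply, Nat.add_sub_cancel]
    generalize csqrt (radicand s t) = R at h0 h2 ⊢
    rw [← h2]
    push_cast
    field_simp
    ring
  have hcont : Continuous fun t : ℝ => (((Real.cos t : ℂ) ^ (2 * n + 2) -
      (2 * n + 1) * (Real.sin t : ℂ) ^ 2 * (Real.cos t : ℂ) ^ (2 * n)) * radicand s t -
      (s + 1) * (Real.sin t : ℂ) ^ 2 * (Real.cos t : ℂ) ^ (2 * n + 2)) /
      csqrt (radicand s t) := by
    refine Continuous.div ?_ (continuous_csqrt_radicand hs) (csqrt_radicand_ne_zero hs)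
    have := continuous_slice (S := univ) continuous_radicand.continuousOn (mem_univ s)
    fun_prop
  rw [intervalIntegral.integral_eq_sub_of_hasDerivAt (fun t _ => hd t)
    (hcont.intervalIntegrable _ _)]
  simp

/-- The numerator in `integral_by_parts` for `n = 0`, expanded in powers of `cos²`. Together with
the case `n = 1` below, it expresses `cosInt 2` and `cosInt 3` through the basis `cosInt 0`, `cosInt
1`. -/
theorem cosInt_relation_one {s : ℂ} (hs : s ∈ cutPlane) :
    3 * (s + 1) * cosInt 2 s = 4 * cosInt 1 s + (s - 1) * cosInt 0 s := by
  have h1 := integral_by_parts hs 0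
  have h2 := integral_cubic hs ![-(s - 1), -4, 3 * (s + 1), 0]
  simp only [Matrix.cons_val_zero, Matrix.cons_val_one, Matrix.cons_val] at h2
  have e : ∀ t : ℝ, (-(s - 1) + -4 * (Real.cos t : ℂ) ^ 2 + 3 * (s + 1) * (Real.cos t : ℂ) ^ 4 +
      0 * (Real.cos t : ℂ) ^ 6) = (((Real.cos t : ℂ) ^ (2 * 0 + 2) -
      (2 * (0 : ℕ) + 1) * (Real.sin t : ℂ) ^ 2 * (Real.cos t : ℂ) ^ (2 * 0)) * radicand s t -
      (s + 1) * (Real.sin t : ℂ) ^ 2 * (Real.cos t : ℂ) ^ (2 * 0 + 2)) := by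
    intro t
    unfold radicand
    rw [sin_sq_ofReal]
    push_cast
    ring
  simp only [e] at h2
  rw [h1] at h2
  linear_combination -h2

theorem cosInt_relation_two {s : ℂ} (hs : s ∈ cutPlane) :
    5 * (s + 1) * cosInt 3 s = 8 * cosInt 2 s + 3 * (s - 1) * cosInt 1 s := by
  have h1 := integral_by_parts hs 1
  have h2 := integral_cubic hs ![0, -3 * (s - 1), -8, 5 * (s + 1)]
  simp only [Matrix.cons_val_zero, Matrix.cons_val_one, Matrix.cons_val] at h2
  have e : ∀ t : ℝ, (0 + -3 * (s - 1) * (Real.cos t : ℂ) ^ 2 + -8 * (Real.cos t : ℂ) ^ 4 +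
      5 * (s + 1) * (Real.cos t : ℂ) ^ 6) = (((Real.cos t : ℂ) ^ (2 * 1 + 2) -
      (2 * (1 : ℕ) + 1) * (Real.sin t : ℂ) ^ 2 * (Real.cos t : ℂ) ^ (2 * 1)) * radicand s t -
      (s + 1) * (Real.sin t : ℂ) ^ 2 * (Real.cos t : ℂ) ^ (2 * 1 + 2)) := by
    intro t
    unfold radicand
    rw [sin_sq_ofReal]
    push_cast
    ring
  simp only [e] at h2
  rw [h1] at h2
  linear_combination -h2

/-- Turns integrals of the root into combinations of the `cosInt`. At `z = 0` it relies on `0 / 0 =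
0`. -/
theorem csqrt_eq_div (z : ℂ) : csqrt z = z / csqrt z := by
  by_cases h : csqrt z = 0
  · rw [h, div_zero]
  · rw [eq_div_iff h, ← pow_two, csqrt_sq]

theorem sqrtInt_wt0_eq {s : ℂ} (hs : s ∈ cutPlane) :
    sqrtInt wt0 s = (s - 1) * cosInt 0 s + 2 * cosInt 1 s - (s + 1) * cosInt 2 s := by
  have h2 := integral_cubic hs ![s - 1, 2, -(s + 1), 0]
  simp only [Matrix.cons_val_zero, Matrix.cons_val_one, Matrix.cons_val] at h2
  rw [show (s - 1) * cosInt 0 s + 2 * cosInt 1 s - (s + 1) * cosInt 2 s = (s - 1) * cosInt 0 s +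
    2 * cosInt 1 s + -(s + 1) * cosInt 2 s + 0 * cosInt 3 s by ring, ← h2]
  unfold sqrtInt
  congr 1
  funext t
  conv_lhs => rw [csqrt_eq_div, ← mul_div_assoc]
  congr 1
  unfold radicand wt0
  push_cast
  simp only [← Complex.ofReal_cos, ← Complex.ofReal_sin]
  rw [sin_sq_ofReal]
  ring

theorem sqrtInt_wt2_eq {s : ℂ} (hs : s ∈ cutPlane) :
    sqrtInt wt2 s = (s - 1) * cosInt 1 s + 2 * cosInt 2 s - (s + 1) * cosInt 3 s := by
  have h2 := integral_cubic hs ![0, s - 1, 2, -(s + 1)]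
  simp only [Matrix.cons_val_zero, Matrix.cons_val_one, Matrix.cons_val] at h2
  rw [show (s - 1) * cosInt 1 s + 2 * cosInt 2 s - (s + 1) * cosInt 3 s = 0 * cosInt 0 s +
    (s - 1) * cosInt 1 s + 2 * cosInt 2 s + -(s + 1) * cosInt 3 s by ring, ← h2]
  unfold sqrtInt
  congr 1
  funext t
  conv_lhs => rw [csqrt_eq_div, ← mul_div_assoc]
  congr 1
  unfold radicand wt2
  push_cast
  simp only [← Complex.ofReal_cos, ← Complex.ofReal_sin]
  rw [sin_sq_ofReal]
  ring

theorem hasDerivAt_sqrtInt_wt0 {s : ℂ} (hs : s ∈ cutPlane) :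
    HasDerivAt (sqrtInt wt0) ((cosInt 0 s - cosInt 2 s) / 2) s := by
  have h := hasDerivAt_sqrtInt continuous_wt0 hs
  convert! h using 1
  have h2 := integral_cubic hs ![1 / 2, 0, -1 / 2, 0]
  simp only [Matrix.cons_val_zero, Matrix.cons_val_one, Matrix.cons_val] at h2
  rw [show (cosInt 0 s - cosInt 2 s) / 2 = 1 / 2 * cosInt 0 s +
    0 * cosInt 1 s + -1 / 2 * cosInt 2 s + 0 * cosInt 3 s by ring, ← h2]
  unfold invSqrtInt
  congr 1
  funext t
  congr 1
  unfold wt0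
  push_cast
  simp only [← Complex.ofReal_cos, ← Complex.ofReal_sin]
  rw [sin_sq_ofReal]
  ring

theorem hasDerivAt_sqrtInt_wt2 {s : ℂ} (hs : s ∈ cutPlane) :
    HasDerivAt (sqrtInt wt2) ((cosInt 1 s - cosInt 3 s) / 2) s := by
  have h := hasDerivAt_sqrtInt continuous_wt2 hs
  convert! h using 1
  have h2 := integral_cubic hs ![0, 1 / 2, 0, -1 / 2]
  simp only [Matrix.cons_val_zero, Matrix.cons_val_one, Matrix.cons_val] at h2
  rw [show (cosInt 1 s - cosInt 3 s) / 2 = 0 * cosInt 0 s +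
    1 / 2 * cosInt 1 s + 0 * cosInt 2 s + -1 / 2 * cosInt 3 s by ring, ← h2]
  unfold invSqrtInt
  congr 1
  funext t
  congr 1
  unfold wt2
  push_cast
  simp only [← Complex.ofReal_cos, ← Complex.ofReal_sin]
  rw [sin_sq_ofReal]
  ring

/-- `√2 I₀` as a function of `s`. -/
noncomputable def N0 (s : ℂ) : ℂ := (1 + s) * sqrtInt wt0 s

/-- `√2 I₂` as a function of `s`. -/
noncomputable def N2 (s : ℂ) : ℂ := (1 + s) ^ 2 * sqrtInt wt2 s

theorem cutPlane_ne {s : ℂ} (hs : s ∈ cutPlane) : s ≠ 0 ∧ s ≠ 1 ∧ s ≠ -1 := by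
  refine ⟨?_, ?_, ?_⟩ <;> rintro rfl <;> rcases hs with h | h <;> norm_num at h

/-- One half of the Picard–Fuchs system; `hasDerivAt_N2` is the other. Both sides are combinations
of `cosInt 0`, …, `cosInt 3`, and agree once the two relations have eliminated `cosInt 2` and
`cosInt 3`. -/
theorem hasDerivAt_N0 {s : ℂ} (hs : s ∈ cutPlane) :
    HasDerivAt N0 (((1 + 3 * s ^ 2) * N0 s - 5 * N2 s) / (2 * s * (s ^ 2 - 1))) s := by
  obtain ⟨h0, h1, h2⟩ := cutPlane_ne hs
  have h3 : s + 1 ≠ 0 := fun h => h2 (eq_neg_of_add_eq_zero_left h)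
  have h4 : s ^ 2 - 1 ≠ 0 := by
    rw [show s ^ 2 - 1 = (s - 1) * (s + 1) by ring]
    exact mul_ne_zero (sub_ne_zero.2 h1) h3
  have hd := ((hasDerivAt_id s).const_add 1).mul (hasDerivAt_sqrtInt_wt0 hs)
  convert! hd using 1
  simp only [id]
  rw [div_eq_iff (mul_ne_zero (mul_ne_zero two_ne_zero h0) h4)]
  unfold N0 N2
  rw [sqrtInt_wt0_eq hs, sqrtInt_wt2_eq hs]
  have r1 := cosInt_relation_one hs
  have r2 := cosInt_relation_two hs
  have e2 : cosInt 2 s = (4 * cosInt 1 s + (s - 1) * cosInt 0 s) / (3 * (s + 1)) := by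
    rw [eq_div_iff (mul_ne_zero three_ne_zero h3)]; linear_combination r1
  have e3 : cosInt 3 s = (8 * cosInt 2 s + 3 * (s - 1) * cosInt 1 s) / (5 * (s + 1)) := by
    rw [eq_div_iff (mul_ne_zero (by norm_num) h3)]; linear_combination r2
  rw [e3, e2]
  field_simp
  ring

theorem hasDerivAt_N2 {s : ℂ} (hs : s ∈ cutPlane) :
    HasDerivAt N2 ((5 * N2 s - N0 s) / (2 * s)) s := by
  obtain ⟨h0, h1, h2⟩ := cutPlane_ne hs
  have h3 : s + 1 ≠ 0 := fun h => h2 (eq_neg_of_add_eq_zero_left h)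
  have hd := (((hasDerivAt_id s).const_add 1).pow 2).mul (hasDerivAt_sqrtInt_wt2 hs)
  convert! hd using 1
  simp only [id, Pi.pow_apply]
  rw [div_eq_iff (mul_ne_zero two_ne_zero h0)]
  unfold N0 N2
  rw [sqrtInt_wt0_eq hs, sqrtInt_wt2_eq hs]
  have r1 := cosInt_relation_one hs
  have r2 := cosInt_relation_two hs
  have e2 : cosInt 2 s = (4 * cosInt 1 s + (s - 1) * cosInt 0 s) / (3 * (s + 1)) := by
    rw [eq_div_iff (mul_ne_zero three_ne_zero h3)]; linear_combination r1
  have e3 : cosInt 3 s = (8 * cosInt 2 s + 3 * (s - 1) * cosInt 1 s) / (5 * (s + 1)) := by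
    rw [eq_div_iff (mul_ne_zero (by norm_num) h3)]; linear_combination r2
  rw [e3, e2]
  push_cast
  field_simp
  ring

/-! ### Estimates for the integrals in the closed first quadrant -/

theorem sqrtInt_re {φ : ℝ → ℝ} (hφ : Continuous φ) {s : ℂ} (hs : 0 ≤ s.im) :
    (sqrtInt φ s).re = ∫ t in (0 : ℝ)..(2 * Real.pi), φ t * (csqrt (radicand s t)).re := by
  have hc : Continuous fun t : ℝ => (φ t : ℂ) * csqrt (radicand s t) :=
    (Complex.continuous_ofReal.comp hφ).mul (continuous_csqrt_radicand_upper hs)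
  have := Complex.reCLM.intervalIntegral_comp_comm
    (hc.intervalIntegrable (μ := MeasureTheory.volume) 0 (2 * Real.pi))
  simp only [Complex.reCLM_apply, Complex.re_ofReal_mul] at this
  exact this.symm

theorem sqrtInt_im {φ : ℝ → ℝ} (hφ : Continuous φ) {s : ℂ} (hs : 0 ≤ s.im) :
    (sqrtInt φ s).im = ∫ t in (0 : ℝ)..(2 * Real.pi), φ t * (csqrt (radicand s t)).im := by
  have hc : Continuous fun t : ℝ => (φ t : ℂ) * csqrt (radicand s t) :=
    (Complex.continuous_ofReal.comp hφ).mul (continuous_csqrt_radicand_upper hs)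
  have := Complex.imCLM.intervalIntegral_comp_comm
    (hc.intervalIntegrable (μ := MeasureTheory.volume) 0 (2 * Real.pi))
  simp only [Complex.imCLM_apply, Complex.im_ofReal_mul] at this
  exact this.symm

theorem continuous_re_csqrt {s : ℂ} (hs : 0 ≤ s.im) :
    Continuous fun t : ℝ => (csqrt (radicand s t)).re :=
  Complex.continuous_re.comp (continuous_csqrt_radicand_upper hs)

theorem continuous_im_csqrt {s : ℂ} (hs : 0 ≤ s.im) :
    Continuous fun t : ℝ => (csqrt (radicand s t)).im :=
  Complex.continuous_im.comp (continuous_csqrt_radicand_upper hs)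

theorem im_csqrt_radicand_nonneg {s : ℂ} (hs : 0 ≤ s.im) (t : ℝ) :
    0 ≤ (csqrt (radicand s t)).im := by
  refine csqrt_im_nonneg ?_
  rw [radicand_im]
  positivity

theorem wt0_nonneg (t : ℝ) : 0 ≤ wt0 t := sq_nonneg _

theorem wt2_nonneg (t : ℝ) : 0 ≤ wt2 t := mul_nonneg (sq_nonneg _) (sq_nonneg _)

theorem wt2_le_wt0 (t : ℝ) : wt2 t ≤ wt0 t := by
  unfold wt2 wt0
  nlinarith [Real.cos_sq_le_one t, sq_nonneg (Real.sin t)]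

theorem two_pi_pos : (0 : ℝ) < 2 * Real.pi := Real.two_pi_pos

theorem integral_pos_of_continuous {g : ℝ → ℝ} (hg : Continuous g) (h0 : ∀ t, 0 ≤ g t) {t₀ : ℝ}
    (ht : t₀ ∈ Icc 0 (2 * Real.pi)) (hp : 0 < g t₀) :
    0 < ∫ t in (0 : ℝ)..(2 * Real.pi), g t :=
  intervalIntegral.integral_pos two_pi_pos hg.continuousOn (fun t _ => h0 t) ⟨t₀, ht, hp⟩

theorem integral_mono_of_continuous {f g : ℝ → ℝ} (hf : Continuous f) (hg : Continuous g)
    (h : ∀ t, f t ≤ g t) :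
    ∫ t in (0 : ℝ)..(2 * Real.pi), f t ≤ ∫ t in (0 : ℝ)..(2 * Real.pi), g t :=
  intervalIntegral.integral_mono two_pi_pos.le (hf.intervalIntegrable _ _)
    (hg.intervalIntegrable _ _) h

theorem csqrt_re_add_im_pos {z : ℂ} (hz : 0 ≤ z.im) (h0 : z ≠ 0) :
    0 < (csqrt z).re + (csqrt z).im := by
  have h1 := csqrt_re_nonneg z
  have h2 := csqrt_im_nonneg hz
  rcases h1.eq_or_lt with h | h
  · rcases h2.eq_or_lt with h' | h'
    · exact absurd (csqrt_eq_zero.1 (Complex.ext h.symm h'.symm)) h0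
    · linarith
  · linarith

/-- The roots lie in the closed first quadrant, so the sum of the real and imaginary parts of the
integral is the integral of a nonnegative function. If it vanished, the radicand would be zero
wherever `sin t ≠ 0`; but `t = π/2` would require `Re s = 1` and `t = π/4` would require `Re s =
1/3`. Real `s` is included, which covers the limit values on the cut. -/
theorem sqrtInt_wt0_ne_zero {s : ℂ} (hs : 0 ≤ s.im) : sqrtInt wt0 s ≠ 0 := by
  intro h
  have hre := sqrtInt_re continuous_wt0 hs
  have him := sqrtInt_im continuous_wt0 hs
  rw [h] at hre him
  have hcr : Continuous fun t => wt0 t * (csqrt (radicand s t)).re :=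
    continuous_wt0.mul (continuous_re_csqrt hs)
  have hci : Continuous fun t => wt0 t * (csqrt (radicand s t)).im :=
    continuous_wt0.mul (continuous_im_csqrt hs)
  have hadd : ∫ t in (0 : ℝ)..(2 * Real.pi),
      (wt0 t * (csqrt (radicand s t)).re + wt0 t * (csqrt (radicand s t)).im) = 0 := by
    rw [intervalIntegral.integral_add (hcr.intervalIntegrable _ _) (hci.intervalIntegrable _ _),
      ← hre, ← him]
    simp
  have hnn : ∀ t, 0 ≤ wt0 t * (csqrt (radicand s t)).re + wt0 t * (csqrt (radicand s t)).im :=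
    fun t => add_nonneg (mul_nonneg (wt0_nonneg t) (csqrt_re_nonneg _))
      (mul_nonneg (wt0_nonneg t) (im_csqrt_radicand_nonneg hs t))
  have key : ∀ t ∈ Icc 0 (2 * Real.pi), 0 < wt0 t → radicand s t = 0 := by
    intro t ht hw
    by_contra hne
    have hp := csqrt_re_add_im_pos (z := radicand s t)
      (by rw [radicand_im]; positivity) hne
    have hp' : 0 < wt0 t * (csqrt (radicand s t)).re + wt0 t * (csqrt (radicand s t)).im := by
      rw [← mul_add]; exact mul_pos hw hp
    have := integral_pos_of_continuous (hcr.add hci) hnn ht hp'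
    exact this.ne' hadd
  have hpi := Real.pi_pos
  have k1 := key (Real.pi / 2) ⟨by positivity, by linarith⟩ (by simp [wt0])
  have k2 := key (Real.pi / 4) ⟨by positivity, by linarith⟩ (by
    simp only [wt0, Real.sin_pi_div_four]; positivity)
  have r1 := congrArg Complex.re k1
  have r2 := congrArg Complex.re k2
  rw [radicand_re] at r1 r2
  have e : (√2 / 2) ^ 2 = (1 / 2 : ℝ) := by
    rw [div_pow, Real.sq_sqrt (by norm_num)]; norm_num
  simp only [Real.cos_pi_div_two, Real.sin_pi_div_two, Real.cos_pi_div_four,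
    Real.sin_pi_div_four, e, Complex.zero_re] at r1 r2
  linarith

theorem integral_wt0 : ∫ t in (0 : ℝ)..(2 * Real.pi), wt0 t = Real.pi := by
  unfold wt0
  rw [integral_sin_sq]
  simp

theorem integral_wt2 : ∫ t in (0 : ℝ)..(2 * Real.pi), wt2 t = Real.pi / 4 := by
  have h := integral_sin_sq_mul_cos_sq (a := 0) (b := 2 * Real.pi)
  have h8 : Real.sin (4 * (2 * Real.pi)) = 0 := by
    have := Real.sin_nat_mul_pi 8
    rw [show (4 * (2 * Real.pi)) = ((8 : ℕ) : ℝ) * Real.pi by push_cast; ring]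
    exact this
  have e : ∀ t, wt2 t = Real.sin t ^ 2 * Real.cos t ^ 2 := fun t => mul_comm _ _
  simp only [e]
  rw [h, h8]
  simp
  ring

theorem csqrt_parts (z : ℂ) : (csqrt z).re ^ 2 - (csqrt z).im ^ 2 = z.re ∧
    2 * ((csqrt z).re * (csqrt z).im) = z.im ∧
    (csqrt z).re ^ 2 + (csqrt z).im ^ 2 = ‖z‖ := by
  have h := csqrt_sq z
  refine ⟨?_, ?_, ?_⟩
  · have := congrArg Complex.re h
    rw [pow_two, Complex.mul_re] at this
    linarith
  · have := congrArg Complex.im h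
    rw [pow_two, Complex.mul_im] at this
    linarith
  · have := congrArg norm h
    rw [norm_pow, ← Complex.normSq_eq_norm_sq, Complex.normSq_apply] at this
    linarith

/-- For `‖s‖ ≥ 2` the radicand has modulus between `‖s‖ / 2` and `3 ‖s‖`. With `x + iy` its root,
the sum of its real and imaginary parts is `x² - y² + 2xy`, which is nonnegative because `Re s + Im
s ≥ ‖s‖ ≥ 2`; this excludes `y > 3x`. Then `‖radicand‖ = x² + y² ≤ 10 x²`, whence the constant `20`.
-/
theorem csqrt_radicand_bounds {s : ℂ} (hre : 0 ≤ s.re) (him : 0 ≤ s.im) (hs : 2 ≤ ‖s‖) (t : ℝ) :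
    (csqrt (radicand s t)).im ≤ 3 * (csqrt (radicand s t)).re ∧
    √(‖s‖ / 20) ≤ (csqrt (radicand s t)).re ∧ (csqrt (radicand s t)).re ≤ √(3 * ‖s‖) := by
  obtain ⟨h1, h2, h3⟩ := csqrt_parts (radicand s t)
  have hx := csqrt_re_nonneg (radicand s t)
  have hy := im_csqrt_radicand_nonneg him t
  rw [radicand_re] at h1
  rw [radicand_im] at h2
  set x := (csqrt (radicand s t)).re
  set y := (csqrt (radicand s t)).im
  have hc0 := sq_nonneg (Real.cos t)
  have hc1 := Real.cos_sq_le_one t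
  have hsc := Real.sin_sq t
  have hl1 : ‖s‖ ≤ s.re + s.im := by
    have := Complex.norm_le_abs_re_add_abs_im s
    rwa [abs_of_nonneg hre, abs_of_nonneg him] at this
  have hW1 : ‖radicand s t‖ ≤ 3 * ‖s‖ := by
    have e : radicand s t = s * ((1 + Real.cos t ^ 2 : ℝ) : ℂ) - ((Real.sin t ^ 2 : ℝ) : ℂ) := by
      unfold radicand; push_cast; rfl
    have := norm_sub_le (s * ((1 + Real.cos t ^ 2 : ℝ) : ℂ)) ((Real.sin t ^ 2 : ℝ) : ℂ)
    rw [← e, norm_mul, Complex.norm_real, Complex.norm_real, Real.norm_eq_abs, Real.norm_eq_abs,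
      abs_of_nonneg (by positivity), abs_of_nonneg (by positivity)] at this
    nlinarith [norm_nonneg s]
  have hW2 : ‖s‖ / 2 ≤ ‖radicand s t‖ := by
    have e : radicand s t = s * ((1 + Real.cos t ^ 2 : ℝ) : ℂ) - ((Real.sin t ^ 2 : ℝ) : ℂ) := by
      unfold radicand; push_cast; rfl
    have := norm_sub_norm_le (s * ((1 + Real.cos t ^ 2 : ℝ) : ℂ)) ((Real.sin t ^ 2 : ℝ) : ℂ)
    rw [← e, norm_mul, Complex.norm_real, Complex.norm_real, Real.norm_eq_abs, Real.norm_eq_abs,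
      abs_of_nonneg (by positivity), abs_of_nonneg (by positivity)] at this
    nlinarith [norm_nonneg s]
  have hxy : y ≤ 3 * x := by
    by_contra hc
    push Not at hc
    have hsum : 0 ≤ x ^ 2 - y ^ 2 + 2 * (x * y) := by
      rw [h1, h2]
      nlinarith
    nlinarith
  refine ⟨hxy, ?_, ?_⟩
  · rw [Real.sqrt_le_left hx]
    nlinarith
  · refine Real.le_sqrt_of_sq_le ?_
    nlinarith

/-- The quotient of the two integrals, equal to `I₂ / ((1 + s) I₀)`. -/
noncomputable def ratio (s : ℂ) : ℂ := sqrtInt wt2 s / sqrtInt wt0 s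

/-- Both integrals lie in the sector `0 ≤ Im ≤ 3 Re`. The pointwise bounds differ by a factor `√60 <
8` and the weights have integrals `π` and `π / 4`, so the real parts differ by at most a factor
`32`. The sector costs a further factor `10`, giving `1 / 320`; the bound `4` comes from `√10 < 4`.
-/
theorem ratio_bounds_quadrant {s : ℂ} (hre : 0 ≤ s.re) (him : 0 ≤ s.im) (hs : 2 ≤ ‖s‖) :
    1 / 320 ≤ (ratio s).re ∧ ‖ratio s‖ ≤ 4 := by
  have hb := csqrt_radicand_bounds hre him hs
  have hcr := continuous_re_csqrt him
  have hci := continuous_im_csqrt him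
  have hp0 := sqrtInt_re continuous_wt0 him
  have hq0 := sqrtInt_im continuous_wt0 him
  have hp2 := sqrtInt_re continuous_wt2 him
  have hq2 := sqrtInt_im continuous_wt2 him
  have hq0nn : 0 ≤ (sqrtInt wt0 s).im := by
    rw [hq0]
    exact intervalIntegral.integral_nonneg two_pi_pos.le fun t _ =>
      mul_nonneg (wt0_nonneg t) (im_csqrt_radicand_nonneg him t)
  have hq2nn : 0 ≤ (sqrtInt wt2 s).im := by
    rw [hq2]
    exact intervalIntegral.integral_nonneg two_pi_pos.le fun t _ =>
      mul_nonneg (wt2_nonneg t) (im_csqrt_radicand_nonneg him t)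
  have hle : ∀ φ : ℝ → ℝ, Continuous φ → (∀ t, 0 ≤ φ t) →
      (sqrtInt φ s).im ≤ 3 * (sqrtInt φ s).re := by
    intro φ hφ h0
    rw [sqrtInt_re hφ him, sqrtInt_im hφ him, ← intervalIntegral.integral_const_mul]
    refine integral_mono_of_continuous (hφ.mul hci) ((hφ.mul hcr).const_mul 3) fun t => ?_
    have := mul_le_mul_of_nonneg_left (hb t).1 (h0 t)
    linarith
  have h30 := hle wt0 continuous_wt0 wt0_nonneg
  have h32 := hle wt2 continuous_wt2 wt2_nonneg
  have h20 : (sqrtInt wt2 s).re ≤ (sqrtInt wt0 s).re := by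
    rw [hp0, hp2]
    exact integral_mono_of_continuous (continuous_wt2.mul hcr) (continuous_wt0.mul hcr)
      fun t => mul_le_mul_of_nonneg_right (wt2_le_wt0 t) (csqrt_re_nonneg _)
  have hup : (sqrtInt wt0 s).re ≤ √(3 * ‖s‖) * Real.pi := by
    have e := integral_wt0
    rw [hp0]
    conv_rhs => rw [← e, ← intervalIntegral.integral_const_mul]
    refine integral_mono_of_continuous (continuous_wt0.mul hcr) (continuous_wt0.const_mul _)
      fun t => ?_
    have := mul_le_mul_of_nonneg_left (hb t).2.2 (wt0_nonneg t)
    linarith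
  have hlow : √(‖s‖ / 20) * (Real.pi / 4) ≤ (sqrtInt wt2 s).re := by
    rw [hp2, ← integral_wt2, ← intervalIntegral.integral_const_mul]
    refine integral_mono_of_continuous (continuous_wt2.const_mul _) (continuous_wt2.mul hcr)
      fun t => ?_
    have := mul_le_mul_of_nonneg_left (hb t).2.1 (wt2_nonneg t)
    linarith
  have hsq : √(3 * ‖s‖) ≤ 8 * √(‖s‖ / 20) := by
    rw [show (8 : ℝ) = √64 by rw [show (64 : ℝ) = 8 ^ 2 by norm_num, Real.sqrt_sq (by norm_num)],
      ← Real.sqrt_mul (by norm_num)]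
    exact Real.sqrt_le_sqrt (by linarith)
  have hpi := Real.pi_pos
  have h02 : (sqrtInt wt0 s).re ≤ 32 * (sqrtInt wt2 s).re := by nlinarith
  have hp2pos : 0 < (sqrtInt wt2 s).re := by
    have : 0 < √(‖s‖ / 20) := Real.sqrt_pos.2 (by linarith)
    have : 0 < √(‖s‖ / 20) * (Real.pi / 4) := by positivity
    linarith
  have hns0 : 0 < Complex.normSq (sqrtInt wt0 s) :=
    Complex.normSq_pos.2 (sqrtInt_wt0_ne_zero him)
  unfold ratio
  constructor
  · rw [Complex.div_re, ← add_div, le_div_iff₀ hns0, Complex.normSq_apply]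
    nlinarith [mul_nonneg hq0nn hq2nn]
  · rw [norm_div, div_le_iff₀ (norm_pos_iff.2 (sqrtInt_wt0_ne_zero him))]
    refine (sq_le_sq₀ (norm_nonneg _) (by positivity)).1 ?_
    rw [mul_pow, ← Complex.normSq_eq_norm_sq, ← Complex.normSq_eq_norm_sq,
      Complex.normSq_apply, Complex.normSq_apply]
    nlinarith

/-! ### Reflection in the real axis. -/

theorem csqrt_conj {z : ℂ} (hz : z ∈ Complex.slitPlane) :
    csqrt ((starRingEnd ℂ) z) = (starRingEnd ℂ) (csqrt z) := by
  unfold csqrt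
  rw [Complex.conj_cpow _ _ (Complex.mem_slitPlane_iff_arg.1 hz).1]
  congr 2
  rw [map_div₀, map_one, Complex.conj_ofNat]

theorem radicand_conj (s : ℂ) (t : ℝ) :
    radicand ((starRingEnd ℂ) s) t = (starRingEnd ℂ) (radicand s t) := by
  unfold radicand
  simp only [map_sub, map_mul, map_add, map_one, map_pow, Complex.conj_ofReal]

theorem sqrtInt_conj (φ : ℝ → ℝ) {s : ℂ} (hs : s ∈ cutPlane) :
    sqrtInt φ ((starRingEnd ℂ) s) = (starRingEnd ℂ) (sqrtInt φ s) := by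
  unfold sqrtInt
  rw [← intervalIntegral.intervalIntegral_conj]
  congr 1
  funext t
  rw [radicand_conj, csqrt_conj (radicand_mem_slitPlane hs t), map_mul, Complex.conj_ofReal]

theorem ratio_conj {s : ℂ} (hs : s ∈ cutPlane) :
    ratio ((starRingEnd ℂ) s) = (starRingEnd ℂ) (ratio s) := by
  unfold ratio
  rw [sqrtInt_conj _ hs, sqrtInt_conj _ hs, map_div₀]

theorem sqrtInt_wt0_ne_zero_of_cutPlane {s : ℂ} (hs : s ∈ cutPlane) : sqrtInt wt0 s ≠ 0 := by
  rcases le_total 0 s.im with h | h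
  · exact sqrtInt_wt0_ne_zero h
  · have h1 := sqrtInt_wt0_ne_zero (s := (starRingEnd ℂ) s) (by simpa using h)
    rw [sqrtInt_conj _ hs] at h1
    exact fun h2 => h1 (by rw [h2, map_zero])

theorem ratio_bounds {s : ℂ} (hre : 0 < s.re) (hs : 2 ≤ ‖s‖) :
    s ∈ cutPlane ∧ 1 / 320 ≤ (ratio s).re ∧ ‖ratio s‖ ≤ 4 := by
  have hc : s ∈ cutPlane := by
    by_cases h : s.im = 0
    · left
      have := Complex.norm_le_abs_re_add_abs_im s
      rw [h, abs_zero, add_zero, abs_of_pos hre] at this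
      linarith
    · exact Or.inr h
  refine ⟨hc, ?_⟩
  rcases le_total 0 s.im with h | h
  · exact ratio_bounds_quadrant hre.le h hs
  · have := ratio_bounds_quadrant (s := (starRingEnd ℂ) s) (by simpa using hre.le)
      (by simpa using h) (by simpa using hs)
    rw [ratio_conj hc] at this
    simpa using this

/-! ### Real values of `s` -/

theorem csqrt_ofReal_eq (r : ℝ) : (csqrt (r : ℂ)).re = √r ∧ (csqrt (r : ℂ)).im = √(-r) := by
  obtain ⟨h1, h2, -⟩ := csqrt_parts (r : ℂ)
  have hx := csqrt_re_nonneg (r : ℂ)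
  have hy := csqrt_im_nonneg (z := (r : ℂ)) (by simp)
  rw [Complex.ofReal_re] at h1
  rw [Complex.ofReal_im] at h2
  have h2' : (csqrt (r : ℂ)).re * (csqrt (r : ℂ)).im = 0 := by linarith
  rcases mul_eq_zero.1 h2' with h | h
  · rw [h] at h1 ⊢
    have hr : r ≤ 0 := by nlinarith
    refine ⟨(Real.sqrt_eq_zero_of_nonpos hr).symm, ?_⟩
    rw [show -r = (csqrt (r : ℂ)).im ^ 2 by linarith, Real.sqrt_sq hy]
  · rw [h] at h1 ⊢
    have hr : 0 ≤ r := by nlinarith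
    refine ⟨?_, (Real.sqrt_eq_zero_of_nonpos (by linarith)).symm⟩
    conv_rhs => rw [show r = (csqrt (r : ℂ)).re ^ 2 by linarith, Real.sqrt_sq hx]

/-- The radicand for real `s`. -/
noncomputable def realRadicand (s t : ℝ) : ℝ := s * (1 + Real.cos t ^ 2) - Real.sin t ^ 2

theorem radicand_ofReal (s t : ℝ) : radicand (s : ℂ) t = (realRadicand s t : ℂ) := by
  unfold radicand realRadicand; push_cast; rfl

theorem realRadicand_eq (s t : ℝ) : realRadicand s t = (1 + s) * Real.cos t ^ 2 - (1 - s) := by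
  unfold realRadicand
  rw [Real.sin_sq]
  ring

theorem continuous_realRadicand (s : ℝ) : Continuous (realRadicand s) := by
  unfold realRadicand; fun_prop

theorem sqrtInt_ofReal_re {φ : ℝ → ℝ} (hφ : Continuous φ) (s : ℝ) :
    (sqrtInt φ s).re = ∫ t in (0 : ℝ)..(2 * Real.pi), φ t * √(realRadicand s t) := by
  rw [sqrtInt_re hφ (by simp)]
  simp only [radicand_ofReal, csqrt_ofReal_eq]

theorem sqrtInt_ofReal_im {φ : ℝ → ℝ} (hφ : Continuous φ) (s : ℝ) :
    (sqrtInt φ s).im = ∫ t in (0 : ℝ)..(2 * Real.pi), φ t * √(-realRadicand s t) := by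
  rw [sqrtInt_im hφ (by simp)]
  simp only [radicand_ofReal, csqrt_ofReal_eq]

/-- Serves integrands with `|cos t|` or `|sin t|`: on a suitable interval of length `π` the absolute
value can be dropped and an antiderivative is elementary. -/
theorem integral_eq_zero_of_periodic_pi {g : ℝ → ℝ} (hg : Continuous g)
    (hp : Function.Periodic g Real.pi) {a : ℝ} (ha : ∫ t in a..a + Real.pi, g t = 0) :
    ∫ t in (0 : ℝ)..(2 * Real.pi), g t = 0 := by
  have h1 := hp.intervalIntegral_add_eq 0 a
  have h2 := hp.intervalIntegral_add_eq Real.pi a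
  rw [ha] at h1 h2
  rw [zero_add] at h1
  rw [← two_mul] at h2
  rw [← intervalIntegral.integral_add_adjacent_intervals (hg.intervalIntegrable 0 Real.pi)
    (hg.intervalIntegrable Real.pi (2 * Real.pi)), h1, h2, add_zero]

theorem continuous_sqrt_realRadicand (s : ℝ) : Continuous fun t => √(realRadicand s t) :=
  Real.continuous_sqrt.comp (continuous_realRadicand s)

theorem continuous_sqrt_neg_realRadicand (s : ℝ) : Continuous fun t => √(-realRadicand s t) :=
  Real.continuous_sqrt.comp (continuous_realRadicand s).neg

theorem sqrtInt_im_eq_zero {φ : ℝ → ℝ} (hφ : Continuous φ) {s : ℝ} (hs : 1 ≤ s) :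
    (sqrtInt φ s).im = 0 := by
  rw [sqrtInt_ofReal_im hφ]
  have : ∀ t, √(-realRadicand s t) = 0 := fun t => by
    refine Real.sqrt_eq_zero_of_nonpos ?_
    rw [realRadicand_eq]
    nlinarith [sq_nonneg (Real.cos t)]
  simp [this]

/-- At `s = 1`, that is `h = 0`, the radicand is `2 cos²`, and `(sin³ cos²)' = (5 cos² - 2) sin²
cos` yields `5 ∫ wt2 |cos| = 2 ∫ wt0 |cos|`. -/
theorem ratio_one : ratio 1 = 2 / 5 := by
  have h0 : sqrtInt wt0 (1 : ℂ) ≠ 0 := sqrtInt_wt0_ne_zero (by simp)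
  have him0 := sqrtInt_im_eq_zero continuous_wt0 (s := 1) le_rfl
  have him2 := sqrtInt_im_eq_zero continuous_wt2 (s := 1) le_rfl
  have hre0 := sqrtInt_ofReal_re continuous_wt0 1
  have hre2 := sqrtInt_ofReal_re continuous_wt2 1
  rw [Complex.ofReal_one] at him0 him2 hre0 hre2
  have hr : ∀ t, √(realRadicand 1 t) = √2 * |Real.cos t| := fun t => by
    rw [realRadicand_eq, show (1 + 1 : ℝ) * Real.cos t ^ 2 - (1 - 1) = 2 * Real.cos t ^ 2 by ring,
      Real.sqrt_mul (by norm_num), Real.sqrt_sq_eq_abs]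
  have hc : Continuous fun t => (5 * wt2 t - 2 * wt0 t) * (√2 * |Real.cos t|) :=
    ((continuous_wt2.const_mul 5).sub (continuous_wt0.const_mul 2)).mul
      (continuous_const.mul Real.continuous_cos.abs)
  have key : ∫ t in (0 : ℝ)..(2 * Real.pi), (5 * wt2 t - 2 * wt0 t) * (√2 * |Real.cos t|) = 0 := by
    refine integral_eq_zero_of_periodic_pi hc (fun t => ?_) (a := -(Real.pi / 2)) ?_
    · simp [wt0, wt2, Real.sin_add_pi, Real.cos_add_pi]
    · have hd : ∀ t ∈ uIcc (-(Real.pi / 2)) (-(Real.pi / 2) + Real.pi),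
          HasDerivAt (fun t => √2 * (Real.sin t ^ 3 * Real.cos t ^ 2))
            ((5 * wt2 t - 2 * wt0 t) * (√2 * |Real.cos t|)) t := by
        intro t ht
        have hpi := Real.pi_pos
        rw [uIcc_of_le (by linarith)] at ht
        have hcos : 0 ≤ Real.cos t := Real.cos_nonneg_of_mem_Icc ⟨ht.1, by linarith [ht.2]⟩
        have h1 := (((Real.hasDerivAt_sin t).pow 3).mul ((Real.hasDerivAt_cos t).pow 2)).const_mul √2
        convert! h1 using 1
        rw [abs_of_nonneg hcos]
        simp only [Pi.pow_apply]
        unfold wt2 wt0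
        have := Real.sin_sq t
        push_cast
        linear_combination (2 * √2 * Real.sin t ^ 2 * Real.cos t) * this
      rw [intervalIntegral.integral_eq_sub_of_hasDerivAt hd (hc.intervalIntegrable _ _)]
      have : -(Real.pi / 2) + Real.pi = Real.pi / 2 := by ring
      rw [this]
      simp
  have hlin : 5 * (sqrtInt wt2 1).re - 2 * (sqrtInt wt0 1).re = 0 := by
    rw [hre0, hre2, ← intervalIntegral.integral_const_mul, ← intervalIntegral.integral_const_mul,
      ← intervalIntegral.integral_sub, ← key]
    · congr 1
      funext t
      rw [hr]
      ring
    · exact ((continuous_wt2.mul (continuous_sqrt_realRadicand 1)).const_mul 5).intervalIntegrable _ _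
    · exact ((continuous_wt0.mul (continuous_sqrt_realRadicand 1)).const_mul 2).intervalIntegrable _ _
  unfold ratio
  rw [div_eq_div_iff h0 (by norm_num)]
  apply Complex.ext
  · simp; linarith
  · simp [him0, him2]

/-- At `s = 0`, that is `h = -1/4`, the radicand is `-sin²`, so both integrals are purely imaginary,
and `(cos sin⁴)' = (5 cos² - 1) sin³` relates them. -/
theorem ratio_zero : ratio 0 = 1 / 5 := by
  have h0 : sqrtInt wt0 (0 : ℂ) ≠ 0 := sqrtInt_wt0_ne_zero (by simp)
  have hre0 := sqrtInt_ofReal_re continuous_wt0 0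
  have hre2 := sqrtInt_ofReal_re continuous_wt2 0
  have him0 := sqrtInt_ofReal_im continuous_wt0 0
  have him2 := sqrtInt_ofReal_im continuous_wt2 0
  rw [Complex.ofReal_zero] at him0 him2 hre0 hre2
  have e : ∀ t, realRadicand 0 t = -Real.sin t ^ 2 := fun t => by unfold realRadicand; ring
  have hr : ∀ t, √(-realRadicand 0 t) = |Real.sin t| := fun t => by
    rw [e, neg_neg, Real.sqrt_sq_eq_abs]
  have hr' : ∀ t, √(realRadicand 0 t) = 0 := fun t => by
    rw [e]
    exact Real.sqrt_eq_zero_of_nonpos (neg_nonpos.2 (sq_nonneg _))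
  have hc : Continuous fun t => (5 * wt2 t - wt0 t) * |Real.sin t| :=
    ((continuous_wt2.const_mul 5).sub continuous_wt0).mul Real.continuous_sin.abs
  have key : ∫ t in (0 : ℝ)..(2 * Real.pi), (5 * wt2 t - wt0 t) * |Real.sin t| = 0 := by
    refine integral_eq_zero_of_periodic_pi hc (fun t => ?_) (a := 0) ?_
    · simp [wt0, wt2, Real.sin_add_pi, Real.cos_add_pi]
    · have hd : ∀ t ∈ uIcc 0 (0 + Real.pi),
          HasDerivAt (fun t => Real.cos t * Real.sin t ^ 4)
            ((5 * wt2 t - wt0 t) * |Real.sin t|) t := by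
        intro t ht
        have hpi := Real.pi_pos
        rw [uIcc_of_le (by linarith), zero_add] at ht
        have hsin : 0 ≤ Real.sin t := Real.sin_nonneg_of_nonneg_of_le_pi ht.1 ht.2
        have h1 := (Real.hasDerivAt_cos t).mul ((Real.hasDerivAt_sin t).pow 4)
        convert! h1 using 1
        rw [abs_of_nonneg hsin]
        simp only [Pi.pow_apply]
        unfold wt2 wt0
        have := Real.sin_sq t
        push_cast
        linear_combination (Real.sin t ^ 3) * this
      rw [intervalIntegral.integral_eq_sub_of_hasDerivAt hd (hc.intervalIntegrable _ _)]
      simp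
  have hlin : 5 * (sqrtInt wt2 0).im - (sqrtInt wt0 0).im = 0 := by
    refine Eq.trans ?_ key
    rw [him0, him2, ← intervalIntegral.integral_const_mul, ← intervalIntegral.integral_sub]
    · congr 1
      funext t
      rw [hr]
      ring
    · exact ((continuous_wt2.mul (continuous_sqrt_neg_realRadicand 0)).const_mul
        5).intervalIntegrable _ _
    · exact (continuous_wt0.mul (continuous_sqrt_neg_realRadicand 0)).intervalIntegrable _ _
  simp only [hr', mul_zero, intervalIntegral.integral_zero] at hre0 hre2
  unfold ratio
  rw [div_eq_div_iff h0 (by norm_num)]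
  apply Complex.ext
  · simp [hre0, hre2]
  · simp; linarith

/-- The radicand is real and changes sign at `cos² = c`: its root is real where `cos² ≥ c` and
imaginary where `cos² ≤ c`. Hence the weighted average of `cos²` is at least `c` in the real parts
and below `c` in the imaginary parts, so the integral with `wt2` has the smaller argument. -/
theorem ratio_im_neg {s : ℝ} (h0 : 0 < s) (h1 : s < 1) : (ratio s).im < 0 := by
  set c := (1 - s) / (1 + s) with hc
  have hcs : (1 + s) * c = 1 - s := by rw [hc]; field_simp
  have hrad : ∀ t, realRadicand s t = (1 + s) * (Real.cos t ^ 2 - c) := fun t => by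
    rw [realRadicand_eq, mul_sub, hcs]
  have hpi := Real.pi_pos
  have hre0 := sqrtInt_ofReal_re continuous_wt0 s
  have hre2 := sqrtInt_ofReal_re continuous_wt2 s
  have him0 := sqrtInt_ofReal_im continuous_wt0 s
  have him2 := sqrtInt_ofReal_im continuous_wt2 s
  have cr := continuous_sqrt_realRadicand s
  have ci := continuous_sqrt_neg_realRadicand s
  have a0 : 0 < (sqrtInt wt0 s).re := by
    rw [hre0]
    have hle : √(s / 2) ≤ 1 := Real.sqrt_le_one.2 (by linarith)
    have hsin : Real.sin (Real.arcsin √(s / 2)) ^ 2 = s / 2 := by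
      rw [Real.sin_arcsin (by linarith [Real.sqrt_nonneg (s / 2)]) hle, Real.sq_sqrt (by linarith)]
    -- At a point with `sin² = s / 2` the weight is positive and the radicand equals `s (3 - s) / 2
    -- > 0`.
    refine integral_pos_of_continuous (continuous_wt0.mul cr)
      (fun t => mul_nonneg (wt0_nonneg t) (Real.sqrt_nonneg _))
      (t₀ := Real.arcsin √(s / 2)) ⟨Real.arcsin_nonneg.2 (Real.sqrt_nonneg _), ?_⟩ ?_
    · linarith [Real.arcsin_le_pi_div_two √(s / 2)]
    · refine mul_pos (by unfold wt0; rw [hsin]; linarith) (Real.sqrt_pos.2 ?_)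
      unfold realRadicand
      rw [Real.cos_sq', hsin]
      nlinarith
  have b0 : 0 ≤ (sqrtInt wt0 s).im := by
    rw [him0]
    exact intervalIntegral.integral_nonneg two_pi_pos.le fun t _ =>
      mul_nonneg (wt0_nonneg t) (Real.sqrt_nonneg _)
  have a2 : c * (sqrtInt wt0 s).re ≤ (sqrtInt wt2 s).re := by
    rw [hre0, hre2, ← intervalIntegral.integral_const_mul]
    refine integral_mono_of_continuous ((continuous_wt0.mul cr).const_mul c)
      (continuous_wt2.mul cr) fun t => ?_
    have h : 0 ≤ (Real.cos t ^ 2 - c) * √(realRadicand s t) := by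
      rcases le_total c (Real.cos t ^ 2) with h | h
      · exact mul_nonneg (by linarith) (Real.sqrt_nonneg _)
      · rw [Real.sqrt_eq_zero_of_nonpos (by rw [hrad]; nlinarith), mul_zero]
    have := mul_nonneg (wt0_nonneg t) h
    unfold wt2
    unfold wt0 at this ⊢
    linarith
  have b2 : (sqrtInt wt2 s).im < c * (sqrtInt wt0 s).im := by
    have ci0 : Continuous fun t => c * (wt0 t * √(-realRadicand s t)) :=
      (continuous_wt0.mul ci).const_mul c
    have ci2 : Continuous fun t => wt2 t * √(-realRadicand s t) := continuous_wt2.mul ci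
    rw [him0, him2, ← intervalIntegral.integral_const_mul, ← sub_pos,
      ← intervalIntegral.integral_sub (ci0.intervalIntegrable _ _) (ci2.intervalIntegrable _ _)]
    have hE : ∀ t, c * (wt0 t * √(-realRadicand s t)) - wt2 t * √(-realRadicand s t) =
        wt0 t * ((c - Real.cos t ^ 2) * √(-realRadicand s t)) := fun t => by
      unfold wt2 wt0; ring
    have hcpos : 0 < c := by rw [hc]; exact div_pos (by linarith) (by linarith)
    simp only [hE]
    refine integral_pos_of_continuous (t₀ := Real.pi / 2)
      (continuous_wt0.mul ((continuous_const.sub (Real.continuous_cos.pow 2)).mul ci))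
      (fun t => mul_nonneg (wt0_nonneg t) ?_) ⟨by positivity, by linarith⟩ ?_
    · rcases le_total (Real.cos t ^ 2) c with h | h
      · exact mul_nonneg (by linarith) (Real.sqrt_nonneg _)
      · rw [Real.sqrt_eq_zero_of_nonpos (by rw [hrad]; nlinarith), mul_zero]
    · rw [hrad]
      simp only [wt0, Real.cos_pi_div_two, Real.sin_pi_div_two]
      have : 0 < √(-((1 + s) * (0 ^ 2 - c))) := Real.sqrt_pos.2 (by nlinarith)
      have : 0 < c * √(-((1 + s) * (0 ^ 2 - c))) := by positivity
      simpa using this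
  have hns : 0 < Complex.normSq (sqrtInt wt0 s) :=
    Complex.normSq_pos.2 (sqrtInt_wt0_ne_zero (by simp))
  unfold ratio
  rw [Complex.div_im, ← sub_div]
  refine div_neg_of_neg_of_pos ?_ hns
  nlinarith

/-- Chebyshev's inequality: for real `s ≥ 1` both `cos²` and the root increase with `cos²`, and
`1/4` is the average of `cos²` for the weight `wt0`. -/
theorem ratio_real {s : ℝ} (hs : 1 ≤ s) : (ratio s).im = 0 ∧ 1 / 4 ≤ (ratio s).re := by
  have i0 := sqrtInt_im_eq_zero continuous_wt0 hs
  have i2 := sqrtInt_im_eq_zero continuous_wt2 hs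
  have hre0 := sqrtInt_ofReal_re continuous_wt0 s
  have hre2 := sqrtInt_ofReal_re continuous_wt2 s
  have cr := continuous_sqrt_realRadicand s
  have a0 : 0 < (sqrtInt wt0 s).re := by
    have h1 : 0 ≤ (sqrtInt wt0 s).re := by
      rw [hre0]
      exact intervalIntegral.integral_nonneg two_pi_pos.le fun t _ =>
        mul_nonneg (wt0_nonneg t) (Real.sqrt_nonneg _)
    refine h1.lt_of_ne fun h => sqrtInt_wt0_ne_zero (s := (s : ℂ)) (by simp) ?_
    exact Complex.ext h.symm i0
  have key : 0 ≤ (sqrtInt wt2 s).re - 1 / 4 * (sqrtInt wt0 s).re := by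
    -- The value of the root where `cos² = 1/4`.
    set m := √((1 + s) * (1 / 4) - (1 - s)) with hm
    have hz : ∫ t in (0 : ℝ)..(2 * Real.pi), (wt2 t * m - 1 / 4 * (wt0 t * m)) = 0 := by
      rw [intervalIntegral.integral_sub ((continuous_wt2.mul_const m).intervalIntegrable _ _)
        (((continuous_wt0.mul_const m).const_mul (1 / 4)).intervalIntegrable _ _),
        intervalIntegral.integral_const_mul, intervalIntegral.integral_mul_const,
        intervalIntegral.integral_mul_const, integral_wt0, integral_wt2]
      ring
    have cr0 : Continuous fun t => 1 / 4 * (wt0 t * √(realRadicand s t)) :=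
      (continuous_wt0.mul cr).const_mul (1 / 4)
    have cr2 : Continuous fun t => wt2 t * √(realRadicand s t) := continuous_wt2.mul cr
    rw [hre0, hre2, ← intervalIntegral.integral_const_mul, ← intervalIntegral.integral_sub
      (cr2.intervalIntegrable _ _) (cr0.intervalIntegrable _ _)]
    refine hz.symm.le.trans ?_
    refine integral_mono_of_continuous
      ((continuous_wt2.mul_const m).sub ((continuous_wt0.mul_const m).const_mul (1 / 4)))
      (cr2.sub cr0) fun t => ?_
    have h : 0 ≤ (Real.cos t ^ 2 - 1 / 4) * (√(realRadicand s t) - m) := by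
      rcases le_total (1 / 4) (Real.cos t ^ 2) with h | h
      · refine mul_nonneg (by linarith) (sub_nonneg.2 (Real.sqrt_le_sqrt ?_))
        rw [realRadicand_eq]
        nlinarith
      · refine mul_nonneg_of_nonpos_of_nonpos (by linarith) (sub_nonpos.2 (Real.sqrt_le_sqrt ?_))
        rw [realRadicand_eq]
        nlinarith
    have := mul_nonneg (wt0_nonneg t) h
    unfold wt2
    unfold wt0 at this ⊢
    linarith
  unfold ratio
  rw [Complex.div_im, Complex.div_re, i0, i2, Complex.normSq_apply, i0]
  refine ⟨by simp, ?_⟩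
  simp only [mul_zero, zero_div, add_zero]
  rw [le_div_iff₀ (by positivity)]
  nlinarith

/-- Shows that `I₂ / I₀` falls below its value `4/5` at `h = 0` for some `h > 0`. The two relations
reduce `4 N0 - 5 N2` to a positive multiple of `∫ (s - r²) / r`, where `r` is the root of the
radicand. The choice `s = 121/100` is close to `1` and makes `√s`, the zero of `s - r²`, rational.
-/
theorem N2_lt_of_real : 5 * (N2 (121 / 100)).re < 4 * (N0 (121 / 100)).re := by
  set s : ℂ := 121 / 100 with hs
  have hsr : s = ((121 / 100 : ℝ) : ℂ) := by rw [hs]; push_cast; rfl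
  have hsc : s ∈ cutPlane := by left; rw [hsr, Complex.ofReal_re]; norm_num
  have h3 : s + 1 ≠ 0 := by rw [hs]; norm_num
  have r1 := cosInt_relation_one hsc
  have r2 := cosInt_relation_two hsc
  have e2 : cosInt 2 s = (4 * cosInt 1 s + (s - 1) * cosInt 0 s) / (3 * (s + 1)) := by
    rw [eq_div_iff (mul_ne_zero three_ne_zero h3)]; linear_combination r1
  have e3 : cosInt 3 s = (8 * cosInt 2 s + 3 * (s - 1) * cosInt 1 s) / (5 * (s + 1)) := by
    rw [eq_div_iff (mul_ne_zero (by norm_num) h3)]; linear_combination r2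
  have hid : 4 * N0 s - 5 * N2 s = 2 * (s ^ 2 - 1) * (cosInt 0 s - (1 + s) * cosInt 1 s) := by
    unfold N0 N2
    rw [sqrtInt_wt0_eq hsc, sqrtInt_wt2_eq hsc, e3, e2]
    field_simp
    ring
  have hcub := integral_cubic hsc ![1, -(1 + s), 0, 0]
  simp only [Matrix.cons_val_zero, Matrix.cons_val_one, Matrix.cons_val, zero_mul, add_zero]
    at hcub
  set r : ℝ → ℝ := fun t => √(realRadicand (121 / 100) t) with hr
  have hrad : ∀ t, 21 / 100 ≤ realRadicand (121 / 100) t := fun t => by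
    rw [realRadicand_eq]; nlinarith [sq_nonneg (Real.cos t)]
  have hrad' : ∀ t, realRadicand (121 / 100) t ≤ 242 / 100 := fun t => by
    rw [realRadicand_eq]; nlinarith [Real.cos_sq_le_one t]
  have hcs : ∀ t, csqrt (radicand s t) = (r t : ℂ) := fun t => by
    rw [hsr, radicand_ofReal, csqrt_ofReal (by linarith [hrad t])]
  have hrpos : ∀ t, 0 < r t := fun t => Real.sqrt_pos.2 (by linarith [hrad t])
  have hX : cosInt 0 s - (1 + s) * cosInt 1 s = ((∫ t in (0 : ℝ)..(2 * Real.pi),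
      (1 - (221 / 100) * Real.cos t ^ 2) / r t : ℝ) : ℂ) := by
    rw [← intervalIntegral.integral_ofReal, show cosInt 0 s - (1 + s) * cosInt 1 s =
      1 * cosInt 0 s + -(1 + s) * cosInt 1 s by ring, ← hcub]
    congr 1
    funext t
    rw [hcs, hs]
    push_cast
    norm_num
    ring
  have hpos : 0 < ∫ t in (0 : ℝ)..(2 * Real.pi), (1 - (221 / 100) * Real.cos t ^ 2) / r t := by
    -- With `u = 1 - (221/100) cos² = (11/10)² - r²` this is `(10/11) u + u² / 5 ≤ u / r`. The two
    -- sides touch at `r = 11/10`; their difference times `r` is the product in `hfac`, nonnegative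
    -- for `r ≤ 39/25`. The lower bound is a polynomial in `cos²`, integrable by the known moments.
    have hlow : ∀ t, (1 - 221 / 100 + 221 / 100 * wt0 t) * (10 / 11) + 1 / 5 *
        (1 - 2 * (221 / 100) * (1 - wt0 t) + (221 / 100) ^ 2 * (1 - wt0 t - wt2 t)) ≤
        (1 - (221 / 100) * Real.cos t ^ 2) / r t := by
      intro t
      have hx := hrpos t
      have hx2 : r t ^ 2 = 221 / 100 * Real.cos t ^ 2 + 21 / 100 := by
        rw [hr]
        simp only
        rw [Real.sq_sqrt (by linarith [hrad t]), realRadicand_eq]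
        ring
      have hxu : r t ≤ 39 / 25 := by
        refine Real.sqrt_le_iff.2 ⟨by norm_num, ?_⟩
        linarith [hrad' t]
      have e0 : wt0 t = 1 - Real.cos t ^ 2 := by unfold wt0; rw [Real.sin_sq]
      have e2' : wt2 t = Real.cos t ^ 2 * (1 - Real.cos t ^ 2) := by
        unfold wt2; rw [Real.sin_sq]
      rw [e0, e2', le_div_iff₀ hx]
      set x := r t
      have hC : Real.cos t ^ 2 = (x ^ 2 - 21 / 100) * (100 / 221) := by linarith
      rw [hC]
      have hfac : 0 ≤ (x - 11 / 10) ^ 2 * (x + 11 / 10) * (10 / 11 - 1 / 5 * x * (x + 11 / 10)) := by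
        refine mul_nonneg (by positivity) ?_
        nlinarith
      nlinarith
    have hcont : Continuous fun t => (1 - (221 / 100) * Real.cos t ^ 2) / r t :=
      Continuous.div (by fun_prop) (continuous_sqrt_realRadicand _) fun t => (hrpos t).ne'
    have c0 := continuous_wt0
    have c2 := continuous_wt2
    refine lt_of_lt_of_le ?_ (integral_mono_of_continuous (by fun_prop) hcont hlow)
    have hlin : ∀ t, (1 - 221 / 100 + 221 / 100 * wt0 t) * (10 / 11) + 1 / 5 *
        (1 - 2 * (221 / 100) * (1 - wt0 t) + (221 / 100) ^ 2 * (1 - wt0 t - wt2 t)) =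
        (-(121 / 100) * (10 / 11) + 1 / 5 * (1 - 2 * (221 / 100) + (221 / 100) ^ 2)) +
        ((221 / 100) * (10 / 11) + 1 / 5 * (2 * (221 / 100) - (221 / 100) ^ 2)) * wt0 t +
        (-(1 / 5) * (221 / 100) ^ 2) * wt2 t := fun t => by ring
    simp only [hlin]
    rw [intervalIntegral.integral_add (Continuous.intervalIntegrable (by fun_prop) _ _)
      (Continuous.intervalIntegrable (by fun_prop) _ _),
      intervalIntegral.integral_add (Continuous.intervalIntegrable (by fun_prop) _ _)
      (Continuous.intervalIntegrable (by fun_prop) _ _), intervalIntegral.integral_const_mul,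
      intervalIntegral.integral_const_mul, integral_wt0, integral_wt2,
      intervalIntegral.integral_const, smul_eq_mul]
    nlinarith [Real.pi_pos]
  rw [hX] at hid
  have hid' := congrArg Complex.re hid
  rw [hs, show (2 * ((121 / 100 : ℂ) ^ 2 - 1)) = ((2 * ((121 / 100) ^ 2 - 1) : ℝ) : ℂ) by
    push_cast; rfl, ← Complex.ofReal_mul, Complex.ofReal_re, Complex.sub_re] at hid'
  simp only [Complex.mul_re, Complex.re_ofNat, Complex.im_ofNat, zero_mul, sub_zero] at hid'
  rw [hs]
  nlinarith

/-! ### The quotient `I₂ / I₀` -/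

/-- The quotient `I₂ / I₀`, whose values are the `τ` for which `I₂ - τ I₀` vanishes. -/
noncomputable def quot (h : ℂ) : ℂ := I 2 h / I 0 h

theorem sqrt_two_ne_zero : (Real.sqrt 2 : ℂ) ≠ 0 := by
  rw [Complex.ofReal_ne_zero]
  positivity

theorem one_add_csqrt_ne_zero (z : ℂ) : 1 + csqrt z ≠ 0 := by
  intro h
  have := congrArg Complex.re h
  have h2 := csqrt_re_nonneg z
  simp at this
  linarith

theorem quot_eq (h : ℂ) : quot h = (1 + csqrt (1 + 4 * h)) * ratio (csqrt (1 + 4 * h)) := by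
  unfold quot ratio
  rw [I_zero_eq, I_two_eq]
  have := sqrt_two_ne_zero
  have := one_add_csqrt_ne_zero (1 + 4 * h)
  field_simp

theorem quot_eq_N (h : ℂ) : quot h = N2 (csqrt (1 + 4 * h)) / N0 (csqrt (1 + 4 * h)) := by
  rw [quot_eq]
  unfold ratio N0 N2
  have := one_add_csqrt_ne_zero (1 + 4 * h)
  field_simp

theorem csqrt_one_add_im_nonneg {h : ℂ} (hh : 0 ≤ h.im) : 0 ≤ (csqrt (1 + 4 * h)).im :=
  csqrt_im_nonneg (by simpa using hh)

theorem I_zero_ne_zero {h : ℂ} (hh : 0 ≤ h.im) : I 0 h ≠ 0 := by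
  rw [I_zero_eq]
  exact mul_ne_zero (div_ne_zero (one_add_csqrt_ne_zero _) sqrt_two_ne_zero)
    (sqrtInt_wt0_ne_zero (csqrt_one_add_im_nonneg hh))

theorem I_zero_ne_zero_of_mem_D {h : ℂ} (hh : h ∈ D) : I 0 h ≠ 0 := by
  rw [I_zero_eq]
  exact mul_ne_zero (div_ne_zero (one_add_csqrt_ne_zero _) sqrt_two_ne_zero)
    (sqrtInt_wt0_ne_zero_of_cutPlane (csqrt_one_add_mem_cutPlane hh))

theorem analyticOnNhd_quot : AnalyticOnNhd ℂ quot D := fun z hz =>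
  (analyticOnNhd_I_two z hz).div (analyticOnNhd_I_zero z hz) (I_zero_ne_zero_of_mem_D hz)

theorem continuousOn_quot : ContinuousOn quot {h | 0 ≤ h.im} :=
  (continuousOn_I_upper 2).div (continuousOn_I_upper 0) fun _ hh => I_zero_ne_zero hh

theorem conj_mem_D {h : ℂ} (hh : h ∈ D) : (starRingEnd ℂ) h ∈ D := by
  have hh' : h ∈ Complex.slitPlane := hh
  change (starRingEnd ℂ) h ∈ Complex.slitPlane
  rw [Complex.mem_slitPlane_iff] at hh' ⊢
  simpa using hh'

theorem quot_conj {h : ℂ} (hh : h ∈ D) : quot ((starRingEnd ℂ) h) = (starRingEnd ℂ) (quot h) := by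
  have e : 1 + 4 * (starRingEnd ℂ) h = (starRingEnd ℂ) (1 + 4 * h) := by
    simp only [map_add, map_mul, map_one, Complex.conj_ofNat]
  rw [quot_eq, quot_eq, e, csqrt_conj (one_add_four_mul_mem_slitPlane hh),
    ratio_conj (csqrt_one_add_mem_cutPlane hh), map_mul, map_add, map_one]

theorem quot_zero : quot 0 = 4 / 5 := by
  have h1 : csqrt 1 = 1 := by simp [csqrt]
  rw [quot_eq, mul_zero, add_zero, h1, ratio_one]
  norm_num

theorem quot_neg_quarter : quot (-1 / 4) = 1 / 5 := by
  have h1 : csqrt 0 = 0 := csqrt_eq_zero.2 rfl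
  rw [quot_eq, show (1 + 4 * (-1 / 4 : ℂ)) = 0 by norm_num, h1, ratio_zero]
  norm_num

theorem csqrt_one_add_ofReal {h : ℝ} (hh : -1 / 4 ≤ h) :
    csqrt (1 + 4 * (h : ℂ)) = (√(1 + 4 * h) : ℂ) := by
  rw [← csqrt_ofReal (by linarith)]; push_cast; rfl

theorem quot_im_neg {h : ℝ} (h1 : -1 / 4 < h) (h2 : h < 0) : (quot h).im < 0 := by
  have hs0 : 0 < √(1 + 4 * h) := Real.sqrt_pos.2 (by linarith)
  have hs1 : √(1 + 4 * h) < 1 := by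
    rw [Real.sqrt_lt' one_pos]
    linarith
  have := ratio_im_neg hs0 hs1
  rw [quot_eq, csqrt_one_add_ofReal h1.le, Complex.mul_im]
  simp only [Complex.add_re, Complex.one_re, Complex.ofReal_re, Complex.add_im, Complex.one_im,
    Complex.ofReal_im, add_zero, zero_mul]
  nlinarith

theorem quot_real {h : ℝ} (hh : 0 < h) : (quot h).im = 0 ∧ 1 / 2 ≤ (quot h).re := by
  have hs1 : 1 ≤ √(1 + 4 * h) := by rw [Real.one_le_sqrt]; linarith
  obtain ⟨h1, h2⟩ := ratio_real hs1
  rw [quot_eq, csqrt_one_add_ofReal (by linarith), Complex.mul_im, Complex.mul_re]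
  simp only [Complex.add_re, Complex.one_re, Complex.ofReal_re, Complex.add_im, Complex.one_im,
    Complex.ofReal_im, add_zero, zero_mul, h1, mul_zero, sub_zero, true_and]
  nlinarith

theorem exists_quot_lt : ∃ h : ℝ, 0 < h ∧ (quot h).re < 4 / 5 := by
  -- The value of `h` at which `s = 121/100`.
  refine ⟨((121 / 100) ^ 2 - 1) / 4, by norm_num, ?_⟩
  have hlt := N2_lt_of_real
  have e : csqrt (1 + 4 * ((((121 / 100) ^ 2 - 1) / 4 : ℝ) : ℂ)) = ((121 / 100 : ℝ) : ℂ) := by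
    rw [csqrt_one_add_ofReal (by norm_num), show (1 + 4 * (((121 / 100) ^ 2 - 1) / 4) : ℝ) =
      (121 / 100) ^ 2 by norm_num, Real.sqrt_sq (by norm_num)]
  have hreal := (quot_real (h := ((121 / 100) ^ 2 - 1) / 4) (by norm_num))
  rw [quot_eq_N, e] at hreal ⊢
  have e' : ((121 / 100 : ℝ) : ℂ) = 121 / 100 := by push_cast; rfl
  rw [← e'] at hlt
  have hs : (1 : ℝ) ≤ 121 / 100 := by norm_num
  have i0 : (N0 ((121 / 100 : ℝ) : ℂ)).im = 0 := by
    unfold N0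
    rw [Complex.mul_im, sqrtInt_im_eq_zero continuous_wt0 hs]
    simp
  have r0 : 0 < (N0 ((121 / 100 : ℝ) : ℂ)).re := by
    have hnn : 0 ≤ (N0 ((121 / 100 : ℝ) : ℂ)).re := by
      unfold N0
      rw [Complex.mul_re, sqrtInt_im_eq_zero continuous_wt0 hs, mul_zero, sub_zero]
      refine mul_nonneg (by rw [Complex.add_re, Complex.ofReal_re, Complex.one_re]; norm_num) ?_
      rw [sqrtInt_ofReal_re continuous_wt0]
      exact intervalIntegral.integral_nonneg two_pi_pos.le fun t _ =>
        mul_nonneg (wt0_nonneg t) (Real.sqrt_nonneg _)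
    refine hnn.lt_of_ne fun h => ?_
    have hz : N0 ((121 / 100 : ℝ) : ℂ) = 0 := Complex.ext h.symm i0
    rw [hz, div_zero, Complex.zero_re] at hreal
    linarith [hreal.2]
  rw [Complex.div_re, i0, Complex.normSq_apply, i0]
  simp only [mul_zero, zero_div, add_zero]
  rw [div_lt_iff₀ (by positivity)]
  nlinarith

/-! ### The imaginary part on the ray `h < -1/4` -/

/-- The Wronskian of `N0`, `N2` and their conjugates along the imaginary axis. -/
noncomputable def wronskian (η : ℝ) : ℝ :=
  (N2 (η * Complex.I) * (starRingEnd ℂ) (N0 (η * Complex.I))).im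

theorem mul_I_mem_cutPlane {η : ℝ} (hη : η ≠ 0) : (η : ℂ) * Complex.I ∈ cutPlane := by
  right
  simpa using hη

/-- Along `s = iη` the Picard–Fuchs system has real coefficients, displayed in `d0` and `d2`. The
conjugate of a solution is then a solution, and the Wronskian obeys Liouville's equation with the
trace of the system as its coefficient. -/
theorem hasDerivAt_wronskian {η : ℝ} (hη : 0 < η) : HasDerivAt wronskian
    ((2 + 4 * η ^ 2) / (η * (1 + η ^ 2)) * wronskian η) η := by
  have hc := mul_I_mem_cutPlane hη.ne'
  have hlin : HasDerivAt (fun η : ℝ => (η : ℂ) * Complex.I) Complex.I η := by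
    have h1 : HasDerivAt (fun t : ℝ => (t : ℂ)) ((1 : ℝ) : ℂ) η := (hasDerivAt_id η).ofReal_comp
    simpa using h1.mul_const Complex.I
  have h0 := HasDerivAt.comp (𝕜 := ℝ) (𝕜' := ℂ) η (hasDerivAt_N0 hc) hlin
  have h2 := HasDerivAt.comp (𝕜 := ℝ) (𝕜' := ℂ) η (hasDerivAt_N2 hc) hlin
  have h0c := Complex.conjCLE.hasFDerivAt.comp_hasDerivAt η h0
  have hw := Complex.imCLM.hasFDerivAt.comp_hasDerivAt η (h2.mul h0c)
  have hη0 : (η : ℂ) ≠ 0 := Complex.ofReal_ne_zero.2 hη.ne'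
  have hη1 : (1 + (η : ℂ) ^ 2) ≠ 0 := by
    have : (1 + η ^ 2 : ℝ) ≠ 0 := by positivity
    exact_mod_cast this
  have hI : Complex.I ^ 2 = -1 := Complex.I_sq
  have d0 : ((1 + 3 * ((η : ℂ) * Complex.I) ^ 2) * N0 (η * Complex.I) - 5 * N2 (η * Complex.I)) /
      (2 * (η * Complex.I) * ((η * Complex.I) ^ 2 - 1)) * Complex.I =
      ((-(1 - 3 * η ^ 2) / (2 * η * (1 + η ^ 2)) : ℝ) : ℂ) * N0 (η * Complex.I) +
      ((5 / (2 * η * (1 + η ^ 2)) : ℝ) : ℂ) * N2 (η * Complex.I) := by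
    rw [mul_pow, hI]
    rw [show ((η : ℂ) ^ 2 * -1 - 1) = -(1 + (η : ℂ) ^ 2) by ring]
    push_cast
    field_simp
    ring
  have d2 : (5 * N2 (η * Complex.I) - N0 (η * Complex.I)) / (2 * (η * Complex.I)) * Complex.I =
      ((5 / (2 * η) : ℝ) : ℂ) * N2 (η * Complex.I) +
      ((-1 / (2 * η) : ℝ) : ℂ) * N0 (η * Complex.I) := by
    push_cast
    field_simp
    ring
  rw [d0, d2] at hw
  convert! hw using 1
  unfold wronskian
  simp only [Function.comp_apply]
  generalize N0 (η * Complex.I) = a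
  generalize N2 (η * Complex.I) = b
  simp only [Complex.imCLM_apply, ContinuousLinearEquiv.coe_coe,
    Complex.conjCLE_apply, map_add, map_mul, Complex.conj_ofReal, Complex.add_im, Complex.mul_im,
    Complex.add_re, Complex.mul_re, Complex.ofReal_re, Complex.ofReal_im, Complex.conj_re,
    Complex.conj_im]
  field_simp
  ring

theorem csqrt_re_pos {z : ℂ} (hz : z ∈ Complex.slitPlane) : 0 < (csqrt z).re := by
  refine (csqrt_re_nonneg z).lt_of_ne fun h => ?_
  obtain ⟨h1, h2, -⟩ := csqrt_parts z
  rw [← h] at h1 h2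
  rcases Complex.mem_slitPlane_iff.1 hz with h' | h'
  · nlinarith
  · exact h' (by linarith)

/-- Since `(1 + s) · ratio s` is `I₂ / I₀`, the Wronskian carries the sign of `Im (I₂ / I₀)` on `h <
-1/4`. -/
theorem wronskian_eq (η : ℝ) : wronskian η =
    ((1 + (η : ℂ) * Complex.I) * ratio (η * Complex.I)).im * Complex.normSq (N0 (η * Complex.I)) := by
  by_cases h0 : sqrtInt wt0 (η * Complex.I) = 0
  · unfold wronskian N0
    simp [h0]
  · have h1 : (1 + (η : ℂ) * Complex.I) ≠ 0 := by
      intro h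
      have := congrArg Complex.re h
      simp at this
    have e : (1 + (η : ℂ) * Complex.I) * ratio (η * Complex.I) * N0 (η * Complex.I) =
        N2 (η * Complex.I) := by
      unfold ratio N0 N2
      field_simp
    unfold wronskian
    rw [← e, mul_assoc, Complex.mul_conj, Complex.im_mul_ofReal]

/-- Liouville's equation makes the Wronskian a constant multiple of `η² (1 + η²)`, so one large `η`
decides its sign everywhere. -/
theorem wronskian_pos {η : ℝ} (hη : 0 < η) : 0 < wronskian η := by
  set g : ℝ → ℝ := fun η => wronskian η / (η ^ 2 * (1 + η ^ 2)) with hg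
  have hgd : ∀ x ∈ Ioi (0 : ℝ), HasDerivAt g 0 x := by
    intro x hx
    have hx' : (0 : ℝ) < x := hx
    have hden : HasDerivAt (fun η : ℝ => η ^ 2 * (1 + η ^ 2)) (2 * x + 4 * x ^ 3) x := by
      have := ((hasDerivAt_id x).pow 2).mul (((hasDerivAt_id x).pow 2).const_add 1)
      convert! this using 1
      simp
      ring
    have := (hasDerivAt_wronskian hx').div hden (by positivity)
    convert! this using 1
    field_simp
    ring
  have hconst : ∀ x ∈ Ioi (0 : ℝ), ∀ y ∈ Ioi (0 : ℝ), g x = g y := fun x hx y hy =>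
    (isOpen_Ioi.is_const_of_deriv_eq_zero (convex_Ioi 0).isPreconnected
      (fun z hz => (hgd z hz).differentiableAt.differentiableWithinAt)
      (fun z hz => (hgd z hz).deriv) hx hy)
  -- Here `Im ((1 + iη) ratio) = Im ratio + η Re ratio ≥ -4 + 2000 / 320 > 0`.
  have hbig : 0 < wronskian 2000 := by
    rw [wronskian_eq]
    have hn : ‖(((2000 : ℝ) : ℂ) * Complex.I)‖ = 2000 := by simp
    obtain ⟨h1, h2⟩ := ratio_bounds_quadrant (s := ((2000 : ℝ) : ℂ) * Complex.I)
      (by simp) (by simp) (by rw [hn]; norm_num)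
    refine mul_pos ?_ (Complex.normSq_pos.2 ?_)
    · rw [Complex.mul_im]
      have := (abs_le.1 ((Complex.abs_im_le_norm _).trans h2)).1
      simp only [Complex.add_re, Complex.one_re, Complex.add_im, Complex.one_im,
        Complex.re_ofReal_mul, Complex.im_ofReal_mul, Complex.I_re, Complex.I_im]
      linarith
    · refine mul_ne_zero ?_ (sqrtInt_wt0_ne_zero (by simp))
      intro h
      have := congrArg Complex.re h
      simp at this
  have h1 := hconst η hη 2000 (by norm_num : (0 : ℝ) < 2000)
  have h2 : 0 < g 2000 := by rw [hg]; positivity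
  rw [← h1, hg] at h2
  exact (div_pos_iff_of_pos_right (by positivity)).1 h2

theorem quot_im_pos {h : ℝ} (hh : h < -1 / 4) : 0 < (quot h).im := by
  have e : (1 + 4 * (h : ℂ)) = ((1 + 4 * h : ℝ) : ℂ) := by push_cast; rfl
  obtain ⟨h1, h2⟩ := csqrt_ofReal_eq (1 + 4 * h)
  rw [Real.sqrt_eq_zero_of_nonpos (by linarith)] at h1
  have hη : 0 < √(-(1 + 4 * h)) := Real.sqrt_pos.2 (by linarith)
  have es : csqrt (1 + 4 * (h : ℂ)) = (√(-(1 + 4 * h)) : ℂ) * Complex.I := by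
    rw [e]
    apply Complex.ext
    · simpa using h1
    · simpa using h2
  have hw := wronskian_pos hη
  rw [wronskian_eq, ← es, ← quot_eq] at hw
  exact pos_of_mul_pos_left hw (Complex.normSq_nonneg _)

/-! ### Behaviour at infinity -/

theorem norm_csqrt_sq (z : ℂ) : ‖csqrt z‖ ^ 2 = ‖z‖ := by rw [← norm_pow, csqrt_sq]

theorem norm_quot_ge {h : ℂ} (hh : 0 ≤ h.im) (hs : 2 ≤ ‖csqrt (1 + 4 * h)‖) :
    ‖csqrt (1 + 4 * h)‖ / 320 ≤ ‖quot h‖ := by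
  have hre := csqrt_re_nonneg (1 + 4 * h)
  have h1 := (ratio_bounds_quadrant hre (csqrt_one_add_im_nonneg hh) hs).1
  have h2 := (Complex.re_le_norm _).trans' h1
  rw [quot_eq, norm_mul]
  set s := csqrt (1 + 4 * h)
  have h3 : ‖s‖ ≤ ‖1 + s‖ := by
    refine (sq_le_sq₀ (norm_nonneg _) (norm_nonneg _)).1 ?_
    rw [← Complex.normSq_eq_norm_sq, ← Complex.normSq_eq_norm_sq, Complex.normSq_apply,
      Complex.normSq_apply]
    simp
    nlinarith
  have := mul_le_mul h3 h2 (by norm_num) (norm_nonneg _)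
  linarith

/-- In the coordinate `σ = 1/s` the reciprocal of `I₂ / I₀` extends to infinity. -/
noncomputable def recipQuot (σ : ℂ) : ℂ := N0 σ⁻¹ / N2 σ⁻¹

/-- The Riccati equation of the Picard–Fuchs system in `σ = 1 / s`, written with `κ = 1 / ratio`. In
this form the coefficients of `κ`, `κ²` and `1` tend to `1`, `0` and `0` as `σ → 0`, so the
derivative is close to `κ`. -/
theorem hasDerivAt_recipQuot {σ : ℂ} (h0 : σ ≠ 0) (hc : σ⁻¹ ∈ cutPlane) (hr : ratio σ⁻¹ ≠ 0) :
    HasDerivAt recipQuot ((ratio σ⁻¹)⁻¹ * ((1 - 3 * σ ^ 2) / ((1 - σ ^ 2) * (1 + σ))) -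
      (ratio σ⁻¹)⁻¹ ^ 2 * (σ / (2 * (1 + σ) ^ 2)) + 5 * σ / (2 * (1 - σ ^ 2))) σ := by
  obtain ⟨hs0, hs1, hs2⟩ := cutPlane_ne hc
  have hA := sqrtInt_wt0_ne_zero_of_cutPlane hc
  have hB : sqrtInt wt2 σ⁻¹ ≠ 0 := fun h => hr (by unfold ratio; rw [h, zero_div])
  have hinv := hasDerivAt_inv h0
  have d0 := (hasDerivAt_N0 hc).comp σ hinv
  have d2 := (hasDerivAt_N2 hc).comp σ hinv
  have hσ1 : 1 + σ ≠ 0 := by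
    intro h
    apply hs2
    rw [eq_neg_of_add_eq_zero_right h]
    norm_num
  have hσ2 : 1 - σ ≠ 0 := by
    intro h
    apply hs1
    rw [← sub_eq_zero.1 h]
    norm_num
  have hσ3 : 1 - σ ^ 2 ≠ 0 := by
    rw [show 1 - σ ^ 2 = (1 - σ) * (1 + σ) by ring]
    exact mul_ne_zero hσ2 hσ1
  have hN2 : N2 σ⁻¹ ≠ 0 := by
    unfold N2
    refine mul_ne_zero (pow_ne_zero _ fun h => hs2 (eq_neg_of_add_eq_zero_right h)) hB
  have hd := d0.div d2 hN2
  convert! hd using 1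
  simp only [Function.comp_apply]
  have e0 : N0 σ⁻¹ = (1 + σ) / σ * sqrtInt wt0 σ⁻¹ := by
    unfold N0; field_simp; ring
  have e2 : N2 σ⁻¹ = ((1 + σ) / σ) ^ 2 * sqrtInt wt2 σ⁻¹ := by
    unfold N2; field_simp; ring
  have e3 : (σ⁻¹ ^ 2 - 1) = (1 - σ ^ 2) / σ ^ 2 := by field_simp
  rw [e0, e2, e3]
  unfold ratio
  generalize sqrtInt wt0 σ⁻¹ = A at hA ⊢
  generalize sqrtInt wt2 σ⁻¹ = B at hB ⊢
  field_simp
  ring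

/-- The bounds on `ratio` give `‖κ‖ ≤ 320` and `Re κ = Re ratio / ‖ratio‖² ≥ (1 / 320) / 16 = 1 /
5120`, which outweighs the error terms for small `σ`. Positivity on a convex half-disc is what
`injOn_of_re_deriv_pos` needs. -/
theorem exists_re_deriv_recipQuot_pos : ∃ r : ℝ, 0 < r ∧ r ≤ 1 / 2 ∧ ∀ σ : ℂ, 0 < σ.re → ‖σ‖ < r →
    ∃ d : ℂ, HasDerivAt recipQuot d σ ∧ 0 < d.re := by
  -- Any `δ > 0` with `(320 + 320² + 1) δ < 1 / 5120` would do.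
  set δ : ℝ := 1 / 10 ^ 10 with hδ
  have c1 : ContinuousAt (fun σ : ℂ => (1 - 3 * σ ^ 2) / ((1 - σ ^ 2) * (1 + σ))) 0 := by
    refine ContinuousAt.div (by fun_prop) (by fun_prop) (by simp)
  have c2 : ContinuousAt (fun σ : ℂ => σ / (2 * (1 + σ) ^ 2)) 0 := by
    refine ContinuousAt.div (by fun_prop) (by fun_prop) (by simp)
  have c3 : ContinuousAt (fun σ : ℂ => 5 * σ / (2 * (1 - σ ^ 2))) 0 := by
    refine ContinuousAt.div (by fun_prop) (by fun_prop) (by simp)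
  have hδ0 : 0 < δ := by rw [hδ]; positivity
  have h1 := Metric.continuousAt_iff.1 c1 δ hδ0
  have h2 := Metric.continuousAt_iff.1 c2 δ hδ0
  have h3 := Metric.continuousAt_iff.1 c3 δ hδ0
  obtain ⟨r1, hr1, h1⟩ := h1
  obtain ⟨r2, hr2, h2⟩ := h2
  obtain ⟨r3, hr3, h3⟩ := h3
  refine ⟨min (1 / 2) (min r1 (min r2 r3)), by positivity, min_le_left _ _, fun σ hσ hn => ?_⟩
  simp only [lt_min_iff] at hn
  obtain ⟨hn0, hn1, hn2, hn3⟩ := hn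
  have hσ0 : σ ≠ 0 := by
    rintro rfl
    simp at hσ
  have hre : 0 < (σ⁻¹).re := by
    rw [Complex.inv_re]
    exact div_pos hσ (Complex.normSq_pos.2 hσ0)
  have hnorm : 2 ≤ ‖σ⁻¹‖ := by
    rw [norm_inv, le_inv_comm₀ (by norm_num) (norm_pos_iff.2 hσ0)]
    linarith
  obtain ⟨hc, hq1, hq2⟩ := ratio_bounds hre hnorm
  have hq0 : ratio σ⁻¹ ≠ 0 := fun h => by
    rw [h, Complex.zero_re] at hq1
    norm_num at hq1
  have hqn : 1 / 320 ≤ ‖ratio σ⁻¹‖ := hq1.trans (Complex.re_le_norm _)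
  have hκ : ‖(ratio σ⁻¹)⁻¹‖ ≤ 320 := by
    rw [norm_inv, inv_le_comm₀ (by linarith) (by norm_num)]
    linarith
  have hκre : 1 / 5120 ≤ ((ratio σ⁻¹)⁻¹).re := by
    rw [Complex.inv_re, le_div_iff₀ (Complex.normSq_pos.2 hq0), Complex.normSq_eq_norm_sq]
    nlinarith
  refine ⟨_, hasDerivAt_recipQuot hσ0 hc hq0, ?_⟩
  have g1 := h1 (by simpa using hn1)
  have g2 := h2 (by simpa using hn2)
  have g3 := h3 (by simpa using hn3)
  rw [dist_eq_norm] at g1 g2 g3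
  simp only [zero_pow two_ne_zero, mul_zero, sub_zero, add_zero, mul_one, div_one,
    zero_div] at g1 g2 g3
  generalize (1 - 3 * σ ^ 2) / ((1 - σ ^ 2) * (1 + σ)) = e1 at g1 ⊢
  generalize σ / (2 * (1 + σ) ^ 2) = e2 at g2 ⊢
  generalize 5 * σ / (2 * (1 - σ ^ 2)) = e3 at g3 ⊢
  generalize (ratio σ⁻¹)⁻¹ = κ at hκ hκre ⊢
  have hdec : κ * e1 - κ ^ 2 * e2 + e3 = κ + (κ * (e1 - 1) - κ ^ 2 * e2 + e3) := by ring
  have herr : ‖κ * (e1 - 1) - κ ^ 2 * e2 + e3‖ ≤ 320 * δ + 320 ^ 2 * δ + δ := by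
    refine (norm_add_le _ _).trans (add_le_add ((norm_sub_le _ _).trans (add_le_add ?_ ?_)) g3.le)
    · rw [norm_mul]
      exact mul_le_mul hκ g1.le (norm_nonneg _) (by norm_num)
    · rw [norm_mul, norm_pow]
      exact mul_le_mul (pow_le_pow_left₀ (norm_nonneg _) hκ 2) g2.le (norm_nonneg _) (by norm_num)
  rw [hdec, Complex.add_re]
  have := (abs_le.1 ((Complex.abs_re_le_norm _).trans herr)).1
  have hsmall : 320 * δ + 320 ^ 2 * δ + δ < 1 / 5120 := by rw [hδ]; norm_num
  have hlow := (neg_lt_neg hsmall).trans_le this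
  have := add_lt_add_of_le_of_lt hκre hlow
  rwa [add_neg_cancel] at this

theorem quot_inv_eq (h : ℂ) : (quot h)⁻¹ = recipQuot (csqrt (1 + 4 * h))⁻¹ := by
  unfold recipQuot
  rw [quot_eq_N, inv_div, inv_inv]

/-- Near infinity `I₂ / I₀` is locally invertible and injective on `𝓓`. -/
theorem exists_injOn_quot : ∃ R : ℝ, 0 < R ∧ InjOn quot (D ∩ {h | R < ‖h‖}) ∧
    ∀ h ∈ D, R < ‖h‖ → deriv quot h ≠ 0 := by
  obtain ⟨r, hr0, hr1, hr⟩ := exists_re_deriv_recipQuot_pos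
  have hmem : ∀ h ∈ D, (1 / r) ^ 2 < ‖h‖ → 0 < ((csqrt (1 + 4 * h))⁻¹).re ∧
      ‖(csqrt (1 + 4 * h))⁻¹‖ < r := by
    intro h hh hn
    have hre := csqrt_re_pos (one_add_four_mul_mem_slitPlane hh)
    have h0 := (cutPlane_ne (csqrt_one_add_mem_cutPlane hh)).1
    refine ⟨?_, ?_⟩
    · rw [Complex.inv_re]
      exact div_pos hre (Complex.normSq_pos.2 h0)
    · rw [norm_inv, inv_lt_comm₀ (norm_pos_iff.2 h0) hr0, ← one_div]
      refine (sq_lt_sq₀ (by positivity) (norm_nonneg _)).1 ?_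
      rw [norm_csqrt_sq]
      have h1 : ‖4 * h‖ ≤ ‖1 + 4 * h‖ + ‖(1 : ℂ)‖ := by
        have := norm_sub_le (1 + 4 * h) 1
        simpa using this
      rw [norm_mul, norm_one, Complex.norm_ofNat] at h1
      have : 1 ≤ (1 / r) ^ 2 := one_le_pow₀ (by rw [le_div_iff₀ hr0]; linarith)
      linarith
  have hconv : Convex ℝ ({σ : ℂ | 0 < σ.re} ∩ Metric.ball 0 r) :=
    (convex_halfSpace_re_gt 0).inter (convex_ball 0 r)
  choose! d hd hdpos using hr
  have hinj : InjOn recipQuot ({σ : ℂ | 0 < σ.re} ∩ Metric.ball 0 r) :=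
    injOn_of_re_deriv_pos hconv (fun z hz => hd z hz.1 (by simpa using hz.2))
      fun z hz => hdpos z hz.1 (by simpa using hz.2)
  -- For `‖h‖ > (1 / r)²` one has `‖s‖² ≥ 4 ‖h‖ - 1 > (1 / r)²`, so `σ = 1 / s` lies in the
  -- half-disc of radius `r`; and `σ` determines `h`.
  refine ⟨(1 / r) ^ 2, by positivity, ?_, ?_⟩
  · rintro a ⟨ha, ha'⟩ b ⟨hb, hb'⟩ hab
    have h1 := hmem a ha ha'
    have h2 := hmem b hb hb'
    have e : recipQuot (csqrt (1 + 4 * a))⁻¹ = recipQuot (csqrt (1 + 4 * b))⁻¹ := by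
      rw [← quot_inv_eq, ← quot_inv_eq, hab]
    have := inv_injective (hinj ⟨h1.1, by simpa using h1.2⟩ ⟨h2.1, by simpa using h2.2⟩ e)
    have h3 := congrArg (fun z => z ^ 2) this
    simp only [csqrt_sq] at h3
    linear_combination h3 / 4
  · intro h hh hn hd0
    obtain ⟨h1, h2⟩ := hmem h hh hn
    have h0 := (cutPlane_ne (csqrt_one_add_mem_cutPlane hh)).1
    have hs := (hasDerivAt_csqrt_one_add hh).inv h0
    have hcomp := (hd _ h1 h2).comp h hs
    have hq0 : quot h ≠ 0 := by
      intro hq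
      have hre := csqrt_re_pos (one_add_four_mul_mem_slitPlane hh)
      have hb := (ratio_bounds (s := csqrt (1 + 4 * h)) hre (by
        rw [norm_inv] at h2
        have := (inv_lt_comm₀ (norm_pos_iff.2 h0) hr0).1 h2
        have : 2 ≤ r⁻¹ := by rw [le_inv_comm₀ (by norm_num) hr0]; linarith
        linarith)).2.1
      rw [quot_eq] at hq
      rcases mul_eq_zero.1 hq with h' | h'
      · exact one_add_csqrt_ne_zero _ h'
      · rw [h', Complex.zero_re] at hb
        norm_num at hb
    have hquot := ((analyticOnNhd_quot h hh).differentiableAt.hasDerivAt).inv hq0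
    -- By the chain rule a critical point of `quot` would be one of `recipQuot`, because `h ↦ 1 / s`
    -- has nonzero derivative.
    have heq : (recipQuot ∘ fun h => (csqrt (1 + 4 * h))⁻¹) = quot⁻¹ := by
      funext z
      simp only [Function.comp_apply, Pi.inv_apply]
      exact (quot_inv_eq z).symm
    have huniq := hcomp.unique (heq ▸ hquot)
    rw [hd0, neg_zero, zero_div] at huniq
    have hdne : d (csqrt (1 + 4 * h))⁻¹ ≠ 0 := fun h' => by
      have := hdpos _ h1 h2
      rw [h', Complex.zero_re] at this
      exact lt_irrefl _ this
    have h20 : (2 : ℂ) / csqrt (1 + 4 * h) ≠ 0 := div_ne_zero two_ne_zero h0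
    exact mul_ne_zero hdne (div_ne_zero (neg_ne_zero.2 h20) (pow_ne_zero 2 h0)) huniq

/-! ### Location of the solutions of `I₂ / I₀ = τ` -/

/-- Properness of `quot` on the closed upper half-plane: `‖quot‖ ≥ ‖s‖ / 320` for `‖s‖ ≥ 2`, and
`‖s‖² ≥ 4 ‖z‖ - 1`. -/
theorem exists_norm_quot_gt (B : ℝ) : ∃ R : ℝ, 0 < R ∧ ∀ z : ℂ, 0 ≤ z.im → R < ‖z‖ → B < ‖quot z‖ := by
  refine ⟨4 + (320 * (|B| + 1)) ^ 2, by positivity, fun z hz hR => ?_⟩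
  have h1 : ‖4 * z‖ ≤ ‖1 + 4 * z‖ + ‖(1 : ℂ)‖ := by
    have := norm_sub_le (1 + 4 * z) 1
    simpa using this
  rw [norm_mul, norm_one, Complex.norm_ofNat] at h1
  rw [← norm_csqrt_sq (1 + 4 * z)] at h1
  have h2 : 2 ≤ ‖csqrt (1 + 4 * z)‖ := by
    nlinarith [norm_nonneg (csqrt (1 + 4 * z)), sq_nonneg (320 * (|B| + 1))]
  have h3 := norm_quot_ge hz h2
  have h4 : 320 * (|B| + 1) < ‖csqrt (1 + 4 * z)‖ :=
    lt_of_pow_lt_pow_left₀ 2 (norm_nonneg _) (by nlinarith [sq_nonneg (320 * (|B| + 1))])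
  have := le_abs_self B
  linarith

/-- The closed upper half-plane. -/
def upperClosed : Set ℂ := {z | 0 ≤ z.im}

/-- The open upper half-plane. -/
def upperOpen : Set ℂ := {z | 0 < z.im}

theorem isClosed_upperClosed : IsClosed upperClosed :=
  isClosed_le continuous_const Complex.continuous_im

theorem isOpen_upperOpen : IsOpen upperOpen := isOpen_lt continuous_const Complex.continuous_im

theorem isOpen_D : IsOpen D := Complex.isOpen_slitPlane

theorem upperOpen_subset_D : upperOpen ⊆ D := fun _ hz => Or.inr (ne_of_gt hz)

theorem isCompact_upperClosed_inter (R : ℝ) : IsCompact (upperClosed ∩ Metric.closedBall 0 R) :=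
  (isCompact_closedBall 0 R).inter_left isClosed_upperClosed

/-- For `τ` near `τ₀` the solutions in the closed upper half-plane are near those for `τ₀`. -/
theorem eventually_solutions_mem {τ₀ : ℂ} {W : Set ℂ} (hW : IsOpen W)
    (h : ∀ z ∈ upperClosed, quot z = τ₀ → z ∈ W) :
    ∀ᶠ τ in 𝓝 τ₀, ∀ z ∈ upperClosed, quot z = τ → z ∈ W := by
  obtain ⟨R, -, hR⟩ := exists_norm_quot_gt (‖τ₀‖ + 1)
  -- Properness confines the solutions at levels near `τ₀` to one ball. The part of it outside `W`
  -- is compact, so its image is closed, and it misses `τ₀`.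
  have hK : IsCompact ((upperClosed ∩ Metric.closedBall 0 R) \ W) :=
    (isCompact_upperClosed_inter R).diff hW
  have himg := (hK.image_of_continuousOn (continuousOn_quot.mono
    fun z hz => hz.1.1)).isClosed
  have hnot : τ₀ ∉ quot '' ((upperClosed ∩ Metric.closedBall 0 R) \ W) := by
    rintro ⟨z, hz, rfl⟩
    exact hz.2 (h z hz.1.1 rfl)
  have hn : ∀ᶠ τ in 𝓝 τ₀, ‖τ‖ < ‖τ₀‖ + 1 :=
    continuous_norm.continuousAt.eventually_lt_const (by linarith)
  filter_upwards [himg.isOpen_compl.mem_nhds hnot, hn] with τ h1 h2 z hz hzτ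
  by_contra hzW
  refine h1 ⟨z, ⟨⟨hz, ?_⟩, hzW⟩, hzτ⟩
  rw [mem_closedBall_zero_iff]
  by_contra hlt
  have := hR z hz (not_le.1 hlt)
  rw [hzτ] at this
  linarith

theorem mem_upperClosed_or_conj (z : ℂ) : z ∈ upperClosed ∨ (starRingEnd ℂ) z ∈ upperClosed := by
  rcases le_total 0 z.im with h | h
  · exact Or.inl h
  · right
    change 0 ≤ ((starRingEnd ℂ) z).im
    simpa using h

theorem quot_conj_eq {z : ℂ} (hz : z ∈ D) {τ : ℝ} (h : quot z = τ) :
    quot ((starRingEnd ℂ) z) = τ := by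
  rw [quot_conj hz, h, Complex.conj_ofReal]

/-- For real `τ` near `τ₀` the solutions in `𝓓` are near those for `τ₀`. -/
theorem eventually_solutions_mem_D {τ₀ : ℝ} {W : Set ℂ} (hW : IsOpen W)
    (h : ∀ z ∈ upperClosed, quot z = τ₀ → z ∈ W ∧ (starRingEnd ℂ) z ∈ W) :
    ∀ᶠ τ : ℝ in 𝓝 τ₀, ∀ z ∈ D, quot z = τ → z ∈ W := by
  have hW' : IsOpen (W ∩ (starRingEnd ℂ) ⁻¹' W) := hW.inter (hW.preimage Complex.continuous_conj)
  have := (Complex.continuous_ofReal.continuousAt (x := τ₀)).eventually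
    (eventually_solutions_mem hW' h)
  filter_upwards [this] with τ hτ z hz hzτ
  rcases mem_upperClosed_or_conj z with h1 | h1
  · exact (hτ z h1 hzτ).1
  · have := (hτ _ h1 (quot_conj_eq hz hzτ)).2
    simpa using this

/-! ### Finiteness of the solution sets and local constancy of their counts. -/

theorem isPreconnected_D : IsPreconnected D :=
  (Complex.starConvex_one_slitPlane.isPathConnected Complex.one_mem_slitPlane).isConnected.isPreconnected

theorem ofReal_mem_D {x : ℝ} (hx : 0 < x) : (x : ℂ) ∈ D := Or.inl (by simpa using hx)

theorem exists_quot_ne (τ : ℂ) : ∃ z ∈ D, quot z ≠ τ := by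
  obtain ⟨R, hR, hinj, -⟩ := exists_injOn_quot
  have hm : ∀ c : ℝ, 0 < c → ((R + c : ℝ) : ℂ) ∈ D ∩ {h | R < ‖h‖} := fun c hc =>
    ⟨ofReal_mem_D (by linarith), by
      rw [mem_ofPred_eq, Complex.norm_real, Real.norm_eq_abs, abs_of_pos (by linarith)]
      linarith⟩
  by_contra! hcon
  have := hinj (hm 1 one_pos) (hm 2 two_pos)
    ((hcon _ (hm 1 one_pos).1).trans (hcon _ (hm 2 two_pos).1).symm)
  rw [Complex.ofReal_inj] at this
  linarith

theorem analyticOnNhd_quot_sub (τ : ℂ) : AnalyticOnNhd ℂ (fun z => quot z - τ) D := fun z hz =>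
  (analyticOnNhd_quot z hz).sub analyticAt_const

theorem order_quot_ne_top (τ : ℂ) {z : ℂ} (hz : z ∈ D) :
    analyticOrderAt (fun w => quot w - τ) z ≠ ⊤ := by
  obtain ⟨x, hx, hxτ⟩ := exists_quot_ne τ
  refine (analyticOnNhd_quot_sub τ).analyticOrderAt_ne_top_of_isPreconnected isPreconnected_D hx hz ?_
  rw [((analyticOnNhd_quot_sub τ) x hx).analyticOrderAt_eq_zero.2 (sub_ne_zero.2 hxτ)]
  simp

/-- Infinitely many solutions would accumulate by properness. The accumulation point is a solution
by continuity up to the boundary, hence lies in 𝓓, where zeros of a nonconstant analytic function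
are isolated. -/
theorem finite_solutions {τ : ℂ} (h : ∀ z ∈ upperClosed, quot z = τ → z ∈ D) :
    {z ∈ upperClosed | quot z = τ}.Finite := by
  obtain ⟨R, -, hR⟩ := exists_norm_quot_gt ‖τ‖
  by_contra hinf
  obtain ⟨z, hzK, hacc⟩ := Set.Infinite.exists_accPt_of_subset_isCompact hinf
    (isCompact_upperClosed_inter R) (fun z hz => ⟨hz.1, by
      rw [mem_closedBall_zero_iff]
      by_contra hlt
      have := hR z hz.1 (not_le.1 hlt)
      rw [hz.2] at this
      exact lt_irrefl _ this⟩)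
  have hfreq := accPt_iff_frequently_nhdsNE.1 hacc
  have hzτ : quot z = τ := by
    have hc : ContinuousWithinAt quot upperClosed z := continuousOn_quot z hzK.1
    by_contra hne
    have hev : ∀ᶠ w in 𝓝[upperClosed] z, quot w ≠ τ := hc.eventually_ne hne
    rw [eventually_nhdsWithin_iff] at hev
    obtain ⟨w, hw1, hw2⟩ := (hfreq.and_eventually
      (hev.filter_mono nhdsWithin_le_nhds)).exists
    exact hw2 hw1.1 hw1.2
  have hzD := h z hzK.1 hzτ
  rcases ((analyticOnNhd_quot_sub τ) z hzD).eventually_eq_zero_or_eventually_ne_zero with h0 | h0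
  · exact order_quot_ne_top τ hzD (analyticOrderAt_eq_top.2 h0)
  · obtain ⟨w, hw1, hw2⟩ := (hfreq.and_eventually h0).exists
    exact hw2 (sub_eq_zero.2 hw1.2)

/-- The number of solutions of `I₂ / I₀ = τ` in `U`, with multiplicities. -/
noncomputable def solCount (U : Set ℂ) (τ : ℂ) : ℕ∞ := zeroCount (fun z => quot z - τ) U

/-- Solutions at `τ₀` persist with their multiplicities, and `eventually_solutions_mem` keeps others
from entering through the real line or from infinity. -/
theorem eventually_solCount_upper {τ₀ : ℂ} (h : ∀ z ∈ upperClosed, quot z = τ₀ → z ∈ upperOpen) :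
    ∀ᶠ τ in 𝓝 τ₀, solCount upperOpen τ = solCount upperOpen τ₀ := by
  have hfin := finite_solutions fun z hz hzτ => upperOpen_subset_D (h z hz hzτ)
  have hmem : ∀ z ∈ hfin.toFinset, z ∈ upperOpen ∧ quot z = τ₀ := fun z hz => by
    have := hfin.mem_toFinset.1 hz
    exact ⟨h z this.1 this.2, this.2⟩
  obtain ⟨W, hWU, hWn, hW⟩ := exists_hasCount_of_finset (f := quot) (τ₀ := τ₀)
    (S := hfin.toFinset) (U := upperOpen)
    (fun z hz => analyticOnNhd_quot z (upperOpen_subset_D (hmem z hz).1))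
    (fun z hz => (hmem z hz).2)
    (fun z hz => order_quot_ne_top _ (upperOpen_subset_D (hmem z hz).1))
    (fun z hz => isOpen_upperOpen.mem_nhds (hmem z hz).1)
  have hloc := eventually_solutions_mem (τ₀ := τ₀) (W := interior W) isOpen_interior
    fun z hz hzτ => mem_interior_iff_mem_nhds.2 (hWn z (hfin.mem_toFinset.2 ⟨hz, hzτ⟩))
  have hall : ∀ᶠ τ in 𝓝 τ₀, solCount upperOpen τ =
      ∑ z ∈ hfin.toFinset, analyticOrderAt (fun w => quot w - τ₀) z := by
    filter_upwards [hW, hloc] with τ h1 h2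
    exact (h1.of_subset hWU fun z hz h0 =>
      interior_subset (h2 z (show z ∈ upperClosed from le_of_lt (show 0 < z.im from hz)) (sub_eq_zero.1 h0))).zeroCount_eq
  have h0 := hall.self_of_nhds
  filter_upwards [hall] with τ hτ
  rw [hτ, h0]

/-- Finitely many solutions in a part `U` of `𝓓` containing them in its interior: their number is
locally constant in the real level. -/
theorem eventually_hasCount_D {τ₀ : ℝ} {S : Finset ℂ} {U V : Set ℂ} (hUD : U ⊆ D)
    (hS : ∀ z ∈ S, U ∈ 𝓝 z ∧ quot z = τ₀) (hV : IsOpen V) (hVU : Disjoint V U)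
    (h : ∀ z ∈ upperClosed, quot z = τ₀ → (z ∈ S ∧ (starRingEnd ℂ) z ∈ S) ∨
      (z ∈ V ∧ (starRingEnd ℂ) z ∈ V)) :
    ∃ W ⊆ U, (∀ᶠ τ : ℝ in 𝓝 τ₀, HasCount (fun z => quot z - (τ : ℂ)) U
      (∑ z ∈ S, analyticOrderAt (fun w => quot w - (τ₀ : ℂ)) z)) ∧
      ∀ᶠ τ : ℝ in 𝓝 τ₀, ∀ z ∈ D, quot z = τ → z ∈ W ∪ V := by
  have hSD : ∀ z ∈ S, z ∈ D := fun z hz => hUD (mem_of_mem_nhds (hS z hz).1)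
  obtain ⟨W, hWU, hWn, hW⟩ := exists_hasCount_of_finset (f := quot) (τ₀ := (τ₀ : ℂ))
    (S := S) (U := U) (fun z hz => analyticOnNhd_quot z (hSD z hz))
    (fun z hz => (hS z hz).2) (fun z hz => order_quot_ne_top _ (hSD z hz))
    (fun z hz => (hS z hz).1)
  have hWi : ∀ z ∈ S, z ∈ interior W := fun z hz => mem_interior_iff_mem_nhds.2 (hWn z hz)
  have hloc := eventually_solutions_mem_D (τ₀ := τ₀) (W := interior W ∪ V)
    (isOpen_interior.union hV) fun z hz hzτ => by
      rcases h z hz hzτ with h' | h'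
      · exact ⟨Or.inl (hWi _ h'.1), Or.inl (hWi _ h'.2)⟩
      · exact ⟨Or.inr h'.1, Or.inr h'.2⟩
  have hW' := (Complex.continuous_ofReal.continuousAt (x := τ₀)).eventually hW
  refine ⟨W, hWU, ?_, ?_⟩
  · filter_upwards [hW', hloc] with τ h1 h2
    refine h1.of_subset hWU fun z hz h0 => ?_
    rcases h2 z (hUD hz) (sub_eq_zero.1 h0) with h3 | h3
    · exact interior_subset h3
    · exact absurd hz (Set.disjoint_left.1 hVU h3)
  · filter_upwards [hloc] with τ h2 z hz hzτ
    exact (h2 z hz hzτ).imp (fun h => interior_subset h) id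

/-- For real levels the solutions in 𝓓 are those in the upper half-plane, their reflections and
those on `h > 0`. It is therefore enough that no limit value from above on the cut equals the level.
-/
theorem eventually_solCount_D {τ₀ : ℝ} (h : ∀ z ∈ upperClosed, quot z = τ₀ → z ∈ D) :
    ∀ᶠ τ : ℝ in 𝓝 τ₀, solCount D τ = solCount D τ₀ := by
  classical
  have hfin := finite_solutions h
  set S := hfin.toFinset ∪ hfin.toFinset.image (starRingEnd ℂ) with hS
  have hmem : ∀ z ∈ S, z ∈ D ∧ quot z = τ₀ := by
    intro z hz
    rcases Finset.mem_union.1 hz with hz | hz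
    · have := hfin.mem_toFinset.1 hz
      exact ⟨h z this.1 this.2, this.2⟩
    · obtain ⟨w, hw, rfl⟩ := Finset.mem_image.1 hz
      have := hfin.mem_toFinset.1 hw
      exact ⟨conj_mem_D (h w this.1 this.2), quot_conj_eq (h w this.1 this.2) this.2⟩
  obtain ⟨-, -, hall, -⟩ := eventually_hasCount_D (τ₀ := τ₀) (S := S) (U := D) (V := ∅) Subset.rfl
    (fun z hz => ⟨isOpen_D.mem_nhds (hmem z hz).1, (hmem z hz).2⟩) isOpen_empty
    (Set.empty_disjoint _) fun z hz hzτ => Or.inl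
      ⟨Finset.mem_union_left _ (hfin.mem_toFinset.2 ⟨hz, hzτ⟩),
        Finset.mem_union_right _ (Finset.mem_image_of_mem _ (hfin.mem_toFinset.2 ⟨hz, hzτ⟩))⟩
  have h0 := hall.self_of_nhds.zeroCount_eq
  filter_upwards [hall] with τ hτ
  unfold solCount
  rw [hτ.zeroCount_eq, h0]

theorem eq_of_preconnected {f : ℝ → ℕ∞} {s : Set ℝ} (hs : IsPreconnected s)
    (h : ∀ x ∈ s, ∀ᶠ y in 𝓝 x, f y = f x) {x y : ℝ} (hx : x ∈ s) (hy : y ∈ s) : f x = f y := by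
  have := isPreconnected_iff_preconnectedSpace.1 hs
  have hl : IsLocallyConstant fun z : s => f z := (IsLocallyConstant.iff_eventually_eq _).2
    fun z => continuous_subtype_val.continuousAt.eventually (h z z.2)
  exact hl.apply_eq_of_preconnectedSpace ⟨x, hx⟩ ⟨y, hy⟩

/-- On the boundary of `𝓓` the quotient is real only at `-1/4` and at `0`. -/
theorem mem_D_of_quot_eq {z : ℂ} {τ : ℝ} (h : quot z = τ) :
    z ∈ D ∨ (z = -1 / 4 ∧ τ = 1 / 5) ∨ (z = 0 ∧ τ = 4 / 5) := by
  by_cases hD : z ∈ D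
  · exact Or.inl hD
  right
  have hD' : ¬ z ∈ Complex.slitPlane := hD
  rw [Complex.mem_slitPlane_iff] at hD'
  push Not at hD'
  obtain ⟨hre, him⟩ := hD'
  have hzr : z = (z.re : ℂ) := Complex.ext (by simp) (by simpa using him)
  have hi : (quot z).im = 0 := by rw [h, Complex.ofReal_im]
  rw [hzr] at hi
  rcases lt_trichotomy z.re (-1 / 4) with h1 | h1 | h1
  · exact absurd hi (quot_im_pos h1).ne'
  · left
    have e : z = -1 / 4 := by rw [hzr, h1]; push_cast; rfl
    refine ⟨e, ?_⟩
    rw [e, quot_neg_quarter] at h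
    have := congrArg Complex.re h
    rw [Complex.ofReal_re] at this
    rw [← this]
    norm_num
  · rcases hre.lt_or_eq with h2 | h2
    · exact absurd hi (quot_im_neg h1 h2).ne
    · right
      have e : z = 0 := by rw [hzr, h2]; push_cast; rfl
      refine ⟨e, ?_⟩
      rw [e, quot_zero] at h
      have := congrArg Complex.re h
      norm_num at this
      linarith

theorem mem_D_of_quot_eq_of_ne {τ : ℝ} (h1 : τ ≠ 1 / 5) (h2 : τ ≠ 4 / 5) :
    ∀ z ∈ upperClosed, quot z = τ → z ∈ D := fun z hz h => by
  rcases mem_D_of_quot_eq h with h | h | h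
  · exact h
  · exact absurd h.2 h1
  · exact absurd h.2 h2

/-- The first-quadrant argument of `sqrtInt_wt0_ne_zero`, for `wt2`. One test point suffices because
the radicand has no zero for `s` in the cut plane. -/
theorem quot_ne_zero {z : ℂ} (hz : z ∈ upperClosed) (hzD : z ∈ D) : quot z ≠ 0 := by
  have hs := csqrt_one_add_im_nonneg hz
  have hc := csqrt_one_add_mem_cutPlane hzD
  rw [quot_eq]
  refine mul_ne_zero (one_add_csqrt_ne_zero _) (div_ne_zero ?_ (sqrtInt_wt0_ne_zero hs))
  set s := csqrt (1 + 4 * z)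
  intro h
  have hre := sqrtInt_re continuous_wt2 hs
  have him := sqrtInt_im continuous_wt2 hs
  rw [h] at hre him
  have hcr : Continuous fun t => wt2 t * (csqrt (radicand s t)).re :=
    continuous_wt2.mul (continuous_re_csqrt hs)
  have hci : Continuous fun t => wt2 t * (csqrt (radicand s t)).im :=
    continuous_wt2.mul (continuous_im_csqrt hs)
  have hadd : ∫ t in (0 : ℝ)..(2 * Real.pi),
      (wt2 t * (csqrt (radicand s t)).re + wt2 t * (csqrt (radicand s t)).im) = 0 := by
    rw [intervalIntegral.integral_add (hcr.intervalIntegrable _ _) (hci.intervalIntegrable _ _),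
      ← hre, ← him]
    simp
  have hpi := Real.pi_pos
  have := integral_pos_of_continuous (hcr.add hci)
    (fun t => add_nonneg (mul_nonneg (wt2_nonneg t) (csqrt_re_nonneg _))
      (mul_nonneg (wt2_nonneg t) (im_csqrt_radicand_nonneg hs t)))
    (t₀ := Real.pi / 4) ⟨by positivity, by linarith⟩ (by
      simp only [Pi.add_apply]
      rw [← mul_add]
      refine mul_pos ?_ (csqrt_re_add_im_pos (by rw [radicand_im]; positivity)
        (Complex.slitPlane_ne_zero (radicand_mem_slitPlane hc _)))
      simp only [wt2, Real.cos_pi_div_four, Real.sin_pi_div_four]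
      positivity)
  simp only [Pi.add_apply] at this
  exact this.ne' hadd

/-- The count is constant below `1/5`, and at level `0` the equation says `I₂ = 0`. -/
theorem solCount_of_lt {τ : ℝ} (hτ : τ < 1 / 5) : solCount D τ = 0 := by
  have h := eq_of_preconnected (f := fun τ => solCount D τ) (s := Iio (1 / 5)) isPreconnected_Iio
    (fun x hx => eventually_solCount_D (mem_D_of_quot_eq_of_ne (ne_of_lt hx)
      (ne_of_lt (lt_trans hx (by norm_num))))) (x := τ) (y := 0) hτ (by norm_num)
  refine h.trans (zeroCount_eq_zero fun z hz => ?_)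
  rw [Complex.ofReal_zero, sub_zero]
  rcases mem_upperClosed_or_conj z with h1 | h1
  · exact quot_ne_zero h1 hz
  · have := quot_ne_zero h1 (conj_mem_D hz)
    rw [quot_conj hz] at this
    exact fun h => this (by rw [h, map_zero])

theorem frequently_nhds_of_lt {p : ℂ → Prop} {a : ℝ} (h : ∀ x : ℝ, x < a → p x) :
    ∃ᶠ τ in 𝓝 (a : ℂ), p τ := by
  have h1 : ∃ᶠ x : ℝ in 𝓝[<] a, p (x : ℂ) :=
    (eventually_nhdsWithin_of_forall (s := Iio a) fun x hx => h x hx).frequently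
  have ht : Tendsto (fun x : ℝ => (x : ℂ)) (𝓝[<] a) (𝓝 (a : ℂ)) :=
    (Complex.continuous_ofReal.tendsto a).mono_left nhdsWithin_le_nhds
  exact ht.frequently h1

theorem frequently_nhds_of_gt {p : ℂ → Prop} {a : ℝ} (h : ∀ x : ℝ, a < x → p x) :
    ∃ᶠ τ in 𝓝 (a : ℂ), p τ := by
  have h1 : ∃ᶠ x : ℝ in 𝓝[>] a, p (x : ℂ) :=
    (eventually_nhdsWithin_of_forall (s := Ioi a) fun x hx => h x hx).frequently
  have ht : Tendsto (fun x : ℝ => (x : ℂ)) (𝓝[>] a) (𝓝 (a : ℂ)) :=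
    (Complex.continuous_ofReal.tendsto a).mono_left nhdsWithin_le_nhds
  exact ht.frequently h1

theorem solCount_one_fifth : solCount D ((1 / 5 : ℝ) : ℂ) = 0 := by
  refine le_antisymm (le_zeroCount_of_frequently isOpen_D analyticOnNhd_quot
    (fun z hz => order_quot_ne_top _ hz) (frequently_nhds_of_lt fun x hx => ?_)) (zero_le)
  exact (solCount_of_lt hx).le

/-! ### Large levels -/

theorem zeroCount_le_one {f : ℂ → ℂ} {U : Set ℂ}
    (h : ∀ z ∈ U, ∀ w ∈ U, f z = 0 → f w = 0 → z = w)
    (h1 : ∀ z ∈ U, f z = 0 → analyticOrderAt f z = 1) : zeroCount f U ≤ 1 := by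
  by_cases hex : ∃ z ∈ U, f z = 0
  · obtain ⟨z, hz, hz0⟩ := hex
    refine (HasCount.zeroCount_eq ⟨{z}, ?_, ?_⟩).le
    · ext w
      simp only [Finset.coe_singleton, mem_singleton_iff, mem_sep_iff]
      exact ⟨fun hw => hw ▸ ⟨hz, hz0⟩, fun hw => h w hw.1 z hz hw.2 hz0⟩
    · simp [h1 z hz hz0]
  · push Not at hex
    rw [zeroCount_eq_zero hex]
    exact zero_le

theorem order_quot_eq_one {z τ : ℂ} (hz : z ∈ D) (h : quot z = τ) (hd : deriv quot z ≠ 0) :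
    analyticOrderAt (fun w => quot w - τ) z = 1 := by
  rw [← h]
  exact (analyticOnNhd_quot z hz).analyticOrderAt_sub_eq_one_of_deriv_ne_zero hd

theorem exists_bound_quot (R : ℝ) : ∃ B : ℝ, ∀ z ∈ upperClosed, ‖z‖ ≤ R → ‖quot z‖ ≤ B := by
  obtain ⟨B, hB⟩ := (isCompact_upperClosed_inter R).exists_bound_of_continuousOn
    (continuousOn_quot.mono fun z hz => hz.1)
  exact ⟨B, fun z hz hn => hB z ⟨hz, by simpa using hn⟩⟩

theorem exists_bound_quot_D (R : ℝ) : ∃ B : ℝ, ∀ z ∈ D, ‖z‖ ≤ R → ‖quot z‖ ≤ B := by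
  obtain ⟨B, hB⟩ := exists_bound_quot R
  refine ⟨B, fun z hz hn => ?_⟩
  rcases mem_upperClosed_or_conj z with h | h
  · exact hB z h hn
  · have := hB _ h (by simpa using hn)
    rw [quot_conj hz] at this
    simpa using this

/-- At levels exceeding the bound of `quot` on `‖h‖ ≤ R`, all solutions lie where `quot` is
injective with nonzero derivative. -/
theorem exists_solCount_le_one : ∃ B : ℝ, ∀ U ⊆ D, ∀ τ : ℂ, B < ‖τ‖ → solCount U τ ≤ 1 := by
  obtain ⟨R, hR, hinj, hd⟩ := exists_injOn_quot
  obtain ⟨B, hB⟩ := exists_bound_quot_D R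
  refine ⟨B, fun U hU τ hτ => ?_⟩
  have hlarge : ∀ z ∈ U, quot z - τ = 0 → R < ‖z‖ := by
    intro z hz h
    by_contra hle
    have := hB z (hU hz) (not_lt.1 hle)
    rw [sub_eq_zero.1 h] at this
    linarith
  refine zeroCount_le_one (fun z hz w hw h1 h2 => ?_) fun z hz h1 => ?_
  · exact hinj ⟨hU hz, hlarge z hz h1⟩ ⟨hU hw, hlarge w hw h2⟩
      ((sub_eq_zero.1 h1).trans (sub_eq_zero.1 h2).symm)
  · exact order_quot_eq_one (hU hz) (sub_eq_zero.1 h1) (hd z (hU hz) (hlarge z hz h1))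

/-! ### The number of solutions of `I₂ / I₀ = τ` for real `τ` -/

theorem exists_im_quot_ge : ∃ R : ℝ, ∀ h : ℝ, h < -R → 1 ≤ (quot h).im := by
  -- Then `s = iη` with `η ≥ 1600`, and `Im quot = η Re ratio + Im ratio ≥ 1600 / 320 - 4 = 1`.
  refine ⟨1600 ^ 2, fun h hh => ?_⟩
  have e : (1 + 4 * (h : ℂ)) = ((1 + 4 * h : ℝ) : ℂ) := by push_cast; rfl
  obtain ⟨h1, h2⟩ := csqrt_ofReal_eq (1 + 4 * h)
  rw [Real.sqrt_eq_zero_of_nonpos (by linarith)] at h1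
  have hη : 1600 ≤ √(-(1 + 4 * h)) := Real.le_sqrt_of_sq_le (by linarith)
  rw [quot_eq, e]
  set s := csqrt ((1 + 4 * h : ℝ) : ℂ)
  have hn : 2 ≤ ‖s‖ := by
    have := Complex.im_le_norm s
    linarith
  obtain ⟨h3, h4⟩ := ratio_bounds_quadrant (s := s) (by linarith) (by linarith) hn
  have h5 := (abs_le.1 ((Complex.abs_im_le_norm (ratio s)).trans h4)).1
  rw [Complex.mul_im]
  simp only [Complex.add_re, Complex.add_im, Complex.one_re, Complex.one_im, h1, h2]
  nlinarith

/-- On `h ≤ -1/4` the imaginary part vanishes only at `-1/4`, where the real part `1/5` is below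
`τ`. Compactness on a bounded interval and growth far out make the positivity uniform. -/
theorem exists_im_quot_boundary_ge {τ : ℝ} (hτ : 1 / 5 < τ) :
    ∃ ε > 0, ∀ h : ℝ, h ≤ -1 / 4 → τ ≤ (quot h).re → ε ≤ (quot h).im := by
  obtain ⟨R, hR⟩ := exists_im_quot_ge
  have hc : Continuous fun h : ℝ => quot h :=
    continuousOn_quot.comp_continuous Complex.continuous_ofReal fun h => by simp
  have hK : IsCompact (Icc (-R) (-1 / 4) ∩ {h : ℝ | τ ≤ (quot h).re}) :=
    isCompact_Icc.inter_right (isClosed_le continuous_const (Complex.continuous_re.comp hc))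
  have hpos : ∀ h ∈ Icc (-R) (-1 / 4) ∩ {h : ℝ | τ ≤ (quot h).re}, 0 < (quot h).im := by
    rintro h ⟨⟨-, h1⟩, h2⟩
    rcases h1.lt_or_eq with h1 | h1
    · exact quot_im_pos h1
    · exfalso
      have e : (h : ℂ) = -1 / 4 := by rw [h1]; push_cast; rfl
      rw [mem_ofPred_eq, e, quot_neg_quarter] at h2
      norm_num at h2
      linarith
  obtain ⟨ε, hε, h⟩ := hK.exists_forall_le' (Complex.continuous_im.comp hc).continuousOn hpos
  refine ⟨min ε 1, lt_min hε one_pos, fun x hx hxτ => ?_⟩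
  by_cases hxR : x < -R
  · exact (min_le_right _ _).trans (hR x hxR)
  · exact (min_le_left _ _).trans (h x ⟨⟨not_lt.1 hxR, hx⟩, hxτ⟩)

/-- On the real line `quot` never equals `x + iε`: its imaginary part is at least `ε₀` on the part
of `h ≤ -1/4` with real part at least `τ`, negative on `(-1/4, 0)`, and zero on `h ≥ 0`. -/
theorem exists_solutions_mem_upperOpen {τ : ℝ} (hτ : 1 / 5 < τ) : ∃ ε₀ > 0, ∀ ε : ℝ, 0 < ε →
    ε < ε₀ → ∀ x : ℝ, τ ≤ x → ∀ z ∈ upperClosed, quot z = x + ε * Complex.I → z ∈ upperOpen := by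
  obtain ⟨ε₀, h0, h⟩ := exists_im_quot_boundary_ge hτ
  refine ⟨ε₀, h0, fun ε hε hlt x hx z hz hq => ?_⟩
  have hre : (quot z).re = x := by rw [hq]; simp
  have him : (quot z).im = ε := by rw [hq]; simp
  rcases (show 0 ≤ z.im from hz).lt_or_eq with h1 | h1
  · exact h1
  exfalso
  have hzr : z = (z.re : ℂ) := Complex.ext (by simp) (by simpa using h1.symm)
  rw [hzr] at hre him
  rcases le_or_gt z.re (-1 / 4) with h2 | h2
  · have := h _ h2 (by linarith)
    linarith
  rcases lt_trichotomy z.re 0 with h3 | h3 | h3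
  · have := quot_im_neg h2 h3
    linarith
  · rw [h3, Complex.ofReal_zero, quot_zero] at him
    norm_num at him
    linarith
  · have := (quot_real h3).1
    linarith

/-- Along the real axis the level could not be followed to infinity, since solutions may meet the
real line. The parallel path at height `ε` avoids this; far out the count is at most one, and
semicontinuity returns the bound to `ε = 0`. -/
theorem solCount_upperOpen_le_one {τ : ℝ} (hτ : 1 / 5 < τ) : solCount upperOpen τ ≤ 1 := by
  obtain ⟨ε₀, h0, h⟩ := exists_solutions_mem_upperOpen hτ
  obtain ⟨B, hB⟩ := exists_solCount_le_one
  have key : ∀ ε : ℝ, 0 < ε → ε < ε₀ → solCount upperOpen (τ + ε * Complex.I) ≤ 1 := by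
    intro ε hε hlt
    have hc : Continuous fun y : ℝ => (y : ℂ) + ε * Complex.I := by fun_prop
    have heq := eq_of_preconnected (f := fun x => solCount upperOpen (x + ε * Complex.I))
      (s := Ici τ) isPreconnected_Ici
      (fun x hx => hc.continuousAt.eventually (eventually_solCount_upper (h ε hε hlt x hx)))
      (x := τ) (y := max τ (|B| + 1)) self_mem_Ici
      (mem_Ici.2 (le_max_left _ _))
    refine heq.trans_le (hB _ upperOpen_subset_D _ ?_)
    refine lt_of_lt_of_le ?_ (Complex.re_le_norm _)
    have h1 := le_max_right τ (|B| + 1)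
    have h2 := le_abs_self B
    simp only [Complex.add_re, Complex.ofReal_re, Complex.mul_re, Complex.ofReal_im,
      Complex.I_re, Complex.I_im]
    linarith
  refine le_zeroCount_of_frequently isOpen_upperOpen
    (analyticOnNhd_quot.mono upperOpen_subset_D)
    (fun z hz => order_quot_ne_top _ (upperOpen_subset_D hz)) ?_
  have h1 : ∃ᶠ ε : ℝ in 𝓝[>] 0,
      zeroCount (fun z => quot z - ((τ : ℂ) + ε * Complex.I)) upperOpen ≤ 1 :=
    Eventually.frequently (by
      filter_upwards [Ioo_mem_nhdsGT h0] with ε hε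
      exact key ε hε.1 hε.2)
  have ht : Tendsto (fun ε : ℝ => (τ : ℂ) + ε * Complex.I) (𝓝[>] 0) (𝓝 (τ : ℂ)) := by
    have hc : Continuous fun y : ℝ => (τ : ℂ) + y * Complex.I := by fun_prop
    have := (hc.tendsto 0).mono_left (nhdsWithin_le_nhds (s := Ioi 0))
    simpa using this
  exact ht.frequently h1

/-! ### Simple zeros and conjugate pairs obtained from counts. -/

theorem one_le_order {f : ℂ → ℂ} {z : ℂ} (hf : AnalyticAt ℂ f z) (h : f z = 0) :
    1 ≤ analyticOrderAt f z :=
  Order.one_le_iff_ne_zero.2 (analyticOrderAt_ne_zero.2 ⟨hf, h⟩)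

theorem one_le_zeroCount {f : ℂ → ℂ} {U : Set ℂ} {z : ℂ} (hz : z ∈ U) (hf : AnalyticAt ℂ f z)
    (h : f z = 0) : 1 ≤ zeroCount f U := by
  have := sum_le_zeroCount f (U := U) (s := {z}) (by simpa using hz)
  rw [Finset.sum_singleton] at this
  exact (one_le_order hf h).trans this

theorem eq_of_zeroCount_le_one {f : ℂ → ℂ} {U : Set ℂ} (hf : AnalyticOnNhd ℂ f U)
    (hle : zeroCount f U ≤ 1) {z : ℂ} (hz : z ∈ U) (h : f z = 0) :
    {w ∈ U | f w = 0} = {z} ∧ analyticOrderAt f z = 1 := by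
  classical
  refine ⟨?_, le_antisymm ?_ (one_le_order (hf z hz) h)⟩
  · ext w
    simp only [mem_sep_iff, mem_singleton_iff]
    refine ⟨fun hw => ?_, fun hw => hw ▸ ⟨hz, h⟩⟩
    by_contra hne
    have := (sum_le_zeroCount f (U := U) (s := {w, z}) (by
      intro v hv
      rcases Finset.mem_insert.1 (Finset.mem_coe.1 hv) with rfl | hv
      · exact hw.1
      · rw [Finset.mem_singleton.1 hv]; exact hz)).trans hle
    rw [Finset.sum_pair hne] at this
    have h2 := (add_le_add (one_le_order (hf w hw.1) hw.2) (one_le_order (hf z hz) h)).trans this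
    norm_num at h2
  · have := (sum_le_zeroCount f (U := U) (s := {z}) (by simpa using hz)).trans hle
    rwa [Finset.sum_singleton] at this

theorem exists_of_zeroCount_eq_one {f : ℂ → ℂ} {U : Set ℂ} (hf : AnalyticOnNhd ℂ f U)
    (h1 : zeroCount f U = 1) : ∃ z ∈ U, {w ∈ U | f w = 0} = {z} ∧ analyticOrderAt f z = 1 := by
  by_cases h : ∃ z ∈ U, f z = 0
  · obtain ⟨z, hz, h0⟩ := h
    exact ⟨z, hz, eq_of_zeroCount_le_one hf h1.le hz h0⟩
  · push Not at h
    rw [zeroCount_eq_zero h] at h1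
    exact absurd h1 zero_ne_one

theorem deriv_ne_zero_of_order_eq_one {z τ : ℂ} (hz : z ∈ D) (h : quot z = τ)
    (ho : analyticOrderAt (fun w => quot w - τ) z = 1) : deriv quot z ≠ 0 := by
  subst h
  have h1 := (analyticOnNhd_quot z hz).analyticOrderAt_deriv_add_one
  rw [ho] at h1
  intro h0
  have h2 := one_le_order (analyticOnNhd_quot z hz).deriv h0
  have h3 := add_le_add_left h2 1
  rw [h1] at h3
  norm_num at h3

theorem deriv_quot_conj_ne_zero {z : ℂ} (hz : z ∈ D) (h : deriv quot z ≠ 0) :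
    deriv quot ((starRingEnd ℂ) z) ≠ 0 := by
  have h1 := (analyticOnNhd_quot z hz).differentiableAt.hasDerivAt.conj_conj
  have h2 : (starRingEnd ℂ) ∘ quot ∘ (starRingEnd ℂ) =ᶠ[𝓝 ((starRingEnd ℂ) z)] quot := by
    filter_upwards [isOpen_D.mem_nhds (conj_mem_D hz)] with w hw
    simp [Function.comp_apply, quot_conj hw]
  rw [← h2.deriv_eq, h1.deriv]
  simpa using h

theorem im_ne_zero_of_quot_eq {τ : ℝ} (hτ : τ < 1 / 2) {z : ℂ} (hz : z ∈ D) (h : quot z = τ) :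
    z.im ≠ 0 := by
  intro him
  have hre : 0 < z.re := by
    rcases Complex.mem_slitPlane_iff.1 hz with h | h
    · exact h
    · exact absurd him h
  have hzr : z = (z.re : ℂ) := Complex.ext (by simp) (by simpa using him)
  have := (quot_real hre).2
  rw [← hzr, h, Complex.ofReal_re] at this
  linarith

/-- As `quot ≥ 1/2` on `h > 0`, no solution is real. The upper half-plane then contains exactly one,
it is simple, and the lower half-plane contains its reflection. -/
theorem conj_pair_of_solution {τ : ℝ} (h1 : 1 / 5 < τ) (h2 : τ < 1 / 2) {w : ℂ} (hw : w ∈ D)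
    (hwτ : quot w = τ) : ∃ z ∈ D, z.im ≠ 0 ∧
      {v ∈ D | quot v - (τ : ℂ) = 0} = {z, (starRingEnd ℂ) z} ∧
      analyticOrderAt (fun v => quot v - (τ : ℂ)) z = 1 ∧
      analyticOrderAt (fun v => quot v - (τ : ℂ)) ((starRingEnd ℂ) z) = 1 := by
  have hup : ∀ v ∈ D, quot v = τ → v ∈ upperOpen ∨ (starRingEnd ℂ) v ∈ upperOpen := by
    intro v hv hvτ
    rcases lt_or_gt_of_ne (im_ne_zero_of_quot_eq h2 hv hvτ) with h | h
    · right
      change 0 < ((starRingEnd ℂ) v).im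
      simpa using h
    · exact Or.inl h
  obtain ⟨z, hz, hzτ⟩ : ∃ z ∈ upperOpen, quot z = τ := by
    rcases hup w hw hwτ with h | h
    · exact ⟨w, h, hwτ⟩
    · exact ⟨_, h, quot_conj_eq hw hwτ⟩
  have hzD := upperOpen_subset_D hz
  obtain ⟨hs, ho⟩ := eq_of_zeroCount_le_one
    ((analyticOnNhd_quot_sub τ).mono upperOpen_subset_D) (solCount_upperOpen_le_one h1) hz
    (sub_eq_zero.2 hzτ)
  have huniq : ∀ v ∈ upperOpen, quot v = τ → v = z := fun v hv hvτ => by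
    have : v ∈ ({z} : Set ℂ) := hs ▸ ⟨hv, sub_eq_zero.2 hvτ⟩
    exact this
  refine ⟨z, hzD, im_ne_zero_of_quot_eq h2 hzD hzτ, ?_, ho, ?_⟩
  · ext v
    simp only [mem_sep_iff, mem_insert_iff, mem_singleton_iff, sub_eq_zero]
    constructor
    · rintro ⟨hv, hvτ⟩
      rcases hup v hv hvτ with h | h
      · exact Or.inl (huniq v h hvτ)
      · right
        rw [← huniq _ h (quot_conj_eq hv hvτ), Complex.conj_conj]
    · rintro (rfl | rfl)
      · exact ⟨hzD, hzτ⟩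
      · exact ⟨conj_mem_D hzD, quot_conj_eq hzD hzτ⟩
  · exact order_quot_eq_one (conj_mem_D hzD) (quot_conj_eq hzD hzτ)
      (deriv_quot_conj_ne_zero hzD (deriv_ne_zero_of_order_eq_one hzD hzτ ho))

theorem solCount_eq_two_of_solution {τ : ℝ} (h1 : 1 / 5 < τ) (h2 : τ < 1 / 2) {w : ℂ} (hw : w ∈ D)
    (hwτ : quot w = τ) : solCount D τ = 2 := by
  classical
  obtain ⟨z, -, him, hs, ho, ho'⟩ := conj_pair_of_solution h1 h2 hw hwτ
  have hne : z ≠ (starRingEnd ℂ) z := fun h => him (Complex.conj_eq_iff_im.1 h.symm)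
  refine HasCount.zeroCount_eq ⟨{z, (starRingEnd ℂ) z}, by rw [hs]; simp, ?_⟩
  rw [Finset.sum_pair hne, ho, ho', one_add_one_eq_two]

/-! ### Real solutions and the exact counts. -/

theorem continuousOn_re_quot : ContinuousOn (fun x : ℝ => (quot x).re) univ :=
  (Complex.continuous_re.comp (continuousOn_quot.comp_continuous Complex.continuous_ofReal
    fun h => by simp)).continuousOn

theorem exists_real_solution {a b τ : ℝ} (ha : 0 ≤ a) (hab : a ≤ b)
    (h : ((quot a).re < τ ∧ τ < (quot b).re) ∨ ((quot b).re < τ ∧ τ < (quot a).re)) :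
    ∃ z ∈ D, quot z = τ := by
  have hc := continuousOn_re_quot.mono (subset_univ (Icc a b))
  obtain ⟨x, hx, hxτ⟩ : τ ∈ (fun x : ℝ => (quot x).re) '' Ioo a b := by
    rcases h with h | h
    · exact intermediate_value_Ioo hab hc h
    · exact intermediate_value_Ioo' hab hc h
  have h0 : 0 < x := ha.trans_lt hx.1
  refine ⟨x, ofReal_mem_D h0, Complex.ext ?_ ?_⟩
  · rw [Complex.ofReal_re]
    exact hxτ
  · rw [(quot_real h0).1, Complex.ofReal_im]

theorem one_le_solCount {τ z : ℂ} (hz : z ∈ D) (h : quot z = τ) : 1 ≤ solCount D τ :=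
  one_le_zeroCount hz (analyticOnNhd_quot_sub τ z hz) (sub_eq_zero.2 h)

theorem exists_solution_of_ne_zero {τ : ℂ} (h : solCount D τ ≠ 0) : ∃ z ∈ D, quot z = τ := by
  by_contra! hcon
  exact h (zeroCount_eq_zero fun z hz => sub_ne_zero.2 (hcon z hz))

theorem quot_ne_of_solCount_eq_zero {τ : ℂ} (h : solCount D τ = 0) {z : ℂ} (hz : z ∈ D) :
    quot z ≠ τ := fun hq => by
  have := one_le_solCount hz hq
  rw [h] at this
  norm_num at this

theorem solCount_eq_of_mem_Ioo {τ σ : ℝ} (h1 : τ ∈ Ioo (1 / 5 : ℝ) (4 / 5))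
    (h2 : σ ∈ Ioo (1 / 5 : ℝ) (4 / 5)) : solCount D τ = solCount D σ :=
  eq_of_preconnected (f := fun τ => solCount D τ) isPreconnected_Ioo
    (fun _ hx => eventually_solCount_D (mem_D_of_quot_eq_of_ne hx.1.ne' hx.2.ne)) h1 h2

/-- Between the levels `1/5` and `4/5` there are two solutions. -/
theorem solCount_eq_two {τ : ℝ} (h1 : 1 / 5 < τ) (h2 : τ < 4 / 5) : solCount D τ = 2 := by
  -- A reference level below `1/2`, where `solCount_eq_two_of_solution` applies once one solution is
  -- known.
  have hq : (1 / 4 : ℝ) ∈ Ioo (1 / 5 : ℝ) (4 / 5) := by constructor <;> norm_num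
  obtain ⟨b, hb, hb'⟩ := exists_quot_lt
  have hb2 := (quot_real hb).2
  -- A level strictly between `quot b` and `quot 0 = 4/5` is attained on `(0, b)`. Constancy of the
  -- count carries this existence to the level `1/4`.
  obtain ⟨z, hz, hzσ⟩ := exists_real_solution (a := 0) (b := b) (τ := ((quot b).re + 4 / 5) / 2)
    le_rfl hb.le (Or.inr ⟨by linarith, by
      rw [Complex.ofReal_zero, quot_zero]
      norm_num
      linarith⟩)
  have hone := one_le_solCount hz hzσ
  rw [solCount_eq_of_mem_Ioo (σ := 1 / 4) ⟨by linarith, by linarith⟩ hq] at hone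
  obtain ⟨w, hw, hwτ⟩ := exists_solution_of_ne_zero (Order.one_le_iff_ne_zero.1 hone)
  rw [solCount_eq_of_mem_Ioo ⟨h1, h2⟩ hq]
  exact solCount_eq_two_of_solution (by norm_num) (by norm_num) hw hwτ

/-- The intermediate value theorem between a point where `quot < 4/5` and a distant one. The strict
drop below `4/5` is what provides a solution in 𝓓 at the level `4/5` itself, besides the boundary
point `0`. -/
theorem exists_solution_of_ge {τ : ℝ} (hτ : 4 / 5 ≤ τ) : ∃ z ∈ D, quot z = τ := by
  obtain ⟨a, ha, ha'⟩ := exists_quot_lt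
  obtain ⟨R, hR, h⟩ := exists_norm_quot_gt τ
  have hb : 0 < a + R := by linarith
  have hn := h ((a + R : ℝ) : ℂ) (by simp) (by
    rw [Complex.norm_real, Real.norm_eq_abs, abs_of_pos hb]
    linarith)
  obtain ⟨h1, h2⟩ := quot_real hb
  have e : quot ((a + R : ℝ) : ℂ) = ((quot ((a + R : ℝ) : ℂ)).re : ℂ) :=
    Complex.ext (by simp) (by simpa using h1)
  rw [e, Complex.norm_real, Real.norm_eq_abs, abs_of_pos (by linarith)] at hn
  exact exists_real_solution ha.le (by linarith : a ≤ a + R) (Or.inl ⟨by linarith, hn⟩)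

/-- Above the level `4/5` there is one solution. -/
theorem solCount_eq_one_of_gt {τ : ℝ} (hτ : 4 / 5 < τ) : solCount D τ = 1 := by
  obtain ⟨z, hz, hzτ⟩ := exists_solution_of_ge hτ.le
  refine le_antisymm ?_ (one_le_solCount hz hzτ)
  obtain ⟨B, hB⟩ := exists_solCount_le_one
  have h := eq_of_preconnected (f := fun τ => solCount D τ) (s := Ioi (4 / 5)) isPreconnected_Ioi
    (fun x hx => eventually_solCount_D (mem_D_of_quot_eq_of_ne
      (ne_of_gt (lt_trans (by norm_num) hx)) (ne_of_gt hx))) (x := τ) (y := max τ (|B| + 1)) hτ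
    (lt_max_of_lt_left hτ)
  refine h.trans_le (hB D Subset.rfl _ ?_)
  refine lt_of_lt_of_le ?_ (Complex.re_le_norm _)
  have h1 := le_max_right τ (|B| + 1)
  have h2 := le_abs_self B
  rw [Complex.ofReal_re]
  linarith

theorem solCount_four_fifths : solCount D ((4 / 5 : ℝ) : ℂ) = 1 := by
  obtain ⟨z, hz, hzτ⟩ := exists_solution_of_ge (le_refl (4 / 5))
  exact le_antisymm (le_zeroCount_of_frequently isOpen_D analyticOnNhd_quot
    (fun z hz => order_quot_ne_top _ hz) (frequently_nhds_of_gt fun x hx =>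
      (solCount_eq_one_of_gt hx).le)) (one_le_solCount hz hzτ)

theorem solCount_eq_one {τ : ℝ} (hτ : 4 / 5 ≤ τ) : solCount D τ = 1 := by
  rcases hτ.lt_or_eq with h | h
  · exact solCount_eq_one_of_gt h
  · rw [← h]
    exact solCount_four_fifths

theorem solCount_eq_zero {τ : ℝ} (hτ : τ ≤ 1 / 5) : solCount D τ = 0 := by
  rcases hτ.lt_or_eq with h | h
  · exact solCount_of_lt h
  · rw [h]
    exact solCount_one_fifth

/-! ### Bifurcations of the solutions -/

theorem noSolution_near_zero {r : ℝ} {z τ : ℂ} (h1 : solCount D τ = 1) (hz : z ∈ D)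
    (hzτ : quot z = τ) (hr : r ≤ ‖z‖) : NoZeroIn (fun w => quot w - τ) (D ∩ Metric.ball 0 r) := by
  refine eq_empty_of_forall_notMem ?_
  rintro w ⟨⟨hw, hwr⟩, hw0⟩
  have : w ∈ ({z} : Set ℂ) := (eq_of_zeroCount_le_one (analyticOnNhd_quot_sub τ) h1.le hz
    (sub_eq_zero.2 hzτ)).1 ▸ ⟨hw, hw0⟩
  rw [mem_singleton_iff.1 this, mem_ball_zero_iff] at hwr
  linarith

theorem oneSimpleZeroIn_of_counts {f : ℂ → ℂ} {U V W : Set ℂ} (hf : AnalyticOnNhd ℂ f W)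
    (hW : W = U ∪ V) (hUV : Disjoint U V) (hU : HasCount f U 1) (h2 : zeroCount f W = 2) :
    OneSimpleZeroIn f V := by
  have hVW : V ⊆ W := hW ▸ subset_union_right
  have hUW : U ⊆ W := hW ▸ subset_union_left
  obtain ⟨z, hz, hz0⟩ : ∃ z ∈ V, f z = 0 := by
    by_contra! hcon
    have := (hU.of_subset hUW fun z hz h0 => by
      rw [hW] at hz
      exact hz.resolve_right fun hz => hcon z hz h0).zeroCount_eq
    rw [h2] at this
    norm_num at this
  have hle : zeroCount f V ≤ 1 := by
    obtain ⟨s, hs, hs1⟩ := hU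
    have hsU : (s : Set ℂ) ⊆ U := hs.trans_subset (sep_subset _ _)
    refine zeroCount_le_iff.2 fun t ht => ?_
    classical
    have hd : Disjoint s t := Finset.disjoint_coe.1 (hUV.mono hsU ht)
    have := sum_le_zeroCount f (U := W) (s := s ∪ t) (by
      rw [Finset.coe_union]
      exact union_subset (hsU.trans hUW) (ht.trans hVW))
    rw [Finset.sum_union hd, hs1, h2, ← one_add_one_eq_two] at this
    exact (ENat.add_le_add_iff_left ENat.one_ne_top).1 this
  exact ⟨z, eq_of_zeroCount_le_one (hf.mono hVW) hle hz hz0⟩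

/-- At level `4/5` the solutions are one simple point `z` of 𝓓 and the boundary point `0`. If `r <
‖z‖`, exactly one solution stays outside the ball for nearby levels. The total is one at or above
`4/5` and two below, so the ball contains none or one. -/
theorem crossing_zero : ∃ r₀ : ℝ, 0 < r₀ ∧ ∀ r : ℝ, 0 < r → r < r₀ →
    (∀ᶠ τ : ℝ in 𝓝 (4 / 5), 4 / 5 ≤ τ →
      NoZeroIn (fun z => quot z - (τ : ℂ)) (D ∩ Metric.ball 0 r)) ∧
    (∀ᶠ τ : ℝ in 𝓝 (4 / 5), τ < 4 / 5 →
      OneSimpleZeroIn (fun z => quot z - (τ : ℂ)) (D ∩ Metric.ball 0 r)) := by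
  obtain ⟨z, hz, hs, ho⟩ := exists_of_zeroCount_eq_one (analyticOnNhd_quot_sub _)
    solCount_four_fifths
  have huniq : ∀ w ∈ D, quot w = ((4 / 5 : ℝ) : ℂ) → w = z := fun w hw h => by
    have : w ∈ ({z} : Set ℂ) := hs ▸ ⟨hw, sub_eq_zero.2 h⟩
    exact this
  have hzτ : quot z = ((4 / 5 : ℝ) : ℂ) := by
    have : z ∈ {w ∈ D | quot w - ((4 / 5 : ℝ) : ℂ) = 0} := hs ▸ mem_singleton z
    exact sub_eq_zero.1 this.2
  have hconj := huniq _ (conj_mem_D hz) (quot_conj_eq hz hzτ)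
  refine ⟨‖z‖, norm_pos_iff.2 (Complex.slitPlane_ne_zero hz), fun r hr hrz => ?_⟩
  have hdisj : Disjoint (Metric.ball (0 : ℂ) r) (D \ Metric.ball 0 r) := disjoint_sdiff_right
  have hn : D \ Metric.ball 0 r ∈ 𝓝 z := by
    filter_upwards [isOpen_D.mem_nhds hz, continuous_norm.continuousAt.eventually_const_lt hrz]
      with w h1 h2
    exact ⟨h1, fun h => by rw [mem_ball_zero_iff] at h; linarith⟩
  obtain ⟨-, -, hev, -⟩ := eventually_hasCount_D (τ₀ := 4 / 5) (S := {z}) (U := D \ Metric.ball 0 r)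
    (V := Metric.ball 0 r) sdiff_subset (fun w hw => by rw [Finset.mem_singleton.1 hw]; exact ⟨hn, hzτ⟩) Metric.isOpen_ball hdisj
    fun w hw hwτ => by
      rcases mem_D_of_quot_eq hwτ with h | h | h
      · left
        rw [huniq w h hwτ, hconj]
        simp
      · norm_num at h
      · right
        rw [h.1, map_zero]
        simp [hr]
  rw [Finset.sum_singleton, ho] at hev
  constructor
  · filter_upwards [hev] with τ hτ h
    obtain ⟨w, hw, hwτ⟩ : ∃ w ∈ D \ Metric.ball 0 r, quot w - (τ : ℂ) = 0 := by
      by_contra! hcon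
      have := hτ.zeroCount_eq
      rw [zeroCount_eq_zero hcon] at this
      exact zero_ne_one this
    refine noSolution_near_zero (solCount_eq_one h) hw.1 (sub_eq_zero.1 hwτ) ?_
    simpa using hw.2
  · filter_upwards [hev, lt_mem_nhds (show (1 / 5 : ℝ) < 4 / 5 by norm_num)] with τ hτ h1 h2
    exact oneSimpleZeroIn_of_counts (analyticOnNhd_quot_sub τ)
      (by rw [inter_comm, inter_comm, sdiff_union_inter]) (hdisj.symm.mono_right inter_subset_right)
      hτ (solCount_eq_two h1 h2)

/-- At level `1/5` the only solution in the closed upper half-plane is the boundary point `-1/4`, so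
just above this level the whole conjugate pair lies near it. -/
theorem crossing_neg_quarter {r : ℝ} (hr : 0 < r) :
    (∀ᶠ τ : ℝ in 𝓝 (1 / 5), 1 / 5 < τ →
      ConjPairOfZerosIn (fun z => quot z - (τ : ℂ)) (D ∩ Metric.ball (-1 / 4) r)) ∧
    (∀ τ : ℝ, τ ≤ 1 / 5 →
      NoZeroIn (fun z => quot z - (τ : ℂ)) (D ∩ Metric.ball (-1 / 4) r)) := by
  constructor
  · have hconj : (starRingEnd ℂ) (-1 / 4) = -1 / 4 := by
      rw [map_div₀, map_neg, map_one, map_ofNat]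
    have hev := eventually_solutions_mem_D (τ₀ := 1 / 5) (W := Metric.ball (-1 / 4) r)
      Metric.isOpen_ball fun w hw hwτ => by
        rcases mem_D_of_quot_eq hwτ with h | h | h
        · exact absurd hwτ (quot_ne_of_solCount_eq_zero solCount_one_fifth h)
        · rw [h.1, hconj]
          simp [hr]
        · norm_num at h
    filter_upwards [hev, gt_mem_nhds (show (1 / 5 : ℝ) < 1 / 2 by norm_num)] with τ h h2 h1
    obtain ⟨w, hw, hwτ⟩ := exists_solution_of_ne_zero (τ := (τ : ℂ)) (by
      rw [solCount_eq_two h1 (by linarith)]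
      exact two_ne_zero)
    obtain ⟨z, -, him, hs, ho, ho'⟩ := conj_pair_of_solution h1 h2 hw hwτ
    refine ⟨z, him, ?_, ho, ho'⟩
    rw [← hs]
    ext v
    exact ⟨fun hv => ⟨hv.1.1, hv.2⟩, fun hv => ⟨⟨hv.1, h v hv.1 (sub_eq_zero.1 hv.2)⟩, hv.2⟩⟩
  · intro τ hτ
    refine eq_empty_of_forall_notMem ?_
    rintro w ⟨⟨hw, -⟩, hw0⟩
    exact quot_ne_of_solCount_eq_zero (solCount_eq_zero hτ) hw (sub_eq_zero.1 hw0)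

/-- Since `quot` is bounded on `‖h‖ ≤ r`, the unique solution at a large positive level lies
outside. -/
theorem crossing_infinity (r : ℝ) :
    (∀ τ : ℝ, τ ≤ 1 / 5 → NoZeroIn (fun z => quot z - (τ : ℂ)) (D \ Metric.closedBall 0 r)) ∧
    (∀ᶠ τ : ℝ in atTop,
      OneSimpleZeroIn (fun z => quot z - (τ : ℂ)) (D \ Metric.closedBall 0 r)) := by
  constructor
  · intro τ hτ
    refine eq_empty_of_forall_notMem ?_
    rintro w ⟨⟨hw, -⟩, hw0⟩
    exact quot_ne_of_solCount_eq_zero (solCount_eq_zero hτ) hw (sub_eq_zero.1 hw0)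
  · obtain ⟨B, hB⟩ := exists_bound_quot_D r
    filter_upwards [eventually_gt_atTop B, eventually_ge_atTop (4 / 5)] with τ h1 h2
    obtain ⟨z, hz, hs, ho⟩ := exists_of_zeroCount_eq_one (analyticOnNhd_quot_sub τ)
      (solCount_eq_one h2)
    have hout : ∀ w ∈ D, quot w - (τ : ℂ) = 0 → w ∉ Metric.closedBall 0 r := by
      intro w hw hw0 hb
      have := hB w hw (by simpa using hb)
      rw [sub_eq_zero.1 hw0, Complex.norm_real] at this
      have := (le_abs_self τ).trans this
      linarith
    refine ⟨z, ?_, ho⟩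
    rw [← hs]
    ext w
    exact ⟨fun hw => ⟨hw.1.1, hw.2⟩, fun hw => ⟨⟨hw.1, hout w hw.1 hw.2⟩, hw.2⟩⟩

/-! ### From `I₂ / I₀` to `M₁` -/

theorem M₁_eq_mul (t : ℝ) {z : ℂ} (hz : I 0 z ≠ 0) :
    M₁ t 1 z = I 0 z * (quot z - ((-t : ℝ) : ℂ)) := by
  unfold M₁ quot
  push_cast
  field_simp
  ring

theorem M₁_eq_zero_iff (t : ℝ) {z : ℂ} (hz : I 0 z ≠ 0) :
    M₁ t 1 z = 0 ↔ quot z - ((-t : ℝ) : ℂ) = 0 := by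
  rw [M₁_eq_mul t hz, mul_eq_zero, or_iff_right hz]

theorem order_M₁ (t : ℝ) {z : ℂ} (hz : z ∈ D) :
    analyticOrderAt (M₁ t 1) z = analyticOrderAt (fun w => quot w - ((-t : ℝ) : ℂ)) z := by
  have h0 := analyticOnNhd_I_zero z hz
  have heq : M₁ t 1 =ᶠ[𝓝 z] (I 0 * fun w => quot w - ((-t : ℝ) : ℂ)) := by
    filter_upwards [isOpen_D.mem_nhds hz] with w hw
    exact M₁_eq_mul t (I_zero_ne_zero_of_mem_D hw)
  rw [analyticOrderAt_congr heq, analyticOrderAt_mul h0 (analyticOnNhd_quot_sub _ z hz),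
    h0.analyticOrderAt_eq_zero.2 (I_zero_ne_zero_of_mem_D hz), zero_add]

theorem zeros_M₁ (t : ℝ) {S : Set ℂ} (hS : S ⊆ D) :
    {w ∈ S | M₁ t 1 w = 0} = {w ∈ S | quot w - ((-t : ℝ) : ℂ) = 0} := by
  ext w
  exact and_congr_right fun hw => M₁_eq_zero_iff t (I_zero_ne_zero_of_mem_D (hS hw))

theorem noZeroIn_M₁ {t : ℝ} {S : Set ℂ} (hS : S ⊆ D)
    (h : NoZeroIn (fun w => quot w - ((-t : ℝ) : ℂ)) S) : NoZeroIn (M₁ t 1) S := by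
  unfold NoZeroIn
  rw [zeros_M₁ t hS]
  exact h

theorem oneSimpleZeroIn_M₁ {t : ℝ} {S : Set ℂ} (hS : S ⊆ D)
    (h : OneSimpleZeroIn (fun w => quot w - ((-t : ℝ) : ℂ)) S) : OneSimpleZeroIn (M₁ t 1) S := by
  obtain ⟨z, hs, ho⟩ := h
  have hz : z ∈ {w ∈ S | quot w - ((-t : ℝ) : ℂ) = 0} := hs ▸ mem_singleton z
  exact ⟨z, by rw [zeros_M₁ t hS, hs], by rw [order_M₁ t (hS hz.1), ho]⟩

theorem conjPairOfZerosIn_M₁ {t : ℝ} {S : Set ℂ} (hS : S ⊆ D)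
    (h : ConjPairOfZerosIn (fun w => quot w - ((-t : ℝ) : ℂ)) S) :
    ConjPairOfZerosIn (M₁ t 1) S := by
  obtain ⟨z, him, hs, ho, ho'⟩ := h
  have hz : z ∈ {w ∈ S | quot w - ((-t : ℝ) : ℂ) = 0} := hs ▸ mem_insert _ _
  have hzD := hS hz.1
  exact ⟨z, him, by rw [zeros_M₁ t hS, hs], by rw [order_M₁ t hzD, ho],
    by rw [order_M₁ t (conj_mem_D hzD), ho']⟩

theorem M₁_one_zero : M₁ 1 0 = I 0 := by
  funext z
  simp [M₁]

theorem Z_pt (t : ℝ) : Z (pt t) = solCount D ((-t : ℝ) : ℂ) := by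
  unfold pt
  rw [Z_mk]
  exact zeroCount_congr fun z hz => order_M₁ t hz

theorem Z_ptInf : Z ptInf = 0 := by
  unfold ptInf
  rw [Z_mk]
  refine zeroCount_eq_zero fun z hz => ?_
  rw [M₁_one_zero]
  exact I_zero_ne_zero_of_mem_D hz

theorem Z_pt_one {t : ℝ} (h : t ≤ -4 / 5) : Z (pt t) = 1 := by
  rw [Z_pt, solCount_eq_one (by linarith)]

theorem Z_pt_two {t : ℝ} (h1 : -4 / 5 < t) (h2 : t < -1 / 5) : Z (pt t) = 2 := by
  rw [Z_pt, solCount_eq_two (by linarith) (by linarith)]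

theorem Z_pt_zero {t : ℝ} (h : -1 / 5 ≤ t) : Z (pt t) = 0 := by
  rw [Z_pt, solCount_eq_zero (by linarith)]

/-! ### The projective line -/

theorem mk_eq_pt {v : ℝ × ℝ} (hv : v ≠ 0) (h : v.2 ≠ 0) :
    Projectivization.mk ℝ v hv = pt (v.1 / v.2) := by
  refine (Projectivization.mk_eq_mk_iff' ℝ _ _ _ _).2 ⟨v.2, ?_⟩
  ext
  · simp [mul_div_cancel₀ _ h]
  · simp

theorem eq_pt_or_eq_ptInf (p : ℙ ℝ (ℝ × ℝ)) : (∃ t, p = pt t) ∨ p = ptInf := by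
  induction p using Projectivization.ind with
  | h v hv =>
    by_cases h : v.2 = 0
    · right
      refine (Projectivization.mk_eq_mk_iff' ℝ _ _ _ _).2 ⟨v.1, ?_⟩
      ext
      · simp
      · simp [h]
    · exact Or.inl ⟨_, mk_eq_pt hv h⟩

theorem Z_le_two (p : ℙ ℝ (ℝ × ℝ)) : Z p ≤ 2 := by
  rcases eq_pt_or_eq_ptInf p with ⟨t, rfl⟩ | rfl
  · rcases le_or_gt t (-4 / 5) with h1 | h1
    · rw [Z_pt_one h1]
      exact one_le_two
    rcases lt_or_ge t (-1 / 5) with h2 | h2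
    · rw [Z_pt_two h1 h2]
    · rw [Z_pt_zero h2]
      exact zero_le
  · rw [Z_ptInf]
    exact zero_le

theorem pt_mem_P {h : ℂ} (hh : 0 ≤ h.im) (t : ℝ) : pt t ∈ P h ↔ quot h = ((-t : ℝ) : ℂ) := by
  unfold pt
  rw [mk_mem_P, M₁_eq_zero_iff t (I_zero_ne_zero hh), sub_eq_zero]

theorem pt_mem_P_zero (t : ℝ) : pt t ∈ P 0 ↔ t = -4 / 5 := by
  rw [pt_mem_P (by simp), quot_zero, show (4 / 5 : ℂ) = ((4 / 5 : ℝ) : ℂ) by push_cast; rfl,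
    Complex.ofReal_inj]
  constructor <;> intro h <;> linarith

theorem pt_mem_P_neg_quarter (t : ℝ) : pt t ∈ P (-1 / 4) ↔ t = -1 / 5 := by
  rw [pt_mem_P (by simp), quot_neg_quarter,
    show (1 / 5 : ℂ) = ((1 / 5 : ℝ) : ℂ) by push_cast; rfl, Complex.ofReal_inj]
  constructor <;> intro h <;> linarith

theorem pt_notMem_PInf (t : ℝ) : pt t ∉ PInf := by
  unfold pt
  rw [mk_mem_PInf]
  exact one_ne_zero

theorem ptInf_mem_PInf : ptInf ∈ PInf := by
  unfold ptInf
  rw [mk_mem_PInf]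

theorem ptInf_notMem_P {h : ℂ} (hh : 0 ≤ h.im) : ptInf ∉ P h := by
  unfold ptInf
  rw [mk_mem_P, M₁_one_zero]
  exact I_zero_ne_zero hh

theorem P_eq_singleton {h : ℂ} (hh : 0 ≤ h.im) {a : ℝ} (ha : ∀ t, pt t ∈ P h ↔ t = a) :
    P h = {pt a} := by
  ext p
  rw [mem_singleton_iff]
  refine ⟨fun hp => ?_, fun hp => hp ▸ (ha a).2 rfl⟩
  rcases eq_pt_or_eq_ptInf p with ⟨t, rfl⟩ | rfl
  · rw [(ha t).1 hp]
  · exact absurd hp (ptInf_notMem_P hh)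

theorem PInf_eq_singleton : PInf = {ptInf} := by
  ext p
  rw [mem_singleton_iff]
  refine ⟨fun hp => ?_, fun hp => hp ▸ ptInf_mem_PInf⟩
  rcases eq_pt_or_eq_ptInf p with ⟨t, rfl⟩ | rfl
  · exact absurd hp (pt_notMem_PInf t)
  · rfl

theorem isQuotientMap_mk : IsQuotientMap fun v : { v : ℝ × ℝ // v ≠ 0 } =>
    Projectivization.mk ℝ v.1 v.2 :=
  isQuotientMap_quotient_mk'

theorem continuous_mk {f : ℝ → ℝ × ℝ} (hf : Continuous f) (h0 : ∀ t, f t ≠ 0) :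
    Continuous fun t => Projectivization.mk ℝ (f t) (h0 t) :=
  isQuotientMap_mk.continuous.comp (hf.subtype_mk h0)

theorem continuous_pt : Continuous pt := continuous_mk (by fun_prop) _

/-- With continuity of `pt`, this makes `t` a local coordinate, so local constancy of `Z` at `pt t`
can be tested on the real line. -/
theorem isOpen_image_pt {O : Set ℝ} (hO : IsOpen O) : IsOpen (pt '' O) := by
  rw [← isQuotientMap_mk.isOpen_preimage]
  have e : (fun v : { v : ℝ × ℝ // v ≠ 0 } => Projectivization.mk ℝ v.1 v.2) ⁻¹' (pt '' O) =
      {v | v.1.2 ≠ 0 ∧ v.1.1 / v.1.2 ∈ O} := by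
    ext ⟨v, hv⟩
    simp only [mem_preimage, mem_image, mem_ofPred_eq]
    constructor
    · rintro ⟨t, ht, h⟩
      obtain ⟨a, ha⟩ := (Projectivization.mk_eq_mk_iff' ℝ _ _ _ _).1 h.symm
      have h1 : a * t = v.1 := by rw [← ha]; simp
      have h2 : a = v.2 := by rw [← ha]; simp
      have h3 : v.2 ≠ 0 := fun h0 => hv (by
        rw [h2, h0, zero_mul] at h1
        exact Prod.ext h1.symm h0)
      refine ⟨h3, ?_⟩
      rwa [← h1, h2, mul_div_cancel_left₀ _ h3]
    · rintro ⟨h, hO⟩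
      exact ⟨_, hO, (mk_eq_pt hv h).symm⟩
  rw [e, isOpen_iff_mem_nhds]
  rintro v ⟨hv, hvO⟩
  have hc : ContinuousAt (fun v : { v : ℝ × ℝ // v ≠ 0 } => v.1.1 / v.1.2) v :=
    ContinuousAt.div (by fun_prop) (by fun_prop) hv
  have hc2 : ContinuousAt (fun v : { v : ℝ × ℝ // v ≠ 0 } => v.1.2) v := by fun_prop
  filter_upwards [hc2.eventually_ne hv, hc.preimage_mem_nhds (hO.mem_nhds hvO)] with w h1 h2
  exact ⟨h1, h2⟩

theorem pt_mem_bifurcationSet_iff (t : ℝ) :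
    pt t ∈ bifurcationSet ↔ ¬ ∀ᶠ s in 𝓝 t, Z (pt s) = Z (pt t) := by
  refine not_congr ⟨fun h => continuous_pt.continuousAt.eventually h, fun h => ?_⟩
  obtain ⟨O, hO, hOo, hOt⟩ := eventually_nhds_iff.1 h
  filter_upwards [(isOpen_image_pt hOo).mem_nhds (mem_image_of_mem pt hOt)]
  rintro _ ⟨s, hs, rfl⟩
  exact hO s hs

theorem pt_mem_bifurcationSet_iff_eq (t : ℝ) :
    pt t ∈ bifurcationSet ↔ t = -4 / 5 ∨ t = -1 / 5 := by
  rw [pt_mem_bifurcationSet_iff]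
  constructor
  · contrapose!
    rintro ⟨h1, h2⟩
    rcases lt_or_gt_of_ne h1 with h | h
    · filter_upwards [gt_mem_nhds h] with s hs
      rw [Z_pt_one hs.le, Z_pt_one h.le]
    rcases lt_or_gt_of_ne h2 with h' | h'
    · filter_upwards [gt_mem_nhds h', lt_mem_nhds h] with s hs hs'
      rw [Z_pt_two hs' hs, Z_pt_two h h']
    · filter_upwards [lt_mem_nhds h'] with s hs
      rw [Z_pt_zero hs.le, Z_pt_zero h'.le]
  · rintro (rfl | rfl) hev
    · have h1 : ∀ᶠ s : ℝ in 𝓝[>] (-4 / 5), False := by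
        filter_upwards [hev.filter_mono nhdsWithin_le_nhds,
          Ioo_mem_nhdsGT (show (-4 / 5 : ℝ) < -1 / 5 by norm_num)] with s hs hs'
        rw [Z_pt_two hs'.1 hs'.2, Z_pt_one le_rfl] at hs
        norm_num at hs
      exact h1.exists.elim fun _ h => h
    · have h1 : ∀ᶠ s : ℝ in 𝓝[<] (-1 / 5), False := by
        filter_upwards [hev.filter_mono nhdsWithin_le_nhds,
          Ioo_mem_nhdsLT (show (-4 / 5 : ℝ) < -1 / 5 by norm_num)] with s hs hs'
        rw [Z_pt_two hs'.1 hs'.2, Z_pt_zero le_rfl] at hs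
        norm_num at hs
      exact h1.exists.elim fun _ h => h

/-- In the chart at infinity `[t : 1] = [1 : 1/t]`. This end suffices for the bifurcation at
`ptInf`, since `Z = 1` for very negative `t` and `Z ptInf = 0`. -/
theorem tendsto_pt_atBot : Tendsto pt atBot (𝓝 ptInf) := by
  have hc : Continuous fun s : ℝ => Projectivization.mk ℝ ((1, s) : ℝ × ℝ) (by simp) :=
    continuous_mk (by fun_prop) _
  have ht := (hc.tendsto 0).comp tendsto_inv_atBot_zero
  refine ht.congr' ?_
  filter_upwards [eventually_lt_atBot 0] with t ht0
  have h := mk_eq_pt (v := ((1, t⁻¹) : ℝ × ℝ)) (by simp) (inv_ne_zero ht0.ne)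
  rw [Function.comp_apply, h, one_div, inv_inv]

theorem ptInf_mem_bifurcationSet : ptInf ∈ bifurcationSet := fun hev => by
  obtain ⟨t, h1, h2⟩ := ((tendsto_pt_atBot.eventually hev).and
    (eventually_le_atBot (-4 / 5))).exists
  rw [Z_pt_one h2, Z_ptInf] at h1
  exact one_ne_zero h1

theorem bifurcationSet_eq : bifurcationSet = P 0 ∪ P (-1 / 4) ∪ PInf := by
  ext p
  rw [mem_union, mem_union]
  rcases eq_pt_or_eq_ptInf p with ⟨t, rfl⟩ | rfl
  · rw [pt_mem_bifurcationSet_iff_eq, pt_mem_P_zero, pt_mem_P_neg_quarter,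
      or_iff_left (pt_notMem_PInf t)]
  · exact iff_of_true ptInf_mem_bifurcationSet (Or.inr ptInf_mem_PInf)

theorem eventually_of_neg {p : ℝ → Prop} {a b : ℝ} (hab : -a = b) (h : ∀ᶠ τ in 𝓝 b, p τ) :
    ∀ᶠ t in 𝓝 a, p (-t) := by
  subst hab
  exact (continuous_neg.tendsto a).eventually h

end Duffing

theorem mainTheorem2 :
    -- `M₁` is holomorphic in the domain `𝓓`
    (∀ l0 l2 : ℝ, AnalyticOnNhd ℂ (M₁ l0 l2) D) ∧
    -- the bifurcation set consists of the points `P₀`, `P_{-1/4}`, `P_∞`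
    bifurcationSet = P 0 ∪ P (-1 / 4) ∪ PInf ∧
    P 0 = {pt (-4 / 5)} ∧ P (-1 / 4) = {pt (-1 / 5)} ∧ PInf = {ptInf} ∧
    -- the number of zeros on the arcs of the complement and at the three points
    (∀ t : ℝ, t < -4 / 5 → Z (pt t) = 1) ∧
    Z (pt (-4 / 5)) = 1 ∧
    (∀ t : ℝ, -4 / 5 < t → t < -1 / 5 → Z (pt t) = 2) ∧
    Z (pt (-1 / 5)) = 0 ∧
    (∀ t : ℝ, -1 / 5 < t → Z (pt t) = 0) ∧
    Z ptInf = 0 ∧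
    -- the number of zeros is at most two
    (∀ p : ℙ ℝ (ℝ × ℝ), Z p ≤ 2) ∧
    -- crossing `P₀`: one simple zero bifurcates from `h = 0`
    (∃ r₀ : ℝ, 0 < r₀ ∧ ∀ r : ℝ, 0 < r → r < r₀ →
      (∀ᶠ t in 𝓝[≤] (-4 / 5 : ℝ), NoZeroIn (M₁ t 1) (D ∩ Metric.ball 0 r)) ∧
      (∀ᶠ t in 𝓝[>] (-4 / 5 : ℝ), OneSimpleZeroIn (M₁ t 1) (D ∩ Metric.ball 0 r))) ∧
    -- crossing `P_{-1/4}`: a pair of complex conjugate zeros bifurcates from `h = -1/4`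
    (∃ r₀ : ℝ, 0 < r₀ ∧ ∀ r : ℝ, 0 < r → r < r₀ →
      (∀ᶠ t in 𝓝[<] (-1 / 5 : ℝ),
        ConjPairOfZerosIn (M₁ t 1) (D ∩ Metric.ball (-1 / 4) r)) ∧
      (∀ᶠ t in 𝓝[≥] (-1 / 5 : ℝ), NoZeroIn (M₁ t 1) (D ∩ Metric.ball (-1 / 4) r))) ∧
    -- crossing `P_∞`: one simple zero bifurcates from `h = ∞`
    (∃ r₀ : ℝ, 0 < r₀ ∧ ∀ r : ℝ, r₀ < r →
      (∀ᶠ t in atTop, NoZeroIn (M₁ t 1) (D \ Metric.closedBall 0 r)) ∧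
      NoZeroIn (M₁ 1 0) (D \ Metric.closedBall 0 r) ∧
      (∀ᶠ t in atBot, OneSimpleZeroIn (M₁ t 1) (D \ Metric.closedBall 0 r))) := by
  -- The crossings at `-1/4` and at infinity hold for every admissible radius, so the threshold `1`
  -- there is arbitrary.
  refine ⟨analyticOnNhd_M₁, bifurcationSet_eq, P_eq_singleton (by simp) pt_mem_P_zero,
    P_eq_singleton (by simp) pt_mem_P_neg_quarter, PInf_eq_singleton, fun t ht => Z_pt_one ht.le,
    Z_pt_one le_rfl, fun t h1 h2 => Z_pt_two h1 h2, Z_pt_zero le_rfl, fun t ht => Z_pt_zero ht.le,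
    Z_ptInf, Z_le_two, ?_, ⟨1, one_pos, fun r hr _ => ⟨?_, ?_⟩⟩,
    ⟨1, one_pos, fun r _ => ⟨?_, ?_, ?_⟩⟩⟩
  · obtain ⟨r₀, hr₀, h⟩ := crossing_zero
    refine ⟨r₀, hr₀, fun r hr hlt => ?_⟩
    obtain ⟨h1, h2⟩ := h r hr hlt
    constructor
    · filter_upwards [(eventually_of_neg (by norm_num) h1).filter_mono nhdsWithin_le_nhds,
        self_mem_nhdsWithin] with t ht hle
      have : t ≤ -4 / 5 := hle
      exact noZeroIn_M₁ inter_subset_left (ht (by linarith))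
    · filter_upwards [(eventually_of_neg (by norm_num) h2).filter_mono nhdsWithin_le_nhds,
        self_mem_nhdsWithin] with t ht hlt
      have : -4 / 5 < t := hlt
      exact oneSimpleZeroIn_M₁ inter_subset_left (ht (by linarith))
  · filter_upwards [(eventually_of_neg (by norm_num)
      (crossing_neg_quarter hr).1).filter_mono nhdsWithin_le_nhds, self_mem_nhdsWithin] with t ht hlt
    have : t < -1 / 5 := hlt
    exact conjPairOfZerosIn_M₁ inter_subset_left (ht (by linarith))
  · filter_upwards [self_mem_nhdsWithin] with t ht
    have : -1 / 5 ≤ t := ht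
    exact noZeroIn_M₁ inter_subset_left ((crossing_neg_quarter hr).2 _ (by linarith))
  · filter_upwards [eventually_ge_atTop 0] with t ht
    exact noZeroIn_M₁ sdiff_subset ((crossing_infinity r).1 _ (by linarith))
  · refine eq_empty_of_forall_notMem ?_
    rintro w ⟨⟨hw, -⟩, hw0⟩
    rw [M₁_one_zero] at hw0
    exact I_zero_ne_zero_of_mem_D hw hw0
  · filter_upwards [tendsto_neg_atBot_atTop.eventually (crossing_infinity r).2] with t ht
    exact oneSimpleZeroIn_M₁ sdiff_subset ht
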